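/- **Setting.** For a regular curve $c:[0,1]\to\mathbb R^2$ write $\partial_s=|\partial_x c|^{-1}\partial_x$, $ds=|\partial_x c|\,dx$, $\tau=\partial_s c$, $\nu=R\tau$ ($R$ the counterclockwise rotation by $\pi/2$), and define the curvature $\kappa_c$ by $\partial_s^2c=\kappa_c\nu$. Let $P,Q\in\mathbb R^2$ and let $\overline\gamma$ be a regular immersed plane curve, parametrized with constant speed on $[0,1]$, of class $C^{4+\alpha}$ for some $\alpha\in(0,1)$, with $\overline\gamma(0)=P$, $\overline\gamma(1)=Q$ and $\kappa_{\overline\gamma}=0$ at both end points. For $\varepsilon\in(0,1]$ let $\gamma_\varepsilon:[0,\infty)\times[0,1]\to\mathbb R^2$, with each $\gamma_\varepsilon(t)=\gamma_\varepsilon(t,\cdot)$ regular and parametrized with constant speed, be a solution of $$(\partial_t\gamma_\varepsilon)^\perp=\kappa_{\gamma_\varepsilon(t)}\nu_{\gamma_\varepsilon(t)}-\varepsilon\big(2\partial_s^2\kappa_{\gamma_\varepsilon(t)}+\kappa_{\gamma_\varepsilon(t)}^3\big)\nu_{\gamma_\varepsilon(t)}\quad (t>0),$$ $$\gamma_\varepsilon(t,0)=P,\quad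 \gamma_\varepsilon(t,1)=Q,\quad \kappa_{\gamma_\varepsilon(t)}=0 \text{ at both end points},\quad \gamma_\varepsilon(0,\cdot)=\overline\gamma,$$ smooth on $(0,\infty)\times[0,1]$ and continuous on $[0,\infty)\times[0,1]$ together with $\partial_x\gamma_\varepsilon$ and $\partial_x^2\gamma_\varepsilon$. **Proposition.** There exists $T_{\max}>0$, depending only on $\overline\gamma$, such that for every $T\in(0,T_{\max})$ the following hold. 1. For every $j\in\mathbb N$ and every $\delta>0$, $$\sup_{\varepsilon\in(0,1]}\ \sup_{t\in[\delta,T]}\int_{\gamma_\varepsilon(t)}(\partial_s^j\kappa_{\gamma_\varepsilon(t)})^2\,ds<+\infty .$$ 2. For $j\in\{0,1,2\}$, $$\sup_{\varepsilon\in(0,1]}\ \sup_{t\in[0,T]}\int_{\gamma_\varepsilon(t)}(\partial_s^j\kappa_{\gamma_\varepsilon(t)})^2\,ds<+\infty .$$ 3. If moreover $\overline\gamma\in C^\infty([0,1])$ and all derivatives of $\overline\gamma$ of even order $\ge 2$ vanish at $0$ and $1$, then the estimate in 2 (with $t\in[0,T]$) holds for every $j\in\mathbb N$. The suprema are also taken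 over all solutions $\gamma_\varepsilon$ as above. -/

import Mathlib

open Set
open scoped ContDiff NNReal

noncomputable section

namespace ElasticFlow

/-- The Euclidean plane. -/
abbrev Plane : Type := EuclideanSpace ℝ (Fin 2)

/-- The parameter interval `[0, 1]`. -/
abbrev I : Set ℝ := Icc 0 1

/-- Counterclockwise rotation by `π / 2`. -/
def rot (v : Plane) : Plane := !₂[-v 1, v 0]

/-- The speed `|∂ₓ c|` of a curve `c : [0, 1] → ℝ²`. -/
def speed (c : ℝ → Plane) (x : ℝ) : ℝ := ‖derivWithin c I x‖

/-- The arclength derivative `∂ₛ f = |∂ₓ c|⁻¹ ∂ₓ f` of a function `f` along the curve `c`. -/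
def arcDeriv {E : Type*} [NormedAddCommGroup E] [NormedSpace ℝ E]
    (c : ℝ → Plane) (f : ℝ → E) (x : ℝ) : E :=
  (speed c x)⁻¹ • derivWithin f I x

/-- The unit tangent `τ = ∂ₛ c`. -/
def tangent (c : ℝ → Plane) : ℝ → Plane := arcDeriv c c

/-- The unit normal `ν = R τ`. -/
def normal (c : ℝ → Plane) (x : ℝ) : Plane := rot (tangent c x)

/-- The oriented curvature `κ`, given by `∂ₛ² c = κ ν`. -/
def curvature (c : ℝ → Plane) (x : ℝ) : ℝ :=
  inner ℝ (arcDeriv c (arcDeriv c c) x) (normal c x)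

/-- The `j`-th arclength derivative `∂ₛʲ κ` of the curvature. -/
def curvatureDeriv (c : ℝ → Plane) (j : ℕ) : ℝ → ℝ := (arcDeriv c)^[j] (curvature c)

/-- The integral `∫ f ds` along `c`, where `ds = |∂ₓ c| dx`. -/
def arcIntegral (c : ℝ → Plane) (f : ℝ → ℝ) : ℝ := ∫ x in (0 : ℝ)..1, f x * speed c x

/-- `c` is regular on `[0, 1]` and parametrized with constant speed (which is then its length). -/
def HasConstantSpeed (c : ℝ → Plane) : Prop := ∃ L : ℝ, 0 < L ∧ ∀ x ∈ I, speed c x = L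

/-- Admissible initial curves: regular, of class `C^{4+α}` for some `α ∈ (0, 1)`, joining `P` to `Q`,
with curvature vanishing at both end points; given in the constant speed parametrization. -/
structure IsInitialCurve (P Q : Plane) (c : ℝ → Plane) : Prop where
  constSpeed : HasConstantSpeed c
  contDiffOn : ContDiffOn ℝ 4 c I
  holder : ∃ α : ℝ≥0, 0 < α ∧ α < 1 ∧ ∃ K : ℝ≥0, HolderOnWith K α (iteratedDerivWithin 4 c I) I
  left : c 0 = P
  right : c 1 = Q
  curvature_left : curvature c 0 = 0
  curvature_right : curvature c 1 = 0

/-- `Υ t x`, for `t ≥ 0` and `x ∈ [0, 1]`, is the constant speed parametrization of a solution of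
`(∂ₜ γ)^⊥ = (κ - ε (2 ∂ₛ² κ + κ³)) ν` with fixed end points `P`, `Q`, vanishing curvature at the end
points and initial curve `c`. It is smooth for `t > 0`, and it is continuous up to `t = 0` together
with its space derivatives of order at most two; in particular every solution that belongs to the
parabolic Hölder class `C^{(4+α)/4, 4+α}` up to `t = 0` and is smooth for `t > 0` is covered. -/
structure IsSolution (ε : ℝ) (P Q : Plane) (c : ℝ → Plane) (Υ : ℝ → ℝ → Plane) : Prop where
  smooth : ContDiffOn ℝ ∞ (fun p : ℝ × ℝ => Υ p.1 p.2) (Ioi 0 ×ˢ I)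
  continuous_up_to_zero : ∀ k ≤ 2,
    ContinuousOn (fun p : ℝ × ℝ => iteratedDerivWithin k (Υ p.1) I p.2) (Ici 0 ×ˢ I)
  constSpeed : ∀ t, 0 ≤ t → HasConstantSpeed (Υ t)
  initial : ∀ x ∈ I, Υ 0 x = c x
  left : ∀ t, 0 ≤ t → Υ t 0 = P
  right : ∀ t, 0 ≤ t → Υ t 1 = Q
  curvature_left : ∀ t, 0 ≤ t → curvature (Υ t) 0 = 0
  curvature_right : ∀ t, 0 ≤ t → curvature (Υ t) 1 = 0
  motion : ∀ t, 0 < t → ∀ x ∈ I,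
    inner ℝ (deriv (fun τ => Υ τ x) t) (normal (Υ t) x) =
      curvature (Υ t) x - ε * (2 * curvatureDeriv (Υ t) 2 x + curvature (Υ t) x ^ 3)

/-- `∫ (∂ₛʲ κ)² ds` is bounded uniformly over `ε ∈ (0, 1]`, over the solutions with parameter `ε`
and initial curve `c`, and over the times `t ∈ S`. -/
def UniformlyBounded (P Q : Plane) (c : ℝ → Plane) (j : ℕ) (S : Set ℝ) : Prop :=
  ∃ C : ℝ, ∀ ε ∈ Ioc (0 : ℝ) 1, ∀ Υ : ℝ → ℝ → Plane, IsSolution ε P Q c Υ →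
    ∀ t ∈ S, arcIntegral (Υ t) (fun x => curvatureDeriv (Υ t) j x ^ 2) ≤ C

end ElasticFlow

end

/-!
The estimates are obtained for the scalar curvature in the constant speed parametrization, uniformly
in `ε`. With `V = κ - ε (2 ∂ₛ² κ + κ³)`, length `ℓ` and tangential velocity `Λ`, the flow becomes
`∂ₜ κ = ∂ₛ² V + κ² V + Λ ∂ₛ κ`, `∂ₛ Λ = κ V + ℓ'/ℓ`, with `κ = V = Λ = 0` at the end points
(`IsSolution.exists_curvFlow`). Differentiating `∂ₛ²ⁱ κ = 0` in time at an end point gives, as `ε > 0`,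
the next even derivative, so at positive times all even derivatives of `κ` vanish at the ends
(`CurvFlow.oddEnds`). Hence no integration by parts leaves a boundary term, the sequence `‖∂ₛⁱ κ‖` of
`L²(ds)` norms is log-convex, and every `∂ₛⁱ κ` has a zero. This makes interpolation homogeneous: with
`z ^ (4 l) = max 1 ‖∂ₛˡ κ‖²` one has `‖∂ₛⁱ κ‖ ≤ M z ^ (2 i)` and `sup |∂ₛⁱ κ| ≤ 2 M z ^ (2 i + 1)`,
where `‖κ‖ ≤ M`, and no constant depends on the length. Nonlinear terms are then estimated by counting
weights (`SupW`, `L2W`).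

*Energy inequalities.* The evolution of `‖∂ₛʲ κ‖²` has the good terms `-2 ‖∂ₛʲ⁺¹ κ‖²` and
`-4 ε ‖∂ₛʲ⁺² κ‖²`. The nonlinear terms without `ε` have weight `4 (j + 1) - 2` and are absorbed by the
first, those with the factor `ε` have weight `4 (j + 2) - 2` and are absorbed by the second; so
`(‖∂ₛʲ κ‖²)' ≤ -‖∂ₛʲ⁺¹ κ‖² + C` with `C = C(j, M)` (`exists_energyRate_le`). For `j = 0` the more
precise inequality `(‖κ‖²)' ≤ (‖κ‖²)³` (`energyRate_zero_le`) determines `Tmax` and `M` from the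
initial curve (`CurvFlow.nrm_sq_le`). Induction on `j` gives the bounds on `[δ, T]`
(`exists_bound_of_pos`): a bound for `‖∂ₛʲ κ‖²` yields a time in `[δ/2, δ]` at which `‖∂ₛʲ⁺¹ κ‖²` is
bounded, and from there on it grows at most linearly.

*The initial time.* Solutions are only known to be continuous up to `t = 0` with two space
derivatives, so the energy of order `j + 2` has to be compared with its initial value by an
additional argument. Let `φ` be the initial curvature, and assume that its even derivatives of order
at most `j + 1` vanish at the ends. If `∂ₛʲ κ → φ⁽ʲ⁾` in `L²` as `t → 0`, then the derivative of
`‖∂ₛʲ (κ - φ)‖²` is at most `-2 ε (‖∂ₛʲ⁺² κ‖² - ‖∂ₛʲ⁺² φ‖²)` up to an error that is small compared with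
`1 + ‖∂ₛʲ⁺² κ‖²` (`exists_comparison_rate_le`). Since this nonnegative quantity starts from zero, it
cannot decrease strictly, so `‖∂ₛʲ⁺² κ‖²` is bounded in terms of `φ` at arbitrarily small times
(`BddFlow.exists_energy_le`), and the energy inequality extends the bound to `(0, T]`. Interpolation
gives the `L²` convergence of `∂ₛʲ⁺¹ κ`, and the argument can be repeated
(`exists_bound_of_compatible`). For a `C⁴` initial curve whose curvature vanishes at the ends it
applies with `j = 0`, which controls `∂ₛ² κ`; under the compatibility conditions of all orders it
applies with every `j`.
-/

noncomputable section

namespace ElasticFlow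

/-! ### Functions on `[0, 1]`: arclength derivative at constant speed, `L²` norm -/

/-- The arclength derivative along a curve of constant speed `ℓ`, i.e. `ℓ⁻¹ ∂ₓ`, for real functions
on `[0, 1]` (one-sided at the end points). -/
def dS (ℓ : ℝ) (f : ℝ → ℝ) (x : ℝ) : ℝ := ℓ⁻¹ * derivWithin f I x

/-- Smoothness on the closed interval `[0, 1]`. -/
abbrev Smooth (f : ℝ → ℝ) : Prop := ContDiffOn ℝ ∞ f I

lemma uniqueDiffOn_I : UniqueDiffOn ℝ I := uniqueDiffOn_Icc zero_lt_one

lemma zero_mem_I : (0 : ℝ) ∈ I := left_mem_Icc.2 zero_le_one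

lemma one_mem_I : (1 : ℝ) ∈ I := right_mem_Icc.2 zero_le_one

lemma dS_congr (ℓ : ℝ) {f g : ℝ → ℝ} (h : EqOn f g I) : EqOn (dS ℓ f) (dS ℓ g) I := by
  intro x hx
  simp only [dS]
  rw [derivWithin_congr h (h hx)]

lemma dS_iterate_congr (ℓ : ℝ) (n : ℕ) {f g : ℝ → ℝ} (h : EqOn f g I) :
    EqOn ((dS ℓ)^[n] f) ((dS ℓ)^[n] g) I := by
  induction n generalizing f g with
  | zero => exact h
  | succ n ih => exact ih (dS_congr ℓ h)

lemma contDiffOn_dS {m n : WithTop ℕ∞} (ℓ : ℝ) {f : ℝ → ℝ} (hf : ContDiffOn ℝ n f I)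
    (hmn : m + 1 ≤ n) : ContDiffOn ℝ m (dS ℓ f) I :=
  contDiffOn_const.mul (hf.derivWithin uniqueDiffOn_I hmn)

lemma Smooth.dS {f : ℝ → ℝ} (hf : Smooth f) (ℓ : ℝ) : Smooth (dS ℓ f) :=
  contDiffOn_dS ℓ hf le_rfl

lemma Smooth.iter {f : ℝ → ℝ} (hf : Smooth f) (ℓ : ℝ) (n : ℕ) :
    Smooth ((ElasticFlow.dS ℓ)^[n] f) := by
  induction n generalizing f with
  | zero => exact hf
  | succ n ih => exact ih (hf.dS ℓ)

lemma contDiffOn_iterate_dS (ℓ : ℝ) (n m : ℕ) {f : ℝ → ℝ} (hf : ContDiffOn ℝ ((n + m : ℕ)) f I) :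
    ContDiffOn ℝ m ((dS ℓ)^[n] f) I := by
  induction n generalizing f with
  | zero => simpa using hf
  | succ n ih =>
    refine ih (contDiffOn_dS ℓ hf ?_)
    norm_cast
    omega

lemma Smooth.differentiableOn {f : ℝ → ℝ} (hf : Smooth f) : DifferentiableOn ℝ f I :=
  ContDiffOn.differentiableOn hf (by simp)

lemma dS_add (ℓ : ℝ) {f g : ℝ → ℝ} (hf : DifferentiableOn ℝ f I) (hg : DifferentiableOn ℝ g I) :
    EqOn (dS ℓ (f + g)) (dS ℓ f + dS ℓ g) I := by
  intro x hx
  simp only [dS, Pi.add_apply]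
  rw [derivWithin_add (hf x hx) (hg x hx)]
  ring

lemma dS_smul (ℓ c : ℝ) (f : ℝ → ℝ) : dS ℓ (c • f) = c • dS ℓ f := by
  funext x
  simp only [dS, Pi.smul_apply, smul_eq_mul]
  rw [derivWithin_const_smul_field]
  simp only [smul_eq_mul]
  ring

lemma dS_mul (ℓ : ℝ) {f g : ℝ → ℝ} (hf : DifferentiableOn ℝ f I) (hg : DifferentiableOn ℝ g I) :
    EqOn (dS ℓ (f * g)) (dS ℓ f * g + f * dS ℓ g) I := by
  intro x hx
  simp only [dS, Pi.add_apply, Pi.mul_apply]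
  rw [derivWithin_mul (hf x hx) (hg x hx)]
  ring

lemma dS_iterate_smul (ℓ c : ℝ) (n : ℕ) (f : ℝ → ℝ) :
    (dS ℓ)^[n] (c • f) = c • (dS ℓ)^[n] f := by
  induction n generalizing f with
  | zero => rfl
  | succ n ih => rw [Function.iterate_succ_apply, dS_smul, ih, Function.iterate_succ_apply]

lemma dS_iterate_add_of_contDiffOn (ℓ : ℝ) (n : ℕ) {f g : ℝ → ℝ} (hf : ContDiffOn ℝ n f I)
    (hg : ContDiffOn ℝ n g I) :
    EqOn ((dS ℓ)^[n] (f + g)) ((dS ℓ)^[n] f + (dS ℓ)^[n] g) I := by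
  induction n generalizing f g with
  | zero => exact fun x _ => rfl
  | succ n ih =>
    have h1 : (n : WithTop ℕ∞) + 1 ≤ ((n + 1 : ℕ) : WithTop ℕ∞) := by norm_cast
    refine (dS_iterate_congr ℓ n (dS_add ℓ (hf.differentiableOn ?_)
      (hg.differentiableOn ?_))).trans ?_
    · norm_cast
    · norm_cast
    · exact ih (contDiffOn_dS ℓ hf h1) (contDiffOn_dS ℓ hg h1)

lemma dS_iterate_add (ℓ : ℝ) (n : ℕ) {f g : ℝ → ℝ} (hf : Smooth f) (hg : Smooth g) :
    EqOn ((dS ℓ)^[n] (f + g)) ((dS ℓ)^[n] f + (dS ℓ)^[n] g) I :=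
  dS_iterate_add_of_contDiffOn ℓ n (hf.of_le (by exact_mod_cast le_top))
    (hg.of_le (by exact_mod_cast le_top))

lemma dS_iterate_mul_succ (ℓ : ℝ) (n : ℕ) {f g : ℝ → ℝ} (hf : Smooth f) (hg : Smooth g) :
    EqOn ((dS ℓ)^[n + 1] (f * g))
      ((dS ℓ)^[n] (dS ℓ f * g) + (dS ℓ)^[n] (f * dS ℓ g)) I :=
  (dS_iterate_congr ℓ n (dS_mul ℓ hf.differentiableOn hg.differentiableOn)).trans
    (dS_iterate_add ℓ n ((hf.dS ℓ).mul hg) (hf.mul (hg.dS ℓ)))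

lemma hasDerivWithinAt_dS {ℓ : ℝ} (hℓ : ℓ ≠ 0) {f : ℝ → ℝ} (hf : DifferentiableOn ℝ f I) {x : ℝ}
    (hx : x ∈ I) : HasDerivWithinAt f (ℓ * dS ℓ f x) I x := by
  have h := (hf x hx).hasDerivWithinAt
  simp only [dS]
  rwa [mul_inv_cancel_left₀ hℓ]

lemma uIcc_zero_one : uIcc (0 : ℝ) 1 = I := uIcc_of_le zero_le_one

lemma intervalIntegrable_of_continuousOn {f : ℝ → ℝ} (hf : ContinuousOn f I) :
    IntervalIntegrable f MeasureTheory.volume 0 1 :=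
  ContinuousOn.intervalIntegrable (by rwa [uIcc_zero_one])

lemma integral_congr_I {f g : ℝ → ℝ} (h : EqOn f g I) :
    ∫ x in (0 : ℝ)..1, f x = ∫ x in (0 : ℝ)..1, g x :=
  intervalIntegral.integral_congr (by rwa [uIcc_zero_one])

/-- Integration by parts for `∂ₛ`, when the boundary terms vanish. -/
lemma integral_mul_dS {ℓ : ℝ} (hℓ : ℓ ≠ 0) {f g : ℝ → ℝ} (hf : ContDiffOn ℝ 1 f I)
    (hg : ContDiffOn ℝ 1 g I) (h0 : f 0 * g 0 = 0) (h1 : f 1 * g 1 = 0) :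
    ∫ x in (0 : ℝ)..1, f x * dS ℓ g x = -∫ x in (0 : ℝ)..1, dS ℓ f x * g x := by
  have cf : ContinuousOn (dS ℓ f) I :=
    (contDiffOn_dS (m := 0) ℓ hf (by norm_num)).continuousOn
  have cg : ContinuousOn (dS ℓ g) I :=
    (contDiffOn_dS (m := 0) ℓ hg (by norm_num)).continuousOn
  have key := intervalIntegral.integral_mul_deriv_eq_deriv_mul_of_hasDerivWithinAt
    (a := 0) (b := 1) (u := f) (v := g) (u' := fun x => ℓ * dS ℓ f x)
    (v' := fun x => ℓ * dS ℓ g x)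
    (by
      rw [uIcc_zero_one]
      exact fun x hx => hasDerivWithinAt_dS hℓ (hf.differentiableOn (by norm_num)) hx)
    (by
      rw [uIcc_zero_one]
      exact fun x hx => hasDerivWithinAt_dS hℓ (hg.differentiableOn (by norm_num)) hx)
    (intervalIntegrable_of_continuousOn (continuousOn_const.mul cf))
    (intervalIntegrable_of_continuousOn (continuousOn_const.mul cg))
  rw [h0, h1] at key
  have e1 : ∀ x, f x * (ℓ * dS ℓ g x) = ℓ * (f x * dS ℓ g x) := fun x => by ring
  have e2 : ∀ x, ℓ * dS ℓ f x * g x = ℓ * (dS ℓ f x * g x) := fun x => by ring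
  simp only [e1, e2, intervalIntegral.integral_const_mul] at key
  have : ℓ * (∫ x in (0 : ℝ)..1, f x * dS ℓ g x) = ℓ * -∫ x in (0 : ℝ)..1, dS ℓ f x * g x := by
    linarith
  exact mul_left_cancel₀ hℓ this

/-- The `L²(ds)` norm, `ds = ℓ dx`. -/
def nrm (ℓ : ℝ) (f : ℝ → ℝ) : ℝ := √(ℓ * ∫ x in (0 : ℝ)..1, f x ^ 2)

lemma nrm_nonneg (ℓ : ℝ) (f : ℝ → ℝ) : 0 ≤ nrm ℓ f := Real.sqrt_nonneg _

lemma integral_sq_nonneg (f : ℝ → ℝ) : 0 ≤ ∫ x in (0 : ℝ)..1, f x ^ 2 :=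
  intervalIntegral.integral_nonneg zero_le_one fun x _ => sq_nonneg (f x)

lemma nrm_sq {ℓ : ℝ} (hℓ : 0 ≤ ℓ) (f : ℝ → ℝ) :
    nrm ℓ f ^ 2 = ℓ * ∫ x in (0 : ℝ)..1, f x ^ 2 :=
  Real.sq_sqrt (mul_nonneg hℓ (integral_sq_nonneg f))

lemma nrm_congr (ℓ : ℝ) {f g : ℝ → ℝ} (h : EqOn f g I) : nrm ℓ f = nrm ℓ g := by
  unfold nrm
  rw [integral_congr_I (f := fun x => f x ^ 2) (g := fun x => g x ^ 2)
    (fun x hx => by simp only [h hx])]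

lemma nrm_smul {ℓ : ℝ} (c : ℝ) (f : ℝ → ℝ) : nrm ℓ (c • f) = |c| * nrm ℓ f := by
  unfold nrm
  have : ∀ x, (c • f) x ^ 2 = c ^ 2 * f x ^ 2 := fun x => by
    simp only [Pi.smul_apply, smul_eq_mul]
    ring
  simp only [this, intervalIntegral.integral_const_mul]
  rw [show ℓ * (c ^ 2 * ∫ x in (0 : ℝ)..1, f x ^ 2) = c ^ 2 * (ℓ * ∫ x in (0 : ℝ)..1, f x ^ 2) by
    ring, Real.sqrt_mul (sq_nonneg c), Real.sqrt_sq_eq_abs]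

/-- The Cauchy–Schwarz inequality. -/
lemma abs_integral_mul_le {ℓ : ℝ} (hℓ : 0 ≤ ℓ) {f g : ℝ → ℝ} (hf : ContinuousOn f I)
    (hg : ContinuousOn g I) :
    |ℓ * ∫ x in (0 : ℝ)..1, f x * g x| ≤ nrm ℓ f * nrm ℓ g := by
  have hff : IntervalIntegrable (fun x => f x ^ 2) MeasureTheory.volume 0 1 :=
    intervalIntegrable_of_continuousOn (hf.pow 2)
  have hgg : IntervalIntegrable (fun x => g x ^ 2) MeasureTheory.volume 0 1 :=
    intervalIntegrable_of_continuousOn (hg.pow 2)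
  have hfg : IntervalIntegrable (fun x => f x * g x) MeasureTheory.volume 0 1 :=
    intervalIntegrable_of_continuousOn (hf.mul hg)
  have key : ∀ t : ℝ, 0 ≤ (ℓ * ∫ x in (0 : ℝ)..1, g x ^ 2) * (t * t) +
      (2 * (ℓ * ∫ x in (0 : ℝ)..1, f x * g x)) * t + ℓ * ∫ x in (0 : ℝ)..1, f x ^ 2 := by
    intro t
    have h := mul_nonneg hℓ (integral_sq_nonneg fun x => f x + t * g x)
    have e : ∫ x in (0 : ℝ)..1, (f x + t * g x) ^ 2 =
        (∫ x in (0 : ℝ)..1, f x ^ 2) + (2 * t) * (∫ x in (0 : ℝ)..1, f x * g x)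
          + (t * t) * ∫ x in (0 : ℝ)..1, g x ^ 2 := by
      rw [← intervalIntegral.integral_const_mul, ← intervalIntegral.integral_const_mul,
        ← intervalIntegral.integral_add hff (hfg.const_mul _),
        ← intervalIntegral.integral_add (hff.add (hfg.const_mul _)) (hgg.const_mul _)]
      refine intervalIntegral.integral_congr fun x _ => ?_
      ring
    rw [e] at h
    linarith
  have hd := discrim_le_zero key
  unfold discrim at hd
  refine abs_le_of_sq_le_sq ?_ (mul_nonneg (nrm_nonneg _ _) (nrm_nonneg _ _))
  rw [mul_pow (nrm ℓ f), nrm_sq hℓ, nrm_sq hℓ]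
  linarith

/-- The `L²(ds)` inner product. -/
def ip (ℓ : ℝ) (f g : ℝ → ℝ) : ℝ := ℓ * ∫ x in (0 : ℝ)..1, f x * g x

lemma abs_ip_le {ℓ : ℝ} (hℓ : 0 ≤ ℓ) {f g : ℝ → ℝ} (hf : ContinuousOn f I)
    (hg : ContinuousOn g I) : |ip ℓ f g| ≤ nrm ℓ f * nrm ℓ g :=
  abs_integral_mul_le hℓ hf hg

lemma ip_self {ℓ : ℝ} (hℓ : 0 ≤ ℓ) (f : ℝ → ℝ) : ip ℓ f f = nrm ℓ f ^ 2 := by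
  rw [nrm_sq hℓ, ip]
  simp only [sq]

lemma ip_congr (ℓ : ℝ) {f f' g g' : ℝ → ℝ} (hf : EqOn f f' I) (hg : EqOn g g' I) :
    ip ℓ f g = ip ℓ f' g' := by
  unfold ip
  rw [integral_congr_I (f := fun x => f x * g x) (g := fun x => f' x * g' x)
    (fun x hx => by simp only [hf hx, hg hx])]

lemma ip_comm (ℓ : ℝ) (f g : ℝ → ℝ) : ip ℓ f g = ip ℓ g f := by
  simp only [ip, mul_comm (f _)]

lemma ip_add_right (ℓ : ℝ) {f g h : ℝ → ℝ} (hf : ContinuousOn f I) (hg : ContinuousOn g I)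
    (hh : ContinuousOn h I) : ip ℓ f (g + h) = ip ℓ f g + ip ℓ f h := by
  have hfg : IntervalIntegrable (fun x => f x * g x) MeasureTheory.volume 0 1 :=
    intervalIntegrable_of_continuousOn (hf.mul hg)
  have hfh : IntervalIntegrable (fun x => f x * h x) MeasureTheory.volume 0 1 :=
    intervalIntegrable_of_continuousOn (hf.mul hh)
  unfold ip
  simp only [Pi.add_apply, mul_add]
  rw [intervalIntegral.integral_add hfg hfh, mul_add]

lemma ip_smul_right (ℓ c : ℝ) (f g : ℝ → ℝ) : ip ℓ f (c • g) = c * ip ℓ f g := by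
  unfold ip
  simp only [Pi.smul_apply, smul_eq_mul, mul_left_comm _ c, intervalIntegral.integral_const_mul]

lemma nrm_add_le {ℓ : ℝ} (hℓ : 0 ≤ ℓ) {f g : ℝ → ℝ} (hf : ContinuousOn f I)
    (hg : ContinuousOn g I) : nrm ℓ (f + g) ≤ nrm ℓ f + nrm ℓ g := by
  refine le_of_sq_le_sq ?_ (add_nonneg (nrm_nonneg _ _) (nrm_nonneg _ _))
  rw [add_sq, nrm_sq hℓ, nrm_sq hℓ, nrm_sq hℓ]
  have h := (abs_le.1 (abs_integral_mul_le hℓ hf hg)).2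
  have e : ∫ x in (0 : ℝ)..1, (f + g) x ^ 2 =
      (∫ x in (0 : ℝ)..1, f x ^ 2) + 2 * (∫ x in (0 : ℝ)..1, f x * g x)
        + ∫ x in (0 : ℝ)..1, g x ^ 2 := by
    have hff : IntervalIntegrable (fun x => f x ^ 2) MeasureTheory.volume 0 1 :=
      intervalIntegrable_of_continuousOn (hf.pow 2)
    have hgg : IntervalIntegrable (fun x => g x ^ 2) MeasureTheory.volume 0 1 :=
      intervalIntegrable_of_continuousOn (hg.pow 2)
    have hfg : IntervalIntegrable (fun x => f x * g x) MeasureTheory.volume 0 1 :=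
      intervalIntegrable_of_continuousOn (hf.mul hg)
    rw [← intervalIntegral.integral_const_mul,
      ← intervalIntegral.integral_add hff (hfg.const_mul _),
      ← intervalIntegral.integral_add (hff.add (hfg.const_mul _)) hgg]
    refine intervalIntegral.integral_congr fun x _ => ?_
    simp only [Pi.add_apply]
    ring
  rw [e]
  linarith

lemma nrm_mul_le {ℓ : ℝ} (hℓ : 0 ≤ ℓ) {f g : ℝ → ℝ} {K : ℝ} (hK : 0 ≤ K)
    (hf : ContinuousOn f I) (hg : ContinuousOn g I) (h : ∀ x ∈ I, |f x| ≤ K) :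
    nrm ℓ (f * g) ≤ K * nrm ℓ g := by
  refine le_of_sq_le_sq ?_ (mul_nonneg hK (nrm_nonneg _ _))
  rw [mul_pow, nrm_sq hℓ, nrm_sq hℓ, mul_left_comm]
  refine mul_le_mul_of_nonneg_left ?_ hℓ
  rw [← intervalIntegral.integral_const_mul]
  refine intervalIntegral.integral_mono_on zero_le_one
    (intervalIntegrable_of_continuousOn ((hf.mul hg).pow 2))
    (intervalIntegrable_of_continuousOn (continuousOn_const.mul (hg.pow 2))) fun x hx => ?_
  simp only [Pi.mul_apply, mul_pow]
  exact mul_le_mul_of_nonneg_right (sq_le_sq' (abs_le.1 (h x hx)).1 (abs_le.1 (h x hx)).2)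
    (sq_nonneg _)

/-- The oscillation of a function is at most its total variation. -/
lemma abs_sub_le_integral {ℓ : ℝ} (hℓ : 0 < ℓ) {f : ℝ → ℝ} (hf : ContDiffOn ℝ 1 f I) {x y : ℝ}
    (hx : x ∈ I) (hy : y ∈ I) : |f x - f y| ≤ ℓ * ∫ s in (0 : ℝ)..1, |dS ℓ f s| := by
  have cf : ContinuousOn (dS ℓ f) I :=
    (contDiffOn_dS (m := 0) ℓ hf (by norm_num)).continuousOn
  have hsub : uIcc y x ⊆ I := uIcc_subset_Icc hy hx
  have hint : ∫ s in y..x, ℓ * dS ℓ f s = f x - f y := by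
    refine intervalIntegral.integral_eq_sub_of_hasDeriv_right (hf.continuousOn.mono hsub) ?_
      ((continuousOn_const.mul cf).mono hsub).intervalIntegrable
    intro s hs
    have hsI : s ∈ I := hsub (Ioo_subset_Icc_self hs)
    have h1 := hasDerivWithinAt_dS hℓ.ne' (hf.differentiableOn (by norm_num)) hsI
    have hs1 : s < 1 := lt_of_lt_of_le hs.2 (max_le hy.2 hx.2)
    refine h1.mono_of_mem_nhdsWithin ?_
    exact Filter.mem_of_superset (Ioc_mem_nhdsGT hs1) fun r hr => ⟨hsI.1.trans hr.1.le, hr.2⟩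
  have habs : ContinuousOn (fun s => ℓ * |dS ℓ f s|) I := continuousOn_const.mul cf.abs
  rw [← hint, ← Real.norm_eq_abs, ← intervalIntegral.integral_const_mul]
  refine (intervalIntegral.norm_integral_le_integral_norm_uIoc).trans ?_
  rw [intervalIntegral.integral_of_le zero_le_one]
  have e : ∀ s, ‖ℓ * dS ℓ f s‖ = ℓ * |dS ℓ f s| := fun s => by
    rw [Real.norm_eq_abs, abs_mul, abs_of_pos hℓ]
  simp only [e]
  refine MeasureTheory.setIntegral_mono_set (intervalIntegrable_of_continuousOn habs).1 ?_ ?_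
  · exact Filter.Eventually.of_forall fun s => by positivity
  · exact (Ioc_subset_Ioc (le_min hy.1 hx.1) (max_le hy.2 hx.2)).eventuallyLE

lemma integral_abs_mul_le {ℓ : ℝ} (hℓ : 0 ≤ ℓ) {f g : ℝ → ℝ} (hf : ContinuousOn f I)
    (hg : ContinuousOn g I) :
    ℓ * ∫ s in (0 : ℝ)..1, |f s| * |g s| ≤ nrm ℓ f * nrm ℓ g := by
  have h := (abs_le.1 (abs_integral_mul_le hℓ hf.abs hg.abs)).2
  have e1 : nrm ℓ (fun s => |f s|) = nrm ℓ f := by simp only [nrm, sq_abs]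
  have e2 : nrm ℓ (fun s => |g s|) = nrm ℓ g := by simp only [nrm, sq_abs]
  rwa [e1, e2] at h

/-- A one-dimensional Sobolev inequality for functions with a zero: `f² ≤ 2 ‖f‖ ‖∂ₛ f‖`. -/
lemma sq_le_of_zero {ℓ : ℝ} (hℓ : 0 < ℓ) {f : ℝ → ℝ} (hf : ContDiffOn ℝ 1 f I) {y : ℝ}
    (hy : y ∈ I) (hfy : f y = 0) {x : ℝ} (hx : x ∈ I) :
    f x ^ 2 ≤ 2 * (nrm ℓ f * nrm ℓ (dS ℓ f)) := by
  have cf : ContinuousOn (dS ℓ f) I :=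
    (contDiffOn_dS (m := 0) ℓ hf (by norm_num)).continuousOn
  have hff : ContDiffOn ℝ 1 (f * f) I := ContDiffOn.mul hf hf
  have h := abs_sub_le_integral hℓ hff hx hy
  have hd := hf.differentiableOn (by norm_num)
  rw [integral_congr_I (g := fun s => 2 * (|f s| * |dS ℓ f s|)) (fun s hs => by
    rw [dS_mul ℓ hd hd hs]
    simp only [Pi.add_apply, Pi.mul_apply]
    rw [mul_comm, ← two_mul, abs_mul, abs_mul, abs_two]),
    intervalIntegral.integral_const_mul, mul_left_comm, Pi.mul_apply, Pi.mul_apply, hfy, mul_zero,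
    sub_zero] at h
  have h2 := integral_abs_mul_le hℓ.le hf.continuousOn cf
  rw [sq]
  linarith [le_abs_self (f x * f x)]

/-- Integration by parts for the inner product, when the boundary terms vanish. -/
lemma ip_dS {ℓ : ℝ} (hℓ : ℓ ≠ 0) {f g : ℝ → ℝ} (hf : ContDiffOn ℝ 1 f I)
    (hg : ContDiffOn ℝ 1 g I) (h0 : f 0 * g 0 = 0) (h1 : f 1 * g 1 = 0) :
    ip ℓ f (dS ℓ g) = -ip ℓ (dS ℓ f) g := by
  unfold ip
  rw [integral_mul_dS hℓ hf hg h0 h1, mul_neg]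

/-! ### Parity at an end point -/

/-- The derivatives `∂ₛⁱ f`, `i ≤ N`, of one parity vanish at `p`: those with `i + q` even. Thus `q = 0`
means that `f` is odd at `p` (up to order `N`), and `q = 1` that it is even. -/
def Par (ℓ p : ℝ) (N q : ℕ) (f : ℝ → ℝ) : Prop :=
  ∀ i ≤ N, Even (i + q) → (dS ℓ)^[i] f p = 0

section Par
variable {ℓ p : ℝ} {N q r : ℕ} {f g : ℝ → ℝ}

lemma Par.mono (h : Par ℓ p N q f) {n : ℕ} (hn : n ≤ N) : Par ℓ p n q f :=
  fun i hi => h i (hi.trans hn)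

lemma Par.dS (h : Par ℓ p (N + 1) q f) : Par ℓ p N (q + 1) (dS ℓ f) := by
  intro i hi he
  rw [← Function.iterate_succ_apply]
  exact h (i + 1) (by omega) (by rwa [add_assoc, add_comm 1 q])

lemma Par.iter {n : ℕ} (h : Par ℓ p (N + n) q f) : Par ℓ p N (q + n) ((ElasticFlow.dS ℓ)^[n] f) := by
  induction n generalizing f q with
  | zero => exact h
  | succ n ih =>
    have := ih (Par.dS (N := N + n) h)
    rwa [show q + (n + 1) = q + 1 + n by ring]

lemma Par.congr (h : Par ℓ p N q f) (hp : p ∈ I) (hfg : EqOn g f I) : Par ℓ p N q g := by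
  intro i hi he
  rw [dS_iterate_congr ℓ i hfg hp]
  exact h i hi he

lemma Par.add (hp : p ∈ I) (hf : Par ℓ p N q f) (hg : Par ℓ p N q g) (sf : Smooth f)
    (sg : Smooth g) : Par ℓ p N q (f + g) := by
  intro i hi he
  rw [dS_iterate_add ℓ i sf sg hp, Pi.add_apply, hf i hi he, hg i hi he, add_zero]

lemma Par.smul (c : ℝ) (hf : Par ℓ p N q f) : Par ℓ p N q (c • f) := by
  intro i hi he
  rw [dS_iterate_smul, Pi.smul_apply, hf i hi he, smul_zero]

lemma Par.parity (hf : Par ℓ p N q f) (h : Even (q + r)) : Par ℓ p N r f := by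
  intro i hi he
  refine hf i hi ?_
  have : Even (i + r + (q + r)) := he.add h
  rw [show i + r + (q + r) = i + q + 2 * r by ring] at this
  exact (Nat.even_add.1 this).2 (even_two_mul r)

/-- The product of two functions that are both odd, or both even, is even; a product of an odd and
an even function is odd. -/
lemma Par.mul (hp : p ∈ I) (hf : Par ℓ p N q f) (hg : Par ℓ p N r g) (sf : Smooth f)
    (sg : Smooth g) : Par ℓ p N (q + r + 1) (f * g) := by
  induction N generalizing f g q r with
  | zero =>
    intro i hi he
    obtain rfl : i = 0 := by omega
    have : Even q ∨ Even r := by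
      by_contra! h
      simp only [Nat.not_even_iff_odd] at h
      have h2 := (h.1.add_odd h.2).add_one
      rw [zero_add] at he
      exact (Nat.not_even_iff_odd.2 h2) he
    simp only [Function.iterate_zero, id_eq, Pi.mul_apply]
    rcases this with h | h
    · have := hf 0 le_rfl (by simpa using h)
      simp only [Function.iterate_zero, id_eq] at this
      rw [this, zero_mul]
    · have := hg 0 le_rfl (by simpa using h)
      simp only [Function.iterate_zero, id_eq] at this
      rw [this, mul_zero]
  | succ N ih =>
    intro i hi he
    rcases i with _ | i
    · exact ih (hf.mono N.le_succ) (hg.mono N.le_succ) sf sg 0 (Nat.zero_le _) he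
    · rw [dS_iterate_mul_succ ℓ i sf sg hp, Pi.add_apply]
      rw [ih hf.dS (hg.mono N.le_succ) (sf.dS ℓ) sg i (by omega) (by convert he using 1; ring),
        ih (hf.mono N.le_succ) hg.dS sf (sg.dS ℓ) i (by omega) (by convert he using 1; ring),
        add_zero]

end Par

/-! ### Uniform weighted bounds for families of functions -/

section Weights
variable {ι : Type*} {ℓ z : ι → ℝ} {F G : ι → ℝ → ℝ} {n m v w : ℕ}

/-- For a family of functions `F a` along curves of speed `ℓ a`, with scales `z a`: the bounds
`|∂ₛⁱ F| ≤ C z ^ (w + 2 i)` hold on `[0, 1]` for `i ≤ n`, with a constant that does not depend on the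
parameter `a`. One derivative has weight two, i.e. `z²` is an inverse length. -/
def SupW (ℓ z : ι → ℝ) (n w : ℕ) (F : ι → ℝ → ℝ) : Prop :=
  ∃ C : ℝ, 0 ≤ C ∧ ∀ a, ∀ i ≤ n, ∀ x ∈ I, |(dS (ℓ a))^[i] (F a) x| ≤ C * z a ^ (w + 2 * i)

/-- The counterpart of `SupW` for the `L²(ds)` norm. -/
def L2W (ℓ z : ι → ℝ) (n w : ℕ) (F : ι → ℝ → ℝ) : Prop :=
  ∃ C : ℝ, 0 ≤ C ∧ ∀ a, ∀ i ≤ n, nrm (ℓ a) ((dS (ℓ a))^[i] (F a)) ≤ C * z a ^ (w + 2 * i)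

lemma SupW.mono (h : SupW ℓ z n w F) (hm : m ≤ n) : SupW ℓ z m w F := by
  obtain ⟨C, hC, h⟩ := h
  exact ⟨C, hC, fun a i hi => h a i (hi.trans hm)⟩

lemma L2W.mono (h : L2W ℓ z n w F) (hm : m ≤ n) : L2W ℓ z m w F := by
  obtain ⟨C, hC, h⟩ := h
  exact ⟨C, hC, fun a i hi => h a i (hi.trans hm)⟩

lemma SupW.weight (hz : ∀ a, 1 ≤ z a) (h : SupW ℓ z n w F) (hv : w ≤ v) : SupW ℓ z n v F := by
  obtain ⟨C, hC, h⟩ := h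
  refine ⟨C, hC, fun a i hi x hx => (h a i hi x hx).trans ?_⟩
  have := pow_le_pow_right₀ (hz a) (show w + 2 * i ≤ v + 2 * i by omega)
  gcongr

lemma L2W.weight (hz : ∀ a, 1 ≤ z a) (h : L2W ℓ z n w F) (hv : w ≤ v) : L2W ℓ z n v F := by
  obtain ⟨C, hC, h⟩ := h
  refine ⟨C, hC, fun a i hi => (h a i hi).trans ?_⟩
  have := pow_le_pow_right₀ (hz a) (show w + 2 * i ≤ v + 2 * i by omega)
  gcongr

lemma SupW.congr (h : SupW ℓ z n w F) (hFG : ∀ a, EqOn (G a) (F a) I) : SupW ℓ z n w G := by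
  obtain ⟨C, hC, h⟩ := h
  refine ⟨C, hC, fun a i hi x hx => ?_⟩
  rw [dS_iterate_congr _ i (hFG a) hx]
  exact h a i hi x hx

lemma L2W.congr (h : L2W ℓ z n w F) (hFG : ∀ a, EqOn (G a) (F a) I) : L2W ℓ z n w G := by
  obtain ⟨C, hC, h⟩ := h
  refine ⟨C, hC, fun a i hi => ?_⟩
  rw [nrm_congr _ (dS_iterate_congr _ i (hFG a))]
  exact h a i hi

lemma SupW.dS (h : SupW ℓ z (n + 1) w F) : SupW ℓ z n (w + 2) (fun a => dS (ℓ a) (F a)) := by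
  obtain ⟨C, hC, h⟩ := h
  refine ⟨C, hC, fun a i hi x hx => ?_⟩
  have := h a (i + 1) (by omega) x hx
  rwa [Function.iterate_succ_apply, show w + 2 * (i + 1) = w + 2 + 2 * i by ring] at this

lemma L2W.dS (h : L2W ℓ z (n + 1) w F) : L2W ℓ z n (w + 2) (fun a => dS (ℓ a) (F a)) := by
  obtain ⟨C, hC, h⟩ := h
  refine ⟨C, hC, fun a i hi => ?_⟩
  have := h a (i + 1) (by omega)
  rwa [Function.iterate_succ_apply, show w + 2 * (i + 1) = w + 2 + 2 * i by ring] at this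

lemma SupW.iter (h : SupW ℓ z (n + m) w F) :
    SupW ℓ z n (w + 2 * m) (fun a => (ElasticFlow.dS (ℓ a))^[m] (F a)) := by
  induction m generalizing F w with
  | zero => exact h
  | succ m ih =>
    have := ih (SupW.dS (n := n + m) h)
    rwa [show w + 2 * (m + 1) = w + 2 + 2 * m by ring]

lemma L2W.iter (h : L2W ℓ z (n + m) w F) :
    L2W ℓ z n (w + 2 * m) (fun a => (ElasticFlow.dS (ℓ a))^[m] (F a)) := by
  induction m generalizing F w with
  | zero => exact h
  | succ m ih =>
    have := ih (L2W.dS (n := n + m) h)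
    rwa [show w + 2 * (m + 1) = w + 2 + 2 * m by ring]

lemma SupW.of_succ (hz : ∀ a, 1 ≤ z a) (h0 : SupW ℓ z 0 w F)
    (h : SupW ℓ z n (w + 2) (fun a => ElasticFlow.dS (ℓ a) (F a))) : SupW ℓ z (n + 1) w F := by
  obtain ⟨C, hC, h0⟩ := h0
  obtain ⟨D, hD, h⟩ := h
  refine ⟨max C D, hC.trans (le_max_left _ _), fun a i hi x hx => ?_⟩
  have hz0 : 0 ≤ z a := zero_le_one.trans (hz a)
  rcases i with _ | i
  · refine (h0 a 0 le_rfl x hx).trans ?_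
    gcongr
    exact le_max_left _ _
  · refine (h a i (by omega) x hx).trans ?_
    rw [show w + 2 + 2 * i = w + 2 * (i + 1) by ring]
    gcongr
    exact le_max_right _ _

lemma L2W.of_succ (hz : ∀ a, 1 ≤ z a) (h0 : L2W ℓ z 0 w F)
    (h : L2W ℓ z n (w + 2) (fun a => ElasticFlow.dS (ℓ a) (F a))) : L2W ℓ z (n + 1) w F := by
  obtain ⟨C, hC, h0⟩ := h0
  obtain ⟨D, hD, h⟩ := h
  refine ⟨max C D, hC.trans (le_max_left _ _), fun a i hi => ?_⟩
  have hz0 : 0 ≤ z a := zero_le_one.trans (hz a)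
  rcases i with _ | i
  · refine (h0 a 0 le_rfl).trans ?_
    gcongr
    exact le_max_left _ _
  · refine (h a i (by omega)).trans ?_
    rw [show w + 2 + 2 * i = w + 2 * (i + 1) by ring]
    gcongr
    exact le_max_right _ _

lemma SupW.add (hF : SupW ℓ z n w F) (hG : SupW ℓ z n w G) (sF : ∀ a, Smooth (F a))
    (sG : ∀ a, Smooth (G a)) : SupW ℓ z n w (F + G) := by
  obtain ⟨C, hC, hF⟩ := hF
  obtain ⟨D, hD, hG⟩ := hG
  refine ⟨C + D, add_nonneg hC hD, fun a i hi x hx => ?_⟩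
  rw [Pi.add_apply, dS_iterate_add _ i (sF a) (sG a) hx, Pi.add_apply, add_mul]
  exact (abs_add_le _ _).trans (add_le_add (hF a i hi x hx) (hG a i hi x hx))

lemma L2W.add (hℓ : ∀ a, 0 < ℓ a) (hF : L2W ℓ z n w F) (hG : L2W ℓ z n w G)
    (sF : ∀ a, Smooth (F a)) (sG : ∀ a, Smooth (G a)) : L2W ℓ z n w (F + G) := by
  obtain ⟨C, hC, hF⟩ := hF
  obtain ⟨D, hD, hG⟩ := hG
  refine ⟨C + D, add_nonneg hC hD, fun a i hi => ?_⟩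
  rw [Pi.add_apply, nrm_congr _ (dS_iterate_add _ i (sF a) (sG a)), add_mul]
  exact (nrm_add_le (hℓ a).le ((sF a).iter _ i).continuousOn ((sG a).iter _ i).continuousOn).trans
    (add_le_add (hF a i hi) (hG a i hi))

lemma SupW.smul {c : ι → ℝ} {K : ℝ} (hc : ∀ a, |c a| ≤ K) (hF : SupW ℓ z n w F) :
    SupW ℓ z n w (fun a => c a • F a) := by
  obtain ⟨C, hC, hF⟩ := hF
  refine ⟨|K| * C, by positivity, fun a i hi x hx => ?_⟩
  rw [dS_iterate_smul, Pi.smul_apply, smul_eq_mul, abs_mul, mul_assoc]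
  exact mul_le_mul ((hc a).trans (le_abs_self K)) (hF a i hi x hx) (abs_nonneg _) (abs_nonneg K)

lemma L2W.smul {c : ι → ℝ} {K : ℝ} (hc : ∀ a, |c a| ≤ K) (hF : L2W ℓ z n w F) :
    L2W ℓ z n w (fun a => c a • F a) := by
  obtain ⟨C, hC, hF⟩ := hF
  refine ⟨|K| * C, by positivity, fun a i hi => ?_⟩
  rw [dS_iterate_smul, nrm_smul, mul_assoc]
  exact mul_le_mul ((hc a).trans (le_abs_self K)) (hF a i hi) (nrm_nonneg _ _) (abs_nonneg K)

lemma SupW.const_smul (c : ℝ) (hF : SupW ℓ z n w F) : SupW ℓ z n w (fun a => c • F a) :=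
  hF.smul (c := fun _ => c) fun _ => le_rfl

lemma L2W.const_smul (c : ℝ) (hF : L2W ℓ z n w F) : L2W ℓ z n w (fun a => c • F a) :=
  hF.smul (c := fun _ => c) fun _ => le_rfl

lemma SupW.mul (hz : ∀ a, 1 ≤ z a) (hF : SupW ℓ z n w F) (hG : SupW ℓ z n v G)
    (sF : ∀ a, Smooth (F a)) (sG : ∀ a, Smooth (G a)) : SupW ℓ z n (w + v) (F * G) := by
  induction n generalizing F G w v with
  | zero =>
    obtain ⟨C, hC, hF⟩ := hF
    obtain ⟨D, hD, hG⟩ := hG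
    refine ⟨C * D, mul_nonneg hC hD, fun a i hi x hx => ?_⟩
    obtain rfl : i = 0 := by omega
    have h1 := hF a 0 le_rfl x hx
    have h2 := hG a 0 le_rfl x hx
    simp only [Function.iterate_zero, id_eq, mul_zero, add_zero, Pi.mul_apply] at *
    rw [abs_mul, pow_add, mul_mul_mul_comm]
    exact mul_le_mul h1 h2 (abs_nonneg _) ((abs_nonneg _).trans h1)
  | succ n ih =>
    refine SupW.of_succ hz ?_ ?_
    · exact (ih (hF.mono n.le_succ) (hG.mono n.le_succ) sF sG).mono (Nat.zero_le n)
    · have h1 := ih hF.dS (hG.mono n.le_succ) (fun a => (sF a).dS _) sG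
      have h2 := ih (hF.mono n.le_succ) hG.dS sF (fun a => (sG a).dS _)
      rw [show w + 2 + v = w + v + 2 by ring] at h1
      exact (h1.add h2 (fun a => ((sF a).dS _).mul (sG a)) (fun a => (sF a).mul ((sG a).dS _))).congr
        fun a => dS_mul _ (sF a).differentiableOn (sG a).differentiableOn

lemma L2W.mul (hℓ : ∀ a, 0 < ℓ a) (hz : ∀ a, 1 ≤ z a) (hF : SupW ℓ z n w F) (hG : L2W ℓ z n v G)
    (sF : ∀ a, Smooth (F a)) (sG : ∀ a, Smooth (G a)) : L2W ℓ z n (w + v) (F * G) := by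
  induction n generalizing F G w v with
  | zero =>
    obtain ⟨C, hC, hF⟩ := hF
    obtain ⟨D, hD, hG⟩ := hG
    refine ⟨C * D, mul_nonneg hC hD, fun a i hi => ?_⟩
    obtain rfl : i = 0 := by omega
    have h1 := fun x hx => hF a 0 le_rfl x hx
    have h2 := hG a 0 le_rfl
    have hz0 : 0 ≤ z a := zero_le_one.trans (hz a)
    simp only [Function.iterate_zero, id_eq, mul_zero, add_zero, Pi.mul_apply] at *
    refine (nrm_mul_le (hℓ a).le (by positivity) (sF a).continuousOn (sG a).continuousOn h1).trans ?_
    rw [pow_add, mul_mul_mul_comm]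
    exact mul_le_mul_of_nonneg_left h2 (by positivity)
  | succ n ih =>
    refine L2W.of_succ hz ?_ ?_
    · exact (ih (hF.mono n.le_succ) (hG.mono n.le_succ) sF sG).mono (Nat.zero_le n)
    · have h1 := ih hF.dS (hG.mono n.le_succ) (fun a => (sF a).dS _) sG
      have h2 := ih (hF.mono n.le_succ) hG.dS sF (fun a => (sG a).dS _)
      rw [show w + 2 + v = w + v + 2 by ring] at h1
      exact (h1.add hℓ h2 (fun a => ((sF a).dS _).mul (sG a))
        (fun a => (sF a).mul ((sG a).dS _))).congr
        fun a => dS_mul _ (sF a).differentiableOn (sG a).differentiableOn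

end Weights

/-! ### Interpolation -/

section Interpolation

/-- A log-convex sequence lies below a geometric one if it does so at both ends. -/
lemma le_geometric_of_logConvex {b : ℕ → ℝ} {M r : ℝ} {l : ℕ} (hM : 0 < M) (hr : 0 < r)
    (hb : ∀ i, 0 ≤ b i) (hconv : ∀ i, i + 2 ≤ l → b (i + 1) ^ 2 ≤ b i * b (i + 2))
    (h0 : b 0 ≤ M) (hl : b l ≤ M * r ^ l) : ∀ i ≤ l, b i ≤ M * r ^ i := by
  set c : ℕ → ℝ := fun i => b i / (M * r ^ i) with hc
  have hpos : ∀ i, 0 < M * r ^ i := fun i => by positivity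
  have hcn : ∀ i, 0 ≤ c i := fun i => div_nonneg (hb i) (hpos i).le
  have hcc : ∀ i, i + 2 ≤ l → c (i + 1) ^ 2 ≤ c i * c (i + 2) := by
    intro i hi
    simp only [hc]
    rw [div_pow, div_mul_div_comm, show (M * r ^ (i + 1)) ^ 2 = M * r ^ i * (M * r ^ (i + 2)) by ring]
    exact div_le_div_of_nonneg_right (hconv i hi) (mul_pos (hpos _) (hpos _)).le
  have hc0 : c 0 ≤ 1 := by
    simp only [hc, pow_zero, mul_one]
    exact (div_le_one hM).2 h0
  have hcl : c l ≤ 1 := (div_le_one (hpos l)).2 hl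
  -- a first index at which `c` is maximal cannot be interior unless the maximum is at most one
  have key : ∀ i ≤ l, c i ≤ 1 := by
    obtain ⟨m, hm, hmax⟩ := Finset.exists_max_image (Finset.range (l + 1)) c
      ⟨0, Finset.mem_range.2 (Nat.succ_pos l)⟩
    have hex : ∃ m, m ≤ l ∧ ∀ i ≤ l, c i ≤ c m :=
      ⟨m, by simpa [Nat.lt_succ_iff] using hm, fun i hi => hmax i (by simpa [Nat.lt_succ_iff] using hi)⟩
    classical
    obtain ⟨hml, hmax⟩ := Nat.find_spec hex
    set m := Nat.find hex
    have hlt : ∀ i < m, c i < c m := by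
      intro i hi
      have h := Nat.find_min hex hi
      push Not at h
      obtain ⟨k, hk, hlt⟩ := h (hi.le.trans hml)
      exact hlt.trans_le (hmax k hk)
    suffices c m ≤ 1 from fun i hi => (hmax i hi).trans this
    by_contra! h1
    have hm0 : m ≠ 0 := fun h => by rw [h] at h1; linarith
    have hml' : m ≠ l := fun h => by rw [h] at h1; linarith
    obtain ⟨k, hk⟩ := Nat.exists_eq_succ_of_ne_zero hm0
    have h2 := hcc k (by omega)
    have h3 := hlt k (by omega)
    have h4 := hmax (k + 2) (by omega)
    rw [← Nat.succ_eq_add_one, ← hk] at h2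
    have h5 : c k * c (k + 2) ≤ c k * c m := mul_le_mul_of_nonneg_left h4 (hcn k)
    have h6 : c k * c m < c m * c m := mul_lt_mul_of_pos_right h3 (by linarith)
    nlinarith
  intro i hi
  exact (div_le_one (hpos i)).1 (key i hi)

/-- `u` is odd at both end points: all even derivatives vanish there. -/
def OddEnds (ℓ : ℝ) (u : ℝ → ℝ) : Prop := ∀ i, (dS ℓ)^[2 * i] u 0 = 0 ∧ (dS ℓ)^[2 * i] u 1 = 0

variable {ℓ : ℝ} {u : ℝ → ℝ}

lemma OddEnds.iterate_mul_eq_zero (h : OddEnds ℓ u) {i k : ℕ} (hik : Odd (i + k)) :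
    (dS ℓ)^[i] u 0 * (dS ℓ)^[k] u 0 = 0 ∧ (dS ℓ)^[i] u 1 * (dS ℓ)^[k] u 1 = 0 := by
  rcases Nat.even_or_odd i with hi | hi
  · obtain ⟨m, rfl⟩ := even_iff_exists_two_mul.1 hi
    rw [(h m).1, (h m).2, zero_mul, zero_mul]
    exact ⟨rfl, rfl⟩
  · have hk : Even k := by
      rcases Nat.even_or_odd k with hk | hk
      · exact hk
      · exact absurd (hi.add_odd hk) (Nat.not_even_iff_odd.2 hik)
    obtain ⟨m, rfl⟩ := even_iff_exists_two_mul.1 hk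
    rw [(h m).1, (h m).2, mul_zero, mul_zero]
    exact ⟨rfl, rfl⟩

lemma Smooth.contDiffOn {f : ℝ → ℝ} (hf : Smooth f) (n : ℕ) : ContDiffOn ℝ n f I :=
  hf.of_le (by exact_mod_cast le_top)

lemma Smooth.one {f : ℝ → ℝ} (hf : Smooth f) : ContDiffOn ℝ 1 f I := by
  simpa using hf.contDiffOn 1

/-- Integration by parts for the derivatives of a function that is odd at both ends. -/
lemma ip_iterate (hℓ : ℓ ≠ 0) (hu : Smooth u) (hodd : OddEnds ℓ u) {i k : ℕ}
    (hik : Odd (i + k)) :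
    ip ℓ ((dS ℓ)^[i] u) ((dS ℓ)^[k + 1] u) = -ip ℓ ((dS ℓ)^[i + 1] u) ((dS ℓ)^[k] u) := by
  rw [Function.iterate_succ_apply' (dS ℓ) k, Function.iterate_succ_apply' (dS ℓ) i]
  exact ip_dS hℓ (hu.iter ℓ i).one (hu.iter ℓ k).one (hodd.iterate_mul_eq_zero hik).1
    (hodd.iterate_mul_eq_zero hik).2

lemma ip_iterate_two (hℓ : 0 < ℓ) (hu : Smooth u) (hodd : OddEnds ℓ u) (j : ℕ) :
    ip ℓ ((dS ℓ)^[j] u) ((dS ℓ)^[j + 2] u) = -nrm ℓ ((dS ℓ)^[j + 1] u) ^ 2 := by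
  rw [ip_iterate hℓ.ne' hu hodd (k := j + 1) ⟨j, by ring⟩, ip_self hℓ.le]

lemma ip_iterate_four (hℓ : 0 < ℓ) (hu : Smooth u) (hodd : OddEnds ℓ u) (j : ℕ) :
    ip ℓ ((dS ℓ)^[j] u) ((dS ℓ)^[j + 4] u) = nrm ℓ ((dS ℓ)^[j + 2] u) ^ 2 := by
  rw [ip_iterate hℓ.ne' hu hodd (k := j + 3) ⟨j + 1, by ring⟩,
    ip_iterate hℓ.ne' hu hodd (k := j + 2) ⟨j + 1, by ring⟩, neg_neg, ip_self hℓ.le]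

/-- The norms of the derivatives of a function that is odd at both ends form a log-convex sequence. -/
lemma nrm_sq_le_mul (hℓ : 0 < ℓ) (hu : Smooth u) (hodd : OddEnds ℓ u) (i : ℕ) :
    nrm ℓ ((dS ℓ)^[i + 1] u) ^ 2 ≤ nrm ℓ ((dS ℓ)^[i] u) * nrm ℓ ((dS ℓ)^[i + 2] u) := by
  have h := abs_ip_le hℓ.le (hu.iter ℓ i).continuousOn (hu.iter ℓ (i + 2)).continuousOn
  rw [ip_iterate_two hℓ hu hodd, abs_neg] at h
  exact (le_abs_self _).trans h

/-- Every derivative of a function that is odd at both ends has a zero. -/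
lemma OddEnds.exists_zero (hℓ : ℓ ≠ 0) (hu : Smooth u) (hodd : OddEnds ℓ u) (i : ℕ) :
    ∃ y ∈ I, (dS ℓ)^[i] u y = 0 := by
  rcases Nat.even_or_odd i with hi | ⟨m, rfl⟩
  · obtain ⟨m, rfl⟩ := even_iff_exists_two_mul.1 hi
    exact ⟨0, zero_mem_I, (hodd m).1⟩
  · have hs := hu.iter ℓ (2 * m)
    obtain ⟨y, hy, h⟩ := exists_hasDerivAt_eq_zero (f := (dS ℓ)^[2 * m] u)
      (f' := fun x => ℓ * dS ℓ ((dS ℓ)^[2 * m] u) x) zero_lt_one hs.continuousOn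
      (by rw [(hodd m).1, (hodd m).2])
      (fun x hx => (hasDerivWithinAt_dS hℓ hs.differentiableOn (Ioo_subset_Icc_self hx)).hasDerivAt
        (Icc_mem_nhds hx.1 hx.2))
    refine ⟨y, Ioo_subset_Icc_self hy, ?_⟩
    have e : (dS ℓ)^[2 * m + 1] u = dS ℓ ((dS ℓ)^[2 * m] u) := Function.iterate_succ_apply' _ _ _
    rw [e]
    exact (mul_eq_zero.1 h).resolve_left hℓ

/-- The scale attached to the `l`-th derivative: `z ^ (4 l) = max 1 ‖∂ₛˡ u‖²`. -/
def scale (l : ℕ) (ℓ : ℝ) (u : ℝ → ℝ) : ℝ :=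
  (max 1 (nrm ℓ ((dS ℓ)^[l] u) ^ 2)) ^ ((4 * l : ℝ)⁻¹)

lemma one_le_scale (l : ℕ) : 1 ≤ scale l ℓ u :=
  Real.one_le_rpow (le_max_left _ _) (by positivity)

lemma scale_pow {l : ℕ} (hl : l ≠ 0) :
    scale l ℓ u ^ (4 * l) = max 1 (nrm ℓ ((dS ℓ)^[l] u) ^ 2) := by
  have h0 : (0 : ℝ) ≤ max 1 (nrm ℓ ((dS ℓ)^[l] u) ^ 2) := zero_le_one.trans (le_max_left _ _)
  have : ((4 * l : ℕ) : ℝ) ≠ 0 := by positivity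
  rw [scale, show (4 * l : ℝ) = ((4 * l : ℕ) : ℝ) by push_cast; ring, Real.rpow_inv_natCast_pow h0]
  positivity

/-- Interpolation in `L²` between `‖u‖` and `‖∂ₛˡ u‖`, without lower order terms. -/
lemma nrm_iterate_le {l : ℕ} (hl : l ≠ 0) {M : ℝ} (hM : 1 ≤ M) (hℓ : 0 < ℓ) (hu : Smooth u)
    (hodd : OddEnds ℓ u) (hb : nrm ℓ u ≤ M) {i : ℕ} (hi : i ≤ l) :
    nrm ℓ ((dS ℓ)^[i] u) ≤ M * scale l ℓ u ^ (2 * i) := by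
  have hz := one_le_scale (ℓ := ℓ) (u := u) l
  have hz0 : 0 < scale l ℓ u := by linarith
  have := le_geometric_of_logConvex (b := fun i => nrm ℓ ((dS ℓ)^[i] u)) (M := M)
    (r := scale l ℓ u ^ 2) (l := l) (by linarith) (by positivity) (fun i => nrm_nonneg _ _)
    (fun i _ => nrm_sq_le_mul hℓ hu hodd i) hb ?_ i hi
  · rwa [← pow_mul] at this
  · rw [← pow_mul]
    have h1 : nrm ℓ ((dS ℓ)^[l] u) ≤ scale l ℓ u ^ (2 * l) := by
      refine le_of_sq_le_sq ?_ (by positivity)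
      rw [← pow_mul, show 2 * l * 2 = 4 * l by ring, scale_pow hl]
      exact le_max_right _ _
    exact h1.trans (le_mul_of_one_le_left (by positivity) hM)

/-- Interpolation in the supremum norm: a derivative has a zero, hence is controlled by its norm and
that of the next one. -/
lemma abs_iterate_le {l : ℕ} (hl : l ≠ 0) {M : ℝ} (hM : 1 ≤ M) (hℓ : 0 < ℓ) (hu : Smooth u)
    (hodd : OddEnds ℓ u) (hb : nrm ℓ u ≤ M) {i : ℕ} (hi : i + 1 ≤ l) {x : ℝ} (hx : x ∈ I) :
    |(dS ℓ)^[i] u x| ≤ 2 * M * scale l ℓ u ^ (1 + 2 * i) := by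
  obtain ⟨y, hy, hy0⟩ := hodd.exists_zero hℓ.ne' hu i
  have h := sq_le_of_zero hℓ (hu.iter ℓ i).one hy hy0 hx
  rw [← Function.iterate_succ_apply' (dS ℓ)] at h
  have hz := one_le_scale (ℓ := ℓ) (u := u) l
  have h1 := nrm_iterate_le hl hM hℓ hu hodd hb (i := i) (by omega)
  have h2 := nrm_iterate_le hl hM hℓ hu hodd hb (i := i + 1) hi
  refine abs_le_of_sq_le_sq ?_ (by positivity)
  calc (dS ℓ)^[i] u x ^ 2
      ≤ 2 * (M * scale l ℓ u ^ (2 * i) * (M * scale l ℓ u ^ (2 * (i + 1)))) := by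
        refine h.trans (mul_le_mul_of_nonneg_left ?_ zero_le_two)
        exact mul_le_mul h1 h2 (nrm_nonneg _ _) ((nrm_nonneg _ _).trans h1)
    _ ≤ (2 * M * scale l ℓ u ^ (1 + 2 * i)) ^ 2 := by
        rw [show 2 * (M * scale l ℓ u ^ (2 * i) * (M * scale l ℓ u ^ (2 * (i + 1)))) =
          2 * (M * scale l ℓ u ^ (1 + 2 * i)) ^ 2 by ring,
          show (2 * M * scale l ℓ u ^ (1 + 2 * i)) ^ 2 =
            4 * (M * scale l ℓ u ^ (1 + 2 * i)) ^ 2 by ring]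
        nlinarith [sq_nonneg (M * scale l ℓ u ^ (1 + 2 * i))]

end Interpolation

/-! ### The evolution of the derivatives of the curvature, at a fixed time -/

/-- The part of the normal velocity that carries the factor `ε`: `-(2 ∂ₛ² u + u³)`. -/
def velCorr (ℓ : ℝ) (u : ℝ → ℝ) : ℝ → ℝ := (-2 : ℝ) • (dS ℓ)^[2] u + (-1 : ℝ) • (u * u * u)

/-- The normal velocity `V = u - ε (2 ∂ₛ² u + u³)` of a curve with curvature `u`. -/
def vel (ε ℓ : ℝ) (u : ℝ → ℝ) : ℝ → ℝ := u + ε • velCorr ℓ u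

/-- The time derivative of `∂ₛʲ u` along the normal motion, `u` being the curvature. The recursion
comes from `∂ₜ u = ∂ₛ² V + u² V` and from the commutator `[∂ₜ, ∂ₛ] = u V ∂ₛ`. -/
def evol (ε ℓ : ℝ) (u : ℝ → ℝ) : ℕ → ℝ → ℝ
  | 0 => (dS ℓ)^[2] (vel ε ℓ u) + u * u * vel ε ℓ u
  | j + 1 => dS ℓ (evol ε ℓ u j) + u * (dS ℓ)^[j + 1] u * vel ε ℓ u

/-- The nonlinear part of `evol` without the factor `ε`. -/
def lowA (ℓ : ℝ) (u : ℝ → ℝ) : ℕ → ℝ → ℝ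
  | 0 => u * u * u
  | j + 1 => dS ℓ (lowA ℓ u j) + u * u * (dS ℓ)^[j + 1] u

/-- The nonlinear part of `evol` with the factor `ε`. -/
def lowB (ℓ : ℝ) (u : ℝ → ℝ) : ℕ → ℝ → ℝ
  | 0 => (-5 : ℝ) • (u * u * (dS ℓ)^[2] u) + (-6 : ℝ) • (u * (dS ℓ u * dS ℓ u)) +
      (-1 : ℝ) • (u * u * (u * u * u))
  | j + 1 => dS ℓ (lowB ℓ u j) + u * (dS ℓ)^[j + 1] u * velCorr ℓ u

section Smoothness
variable {ε ℓ : ℝ} {u f g : ℝ → ℝ}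

lemma Smooth.add' (hf : Smooth f) (hg : Smooth g) : Smooth (f + g) := ContDiffOn.add hf hg

lemma Smooth.mul' (hf : Smooth f) (hg : Smooth g) : Smooth (f * g) := ContDiffOn.mul hf hg

lemma Smooth.smul' (c : ℝ) (hf : Smooth f) : Smooth (c • f) := contDiffOn_const.smul hf

lemma Smooth.cube (hu : Smooth u) : Smooth (u * u * u) := (hu.mul' hu).mul' hu

lemma Smooth.velCorr (hu : Smooth u) : Smooth (velCorr ℓ u) :=
  ((hu.iter ℓ 2).smul' _).add' (hu.cube.smul' _)

lemma Smooth.vel (hu : Smooth u) : Smooth (vel ε ℓ u) := hu.add' (hu.velCorr.smul' ε)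

lemma Smooth.evol (hu : Smooth u) (j : ℕ) : Smooth (evol ε ℓ u j) := by
  induction j with
  | zero => exact (hu.vel.iter ℓ 2).add' ((hu.mul' hu).mul' hu.vel)
  | succ j ih => exact (ih.dS ℓ).add' ((hu.mul' (hu.iter ℓ _)).mul' hu.vel)

lemma Smooth.lowA (hu : Smooth u) (j : ℕ) : Smooth (lowA ℓ u j) := by
  induction j with
  | zero => exact hu.cube
  | succ j ih => exact (ih.dS ℓ).add' ((hu.mul' hu).mul' (hu.iter ℓ _))

lemma Smooth.lowB (hu : Smooth u) (j : ℕ) : Smooth (lowB ℓ u j) := by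
  induction j with
  | zero =>
    exact ((((hu.mul' hu).mul' (hu.iter ℓ 2)).smul' _).add'
      ((hu.mul' ((hu.dS ℓ).mul' (hu.dS ℓ))).smul' _)).add' (((hu.mul' hu).mul' hu.cube).smul' _)
  | succ j ih => exact (ih.dS ℓ).add' ((hu.mul' (hu.iter ℓ _)).mul' hu.velCorr)

lemma dS_cube (hu : Smooth u) : EqOn (dS ℓ (u * u * u)) ((3 : ℝ) • (u * u * dS ℓ u)) I := by
  intro x hx
  rw [dS_mul ℓ (hu.mul' hu).differentiableOn hu.differentiableOn hx]
  simp only [Pi.add_apply, Pi.mul_apply, Pi.smul_apply, smul_eq_mul]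
  rw [dS_mul ℓ hu.differentiableOn hu.differentiableOn hx]
  simp only [Pi.add_apply, Pi.mul_apply]
  ring

lemma dS_iterate_two_cube (hu : Smooth u) : EqOn ((dS ℓ)^[2] (u * u * u))
    ((3 : ℝ) • (u * u * (dS ℓ)^[2] u) + (6 : ℝ) • (u * (dS ℓ u * dS ℓ u))) I := by
  intro x hx
  refine (dS_congr ℓ (dS_cube hu) hx).trans ?_
  simp only [Function.iterate_succ, Function.iterate_zero, Function.comp_apply, id_eq, dS_smul]
  simp only [Pi.smul_apply, smul_eq_mul, Pi.add_apply, Pi.mul_apply]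
  rw [dS_mul ℓ (hu.mul' hu).differentiableOn (hu.dS ℓ).differentiableOn hx]
  simp only [Pi.add_apply, Pi.mul_apply]
  rw [dS_mul ℓ hu.differentiableOn hu.differentiableOn hx]
  simp only [Pi.add_apply, Pi.mul_apply]
  ring

/-- The linear and nonlinear parts of the evolution of `∂ₛʲ u`. -/
lemma evol_eq (hu : Smooth u) (j : ℕ) : EqOn (evol ε ℓ u j)
    ((dS ℓ)^[j + 2] u + (-(2 * ε)) • (dS ℓ)^[j + 4] u + lowA ℓ u j + ε • lowB ℓ u j) I := by
  induction j with
  | zero =>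
    intro x hx
    have h1 := dS_iterate_add ℓ 2 hu ((hu.velCorr (ℓ := ℓ)).smul' ε) hx
    have h2 := dS_iterate_add ℓ 2 ((hu.iter ℓ 2).smul' (-2)) (hu.cube.smul' (-1)) hx
    have h3 := dS_iterate_two_cube (ℓ := ℓ) hu hx
    simp only [evol, lowA, lowB, vel, Pi.add_apply, Pi.mul_apply] at h1 ⊢
    rw [h1, dS_iterate_smul]
    simp only [velCorr, Pi.add_apply, Pi.smul_apply, smul_eq_mul, Pi.mul_apply] at *
    rw [h2]
    simp only [dS_iterate_smul, Pi.smul_apply, smul_eq_mul, h3, ← Function.iterate_add_apply]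
    ring
  | succ j ih =>
    intro x hx
    have s2 := hu.iter ℓ (j + 2)
    have s4 := (hu.iter ℓ (j + 4)).smul' (-(2 * ε))
    have sA := hu.lowA (ℓ := ℓ) j
    have sB := (hu.lowB (ℓ := ℓ) j).smul' ε
    have h := dS_congr ℓ ih hx
    rw [dS_add ℓ ((s2.add' s4).add' sA).differentiableOn sB.differentiableOn hx, Pi.add_apply,
      dS_add ℓ (s2.add' s4).differentiableOn sA.differentiableOn hx, Pi.add_apply,
      dS_add ℓ s2.differentiableOn s4.differentiableOn hx, Pi.add_apply, dS_smul, dS_smul] at h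
    simp only [evol, lowA, lowB, vel, Pi.add_apply, Pi.mul_apply, Pi.smul_apply,
      smul_eq_mul] at h ⊢
    rw [h, ← Function.iterate_succ_apply' (dS ℓ), ← Function.iterate_succ_apply' (dS ℓ)]
    ring

end Smoothness

section Parity
variable {ε ℓ p : ℝ} {u : ℝ → ℝ} {N n j : ℕ}

lemma par_cube (hp : p ∈ I) (hu : Smooth u) (h : Par ℓ p N 0 u) : Par ℓ p N 0 (u * u * u) :=
  ((h.mul hp h hu hu).mul hp h (hu.mul' hu) hu).parity (by decide)

lemma par_velCorr (hp : p ∈ I) (hu : Smooth u) (h : Par ℓ p N 0 u) (hn : n + 2 ≤ N) :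
    Par ℓ p n 0 (velCorr ℓ u) :=
  Par.add hp (((Par.iter (n := 2) (h.mono hn)).parity (by decide)).smul _)
    (((par_cube hp hu h).mono (by omega)).smul _) ((hu.iter ℓ 2).smul' _) (hu.cube.smul' _)

lemma par_lowA (hp : p ∈ I) (hu : Smooth u) (h : Par ℓ p N 0 u) (hn : n + j ≤ N) :
    Par ℓ p n j (lowA ℓ u j) := by
  induction j generalizing n with
  | zero => exact (par_cube hp hu h).mono hn
  | succ j ih =>
    refine Par.add hp (Par.dS (ih (n := n + 1) (by omega))) ?_ ((hu.lowA j).dS ℓ)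
      ((hu.mul' hu).mul' (hu.iter ℓ _))
    have h0 := h.mono (show n ≤ N by omega)
    refine ((h0.mul hp h0 hu hu).mul hp (Par.iter (n := j + 1) (h.mono hn)) (hu.mul' hu)
      (hu.iter ℓ _)).parity ?_
    exact ⟨j + 2, by ring⟩

lemma par_lowB (hp : p ∈ I) (hu : Smooth u) (h : Par ℓ p N 0 u) (hn : n + j + 2 ≤ N) :
    Par ℓ p n j (lowB ℓ u j) := by
  induction j generalizing n with
  | zero =>
    have h0 := h.mono (show n ≤ N by omega)
    have h1 := Par.dS (h.mono (show n + 1 ≤ N by omega))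
    have h2 := Par.iter (n := 2) (h.mono (show n + 2 ≤ N by omega))
    refine Par.add hp (Par.add hp ?_ ?_ (((hu.mul' hu).mul' (hu.iter ℓ 2)).smul' _)
      ((hu.mul' ((hu.dS ℓ).mul' (hu.dS ℓ))).smul' _)) ?_
      ((((hu.mul' hu).mul' (hu.iter ℓ 2)).smul' _).add'
        ((hu.mul' ((hu.dS ℓ).mul' (hu.dS ℓ))).smul' _)) (((hu.mul' hu).mul' hu.cube).smul' _)
    · exact (((h0.mul hp h0 hu hu).mul hp h2 (hu.mul' hu) (hu.iter ℓ 2)).parity (by decide)).smul _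
    · exact ((h0.mul hp (h1.mul hp h1 (hu.dS ℓ) (hu.dS ℓ)) hu
        ((hu.dS ℓ).mul' (hu.dS ℓ))).parity (by decide)).smul _
    · exact (((h0.mul hp h0 hu hu).mul hp (par_cube hp hu h0) (hu.mul' hu) hu.cube).parity
        (by decide)).smul _
  | succ j ih =>
    refine Par.add hp (Par.dS (ih (n := n + 1) (by omega))) ?_ ((hu.lowB j).dS ℓ)
      ((hu.mul' (hu.iter ℓ _)).mul' hu.velCorr)
    have h0 := h.mono (show n ≤ N by omega)
    refine ((h0.mul hp (Par.iter (n := j + 1) (h.mono (show n + (j + 1) ≤ N by omega))) hu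
      (hu.iter ℓ _)).mul hp (par_velCorr hp hu h (by omega)) (hu.mul' (hu.iter ℓ _))
      hu.velCorr).parity ?_
    exact ⟨j + 2, by ring⟩

/-- If the even derivatives of `u` up to order `2 i + 2` vanish at `p`, and `∂ₛ²ⁱ u` does not move
there, then the next even derivative vanishes as well. -/
lemma iterate_eq_zero_of_evol_eq_zero (hε : ε ≠ 0) (hp : p ∈ I) (hu : Smooth u) (i : ℕ)
    (h : Par ℓ p (2 * i + 3) 0 u) (h0 : evol ε ℓ u (2 * i) p = 0) :
    (dS ℓ)^[2 * i + 4] u p = 0 := by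
  have he : Even (0 + 2 * i) := ⟨i, by ring⟩
  have hA := par_lowA (n := 0) (j := 2 * i) hp hu h (by omega) 0 le_rfl he
  have hB := par_lowB (n := 0) (j := 2 * i) hp hu h (by omega) 0 le_rfl he
  have h2 := h (2 * i + 2) (by omega) ⟨i + 1, by ring⟩
  simp only [Function.iterate_zero, id_eq] at hA hB
  rw [evol_eq hu (2 * i) hp] at h0
  simp only [Pi.add_apply, Pi.smul_apply, smul_eq_mul, hA, hB, h2] at h0
  simpa [hε] using h0

end Parity

section WeightsOfEvolution
variable {ι : Type*} {ℓ z : ι → ℝ} {U : ι → ℝ → ℝ} {n m j : ℕ}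

lemma l2W_cube (hℓ : ∀ a, 0 < ℓ a) (hz : ∀ a, 1 ≤ z a) (hU : ∀ a, Smooth (U a))
    (hS : SupW ℓ z n 1 U) (hL : L2W ℓ z n 0 U) :
    L2W ℓ z n 2 (fun a => U a * U a * U a) :=
  L2W.mul hℓ hz (hS.mul hz hS hU hU) hL (fun a => (hU a).mul' (hU a)) hU

lemma supW_cube (hz : ∀ a, 1 ≤ z a) (hU : ∀ a, Smooth (U a)) (hS : SupW ℓ z n 1 U) :
    SupW ℓ z n 3 (fun a => U a * U a * U a) :=
  (hS.mul hz hS hU hU).mul hz hS (fun a => (hU a).mul' (hU a)) hU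

variable (hℓ : ∀ a, 0 < ℓ a) (hz : ∀ a, 1 ≤ z a) (hU : ∀ a, Smooth (U a))
  (hS : SupW ℓ z m 1 U) (hL : L2W ℓ z (m + 1) 0 U)
include hz hU hS

lemma supW_velCorr (hn : n + 2 ≤ m) : SupW ℓ z n 5 (fun a => velCorr (ℓ a) (U a)) :=
  ((SupW.iter (m := 2) (hS.mono hn)).const_smul _).add
    (((supW_cube hz hU (hS.mono (by omega))).weight hz (by norm_num)).const_smul _)
    (fun a => ((hU a).iter _ 2).smul' _) (fun a => (hU a).cube.smul' _)

include hℓ hL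

lemma l2W_velCorr (hn : n + 1 ≤ m) : L2W ℓ z n 4 (fun a => velCorr (ℓ a) (U a)) :=
  ((L2W.iter (m := 2) (hL.mono (by omega))).const_smul _).add hℓ
    (((l2W_cube hℓ hz hU (hS.mono (by omega)) (hL.mono (by omega))).weight hz
      (by norm_num)).const_smul _)
    (fun a => ((hU a).iter _ 2).smul' _) (fun a => (hU a).cube.smul' _)

lemma l2W_lowA (hn : n + j ≤ m) : L2W ℓ z n (2 + 2 * j) (fun a => lowA (ℓ a) (U a) j) := by
  induction j generalizing n with
  | zero => exact l2W_cube hℓ hz hU (hS.mono hn) (hL.mono (by omega))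
  | succ j ih =>
    have hS0 := hS.mono (show n ≤ m by omega)
    have h1 := L2W.dS (ih (n := n + 1) (by omega))
    have h2 := L2W.mul hℓ hz (hS0.mul hz hS0 hU hU)
      (L2W.iter (m := j + 1) (hL.mono (show n + (j + 1) ≤ m + 1 by omega)))
      (fun a => (hU a).mul' (hU a)) (fun a => (hU a).iter _ _)
    rw [show 1 + 1 + (0 + 2 * (j + 1)) = 2 + 2 * (j + 1) by ring] at h2
    exact h1.add hℓ h2 (fun a => ((hU a).lowA j).dS _)
      (fun a => ((hU a).mul' (hU a)).mul' ((hU a).iter _ _))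

lemma l2W_lowB (hn : n + j + 1 ≤ m) : L2W ℓ z n (6 + 2 * j) (fun a => lowB (ℓ a) (U a) j) := by
  induction j generalizing n with
  | zero =>
    have hS0 := hS.mono (show n ≤ m by omega)
    have hSS := hS0.mul hz hS0 hU hU
    have sUU := fun a => (hU a).mul' (hU a)
    have sd := fun a => (hU a).dS (ℓ a)
    have h1 := L2W.mul hℓ hz hSS (L2W.iter (m := 2) (hL.mono (show n + 2 ≤ m + 1 by omega))) sUU
      (fun a => (hU a).iter _ 2)
    have h2 := L2W.mul hℓ hz hS0 (L2W.mul hℓ hz (SupW.dS (hS.mono (show n + 1 ≤ m by omega)))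
      (L2W.dS (hL.mono (show n + 1 ≤ m + 1 by omega))) sd sd) hU (fun a => (sd a).mul' (sd a))
    have h3 := L2W.mul hℓ hz hSS (l2W_cube hℓ hz hU hS0 (hL.mono (by omega))) sUU
      (fun a => (hU a).cube)
    exact ((h1.const_smul (-5)).add hℓ (h2.const_smul (-6))
      (fun a => ((sUU a).mul' ((hU a).iter _ 2)).smul' _)
      (fun a => ((hU a).mul' ((sd a).mul' (sd a))).smul' _)).add hℓ
      ((h3.weight hz (by norm_num)).const_smul (-1))
      (fun a => (((sUU a).mul' ((hU a).iter _ 2)).smul' _).add'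
        (((hU a).mul' ((sd a).mul' (sd a))).smul' _))
      (fun a => ((sUU a).mul' (hU a).cube).smul' _)
  | succ j ih =>
    have hS0 := hS.mono (show n ≤ m by omega)
    have h1 := L2W.dS (ih (n := n + 1) (by omega))
    have h2 := L2W.mul hℓ hz (hS0.mul hz
      (SupW.iter (m := j + 1) (hS.mono (show n + (j + 1) ≤ m by omega))) hU
      (fun a => (hU a).iter _ _)) (l2W_velCorr hℓ hz hU hS hL (n := n) (by omega))
      (fun a => (hU a).mul' ((hU a).iter _ _)) (fun a => (hU a).velCorr)
    rw [show 1 + (1 + 2 * (j + 1)) + 4 = 6 + 2 * (j + 1) by ring] at h2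
    exact h1.add hℓ h2 (fun a => ((hU a).lowB j).dS _)
      (fun a => ((hU a).mul' ((hU a).iter _ _)).mul' (hU a).velCorr)

end WeightsOfEvolution

/-! ### Energy inequalities at a fixed time -/

/-- A smooth function on `[0, 1]` that may occur as the curvature of a solution at a positive time,
with the length `ℓ` of the curve and the bound `M` on the `L²(ds)` norm. -/
structure OddCurv (M : ℝ) where
  ℓ : ℝ
  u : ℝ → ℝ
  pos : 0 < ℓ
  smooth : Smooth u
  odd : OddEnds ℓ u
  bound : nrm ℓ u ≤ M

lemma OddCurv.supW {M : ℝ} (hM : 1 ≤ M) (m : ℕ) :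
    SupW (fun a : OddCurv M => a.ℓ) (fun a => scale (m + 1) a.ℓ a.u) m 1 (fun a => a.u) :=
  ⟨2 * M, by linarith, fun a i hi _ hx =>
    abs_iterate_le m.succ_ne_zero hM a.pos a.smooth a.odd a.bound (by omega) hx⟩

lemma OddCurv.l2W {M : ℝ} (hM : 1 ≤ M) (m : ℕ) :
    L2W (fun a : OddCurv M => a.ℓ) (fun a => scale (m + 1) a.ℓ a.u) (m + 1) 0 (fun a => a.u) :=
  ⟨M, by linarith, fun a i hi => by
    rw [zero_add]
    exact nrm_iterate_le m.succ_ne_zero hM a.pos a.smooth a.odd a.bound hi⟩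

lemma mul_pow_le_absorb {D y : ℝ} (hD : 0 ≤ D) (hy : 0 ≤ y) (n : ℕ) :
    D * y ^ n ≤ y ^ (n + 1) + D ^ (n + 1) := by
  rcases le_total D y with h | h
  · have : D * y ^ n ≤ y * y ^ n := mul_le_mul_of_nonneg_right h (by positivity)
    have h2 : 0 ≤ D ^ (n + 1) := by positivity
    rw [pow_succ' y]
    linarith
  · have h1 : y ^ n ≤ D ^ n := pow_le_pow_left₀ hy h n
    have : D * y ^ n ≤ D * D ^ n := mul_le_mul_of_nonneg_left h1 hD
    have h2 : 0 ≤ y ^ (n + 1) := by positivity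
    rw [pow_succ' D]
    linarith

/-- A product of derivatives of total weight `4 l - 2` is absorbed by `‖∂ₛˡ u‖²`. -/
lemma absorb_scale {ℓ D : ℝ} {u : ℝ → ℝ} {l : ℕ} (hl : l ≠ 0) (hD : 0 ≤ D) :
    D * scale l ℓ u ^ (4 * l - 2) ≤ 1 + nrm ℓ ((dS ℓ)^[l] u) ^ 2 + D ^ (2 * l) := by
  have hz := one_le_scale (ℓ := ℓ) (u := u) l
  have h := mul_pow_le_absorb hD (sq_nonneg (scale l ℓ u)) (2 * l - 1)
  rw [← pow_mul, ← pow_mul, show 2 * (2 * l - 1) = 4 * l - 2 by omega,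
    show 2 * (2 * l - 1 + 1) = 4 * l by omega, show 2 * l - 1 + 1 = 2 * l by omega,
    scale_pow hl] at h
  have : max 1 (nrm ℓ ((dS ℓ)^[l] u) ^ 2) ≤ 1 + nrm ℓ ((dS ℓ)^[l] u) ^ 2 :=
    max_le (by nlinarith [sq_nonneg (nrm ℓ ((dS ℓ)^[l] u))]) (by linarith)
  linarith

/-- The right-hand side of the evolution equation of `‖∂ₛʲ u‖²`; the second term comes from the
motion of the arclength element. -/
def energyRate (ε ℓ : ℝ) (u : ℝ → ℝ) (j : ℕ) : ℝ :=
  2 * ip ℓ ((dS ℓ)^[j] u) (evol ε ℓ u j) -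
    ip ℓ ((dS ℓ)^[j] u) (u * (dS ℓ)^[j] u * vel ε ℓ u)

lemma ip_evol {ε ℓ : ℝ} {u : ℝ → ℝ} (hℓ : 0 < ℓ) (hu : Smooth u) (hodd : OddEnds ℓ u) (j : ℕ) :
    ip ℓ ((dS ℓ)^[j] u) (evol ε ℓ u j) = -nrm ℓ ((dS ℓ)^[j + 1] u) ^ 2 -
      2 * ε * nrm ℓ ((dS ℓ)^[j + 2] u) ^ 2 + ip ℓ ((dS ℓ)^[j] u) (lowA ℓ u j) +
      ε * ip ℓ ((dS ℓ)^[j] u) (lowB ℓ u j) := by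
  have s := (hu.iter ℓ j).continuousOn
  have s2 := hu.iter ℓ (j + 2)
  have s4 := (hu.iter ℓ (j + 4)).smul' (-(2 * ε))
  have sA := hu.lowA (ℓ := ℓ) j
  have sB := (hu.lowB (ℓ := ℓ) j).smul' ε
  rw [ip_congr ℓ (eqOn_refl _ _) (evol_eq hu j),
    ip_add_right ℓ s ((s2.add' s4).add' sA).continuousOn sB.continuousOn,
    ip_add_right ℓ s (s2.add' s4).continuousOn sA.continuousOn,
    ip_add_right ℓ s s2.continuousOn s4.continuousOn, ip_smul_right, ip_smul_right,
    ip_iterate_two hℓ hu hodd, ip_iterate_four hℓ hu hodd]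
  ring

lemma ip_mul_self_nonneg {ℓ : ℝ} (hℓ : 0 ≤ ℓ) (u k : ℝ → ℝ) : 0 ≤ ip ℓ k (u * k * u) := by
  have : ip ℓ k (u * k * u) = ip ℓ (u * k) (u * k) := by
    simp only [ip, Pi.mul_apply]
    congr 2
    funext x
    ring
  rw [this, ip_self hℓ]
  positivity

/-- The energy inequality for `‖∂ₛʲ u‖²`, with a constant that depends only on `j` and on a bound for
`‖u‖`; in particular it depends neither on `ε ∈ (0, 1]` nor on the length of the curve. -/
lemma exists_energyRate_le {M : ℝ} (hM : 1 ≤ M) (j : ℕ) : ∃ C : ℝ, 0 ≤ C ∧ ∀ ε ℓ : ℝ,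
    ∀ u : ℝ → ℝ, 0 < ε → ε ≤ 1 → 0 < ℓ → Smooth u → OddEnds ℓ u → nrm ℓ u ≤ M →
    energyRate ε ℓ u j ≤ -nrm ℓ ((dS ℓ)^[j + 1] u) ^ 2 + C := by
  have hℓ : ∀ a : OddCurv M, 0 < a.ℓ := fun a => a.pos
  have hU : ∀ a : OddCurv M, Smooth a.u := fun a => a.smooth
  have hz1 : ∀ a : OddCurv M, 1 ≤ scale (j + 1) a.ℓ a.u := fun a => one_le_scale _
  have hz2 : ∀ a : OddCurv M, 1 ≤ scale (j + 2) a.ℓ a.u := fun a => one_le_scale _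
  obtain ⟨C1, hC1, h1⟩ := l2W_lowA (n := 0) (j := j) hℓ hz1 hU (OddCurv.supW hM j)
    (OddCurv.l2W hM j) (by omega)
  obtain ⟨C2, hC2, h2⟩ := l2W_lowB (n := 0) (j := j) hℓ hz2 hU (OddCurv.supW hM (j + 1))
    (OddCurv.l2W hM (j + 1)) (by omega)
  have hS := OddCurv.supW hM (j + 1)
  obtain ⟨C3, hC3, h3⟩ := L2W.mul hℓ hz2 ((hS.mono (Nat.zero_le _)).mul hz2
      (SupW.iter (n := 0) (m := j) (hS.mono (by omega))) hU (fun a => (hU a).iter _ _))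
    (l2W_velCorr (n := 0) hℓ hz2 hU hS (OddCurv.l2W hM (j + 1)) (by omega))
    (fun a => (hU a).mul' ((hU a).iter _ _)) (fun a => (hU a).velCorr)
  set D1 : ℝ := 2 * (M * C1) with hD1
  set D2 : ℝ := M * (2 * C2 + C3) with hD2
  have hM0 : 0 ≤ M := by linarith
  have hD1n : 0 ≤ D1 := by positivity
  have hD2n : 0 ≤ D2 := by positivity
  refine ⟨2 + D1 ^ (2 * (j + 1)) + D2 ^ (2 * (j + 2)), by positivity, ?_⟩
  intro ε ℓ u hε hε1 hℓ' hu hodd hb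
  let a : OddCurv M := ⟨ℓ, u, hℓ', hu, hodd, hb⟩
  have h1 := h1 a 0 le_rfl
  have h2 := h2 a 0 le_rfl
  have h3 := h3 a 0 le_rfl
  simp only [Function.iterate_zero, id_eq, mul_zero, add_zero, Pi.mul_apply, a] at h1 h2 h3
  have hk1 := nrm_iterate_le (l := j + 1) (by omega) hM hℓ' hu hodd hb (i := j) (by omega)
  have hk2 := nrm_iterate_le (l := j + 2) (by omega) hM hℓ' hu hodd hb (i := j) (by omega)
  have sk := hu.iter ℓ j
  have sV := hu.velCorr (ℓ := ℓ)
  have huk := hu.mul' sk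
  set k := (dS ℓ)^[j] u with hk
  have hz1 := one_le_scale (ℓ := ℓ) (u := u) (j + 1)
  have hz2 := one_le_scale (ℓ := ℓ) (u := u) (j + 2)
  have e1 : |ip ℓ k (lowA ℓ u j)| ≤ M * C1 * scale (j + 1) ℓ u ^ (4 * (j + 1) - 2) := by
    refine (abs_ip_le hℓ'.le sk.continuousOn (hu.lowA j).continuousOn).trans
      ((mul_le_mul hk1 h1 (nrm_nonneg _ _) (by positivity)).trans_eq ?_)
    rw [show 4 * (j + 1) - 2 = 2 * j + (2 + 2 * j) by omega, pow_add]
    ring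
  have e2 : |ip ℓ k (lowB ℓ u j)| ≤ M * C2 * scale (j + 2) ℓ u ^ (4 * (j + 2) - 2) := by
    refine (abs_ip_le hℓ'.le sk.continuousOn (hu.lowB j).continuousOn).trans
      ((mul_le_mul hk2 h2 (nrm_nonneg _ _) (by positivity)).trans_eq ?_)
    rw [show 4 * (j + 2) - 2 = 2 * j + (6 + 2 * j) by omega, pow_add]
    ring
  have e3 : |ip ℓ k (u * k * velCorr ℓ u)| ≤ M * C3 * scale (j + 2) ℓ u ^ (4 * (j + 2) - 2) := by
    refine (abs_ip_le hℓ'.le sk.continuousOn (huk.mul' sV).continuousOn).trans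
      ((mul_le_mul hk2 h3 (nrm_nonneg _ _) (by positivity)).trans_eq ?_)
    rw [show 4 * (j + 2) - 2 = 2 * j + (1 + (1 + 2 * j) + 4) by omega, pow_add]
    ring
  have e4 : ip ℓ k (u * k * vel ε ℓ u) =
      ip ℓ k (u * k * u) + ε * ip ℓ k (u * k * velCorr ℓ u) := by
    rw [← ip_smul_right, ← ip_add_right ℓ sk.continuousOn (huk.mul' hu).continuousOn
      ((huk.mul' sV).smul' ε).continuousOn, vel, mul_add, mul_smul_comm]
  have e5 := ip_mul_self_nonneg hℓ'.le u k
  have f1 := absorb_scale (ℓ := ℓ) (u := u) (l := j + 1) (by omega) hD1n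
  have f2 := absorb_scale (ℓ := ℓ) (u := u) (l := j + 2) (by omega) hD2n
  rw [energyRate, ip_evol hℓ' hu hodd, ← hk, e4]
  have g1 := (abs_le.1 e1).2
  have g2 := (abs_le.1 e2).2
  have g3 := (abs_le.1 e3).1
  set Z1 := scale (j + 1) ℓ u ^ (4 * (j + 1) - 2)
  set Z2 := scale (j + 2) ℓ u ^ (4 * (j + 2) - 2)
  set B1 := nrm ℓ ((dS ℓ)^[j + 1] u) ^ 2
  set B2 := nrm ℓ ((dS ℓ)^[j + 2] u) ^ 2
  have hB2 : 0 ≤ B2 := sq_nonneg _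
  have hP2 : 0 ≤ D2 ^ (2 * (j + 2)) := by positivity
  -- the terms with the factor `ε` are absorbed by the good term with the same factor
  have q : ε * (-4 * B2 + 2 * ip ℓ k (lowB ℓ u j) - ip ℓ k (u * k * velCorr ℓ u)) ≤
      1 + D2 ^ (2 * (j + 2)) := by
    have : -4 * B2 + 2 * ip ℓ k (lowB ℓ u j) - ip ℓ k (u * k * velCorr ℓ u) ≤
        1 + D2 ^ (2 * (j + 2)) := by
      have : D2 * Z2 = 2 * (M * C2 * Z2) + M * C3 * Z2 := by rw [hD2]; ring
      linarith
    nlinarith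
  have : D1 * Z1 = 2 * (M * C1 * Z1) := by rw [hD1]; ring
  linarith

/-- The inequality for `A = ‖u‖²` that gives the existence time: `A' ≤ A³`. -/
lemma energyRate_zero_le {ε ℓ : ℝ} {u : ℝ → ℝ} (hε : 0 ≤ ε) (hℓ : 0 < ℓ) (hu : Smooth u)
    (hodd : OddEnds ℓ u) : energyRate ε ℓ u 0 ≤ (nrm ℓ u ^ 2) ^ 3 := by
  have sV := hu.vel (ε := ε) (ℓ := ℓ)
  have s2 := hu.iter ℓ 2
  have u0 := (hodd 0).1
  have u1 := (hodd 0).2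
  simp only [mul_zero, Function.iterate_zero, id_eq] at u0 u1
  have V0 : vel ε ℓ u 0 = 0 := by
    simp only [vel, velCorr, Pi.add_apply, Pi.smul_apply, Pi.mul_apply, smul_eq_mul, u0,
      (hodd 1).1]
    simp
  have V1 : vel ε ℓ u 1 = 0 := by
    simp only [vel, velCorr, Pi.add_apply, Pi.smul_apply, Pi.mul_apply, smul_eq_mul, u1,
      (hodd 1).2]
    simp
  have i1 : ip ℓ u ((dS ℓ)^[2] (vel ε ℓ u)) = ip ℓ ((dS ℓ)^[2] u) (vel ε ℓ u) := by
    change ip ℓ u (dS ℓ (dS ℓ (vel ε ℓ u))) = ip ℓ (dS ℓ (dS ℓ u)) (vel ε ℓ u)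
    rw [ip_dS hℓ.ne' hu.one (sV.dS ℓ).one (by rw [u0, zero_mul]) (by rw [u1, zero_mul]),
      ip_dS hℓ.ne' (hu.dS ℓ).one sV.one (by rw [V0, mul_zero]) (by rw [V1, mul_zero]), neg_neg]
  -- The rate is `∫ V (2 ∂ₛ² u + u³) ds`.
  set q : ℝ → ℝ := (2 : ℝ) • (dS ℓ)^[2] u + u * u * u with hq
  have sq' : Smooth q := (s2.smul' 2).add' hu.cube
  have e1 : energyRate ε ℓ u 0 = ip ℓ q (vel ε ℓ u) := by
    have c1 : ip ℓ u (u * u * vel ε ℓ u) = ip ℓ (vel ε ℓ u) (u * u * u) := by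
      simp only [ip, Pi.mul_apply]
      congr 2
      funext x
      ring
    rw [energyRate, ip_comm ℓ q, hq, ip_add_right ℓ sV.continuousOn (s2.smul' 2).continuousOn
      hu.cube.continuousOn, ip_smul_right, ip_comm ℓ (vel ε ℓ u) ((dS ℓ)^[2] u), ← i1, ← c1]
    change 2 * ip ℓ u ((dS ℓ)^[2] (vel ε ℓ u) + u * u * vel ε ℓ u) - ip ℓ u (u * u * vel ε ℓ u) = _
    rw [ip_add_right ℓ hu.continuousOn (sV.iter ℓ 2).continuousOn
      ((hu.mul' hu).mul' sV).continuousOn]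
    ring
  have e2 : vel ε ℓ u = u + (-ε) • q := by
    rw [vel, velCorr, hq]
    funext x
    simp only [Pi.add_apply, Pi.smul_apply, Pi.mul_apply, smul_eq_mul]
    ring
  have e3 : ip ℓ q (vel ε ℓ u) = ip ℓ u q - ε * nrm ℓ q ^ 2 := by
    rw [e2, ip_add_right ℓ sq'.continuousOn hu.continuousOn (sq'.smul' _).continuousOn,
      ip_smul_right, ip_self hℓ.le, ip_comm ℓ q u]
    ring
  have e4 : ip ℓ u q = -2 * nrm ℓ (dS ℓ u) ^ 2 + nrm ℓ (u * u) ^ 2 := by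
    have c2 : ip ℓ u (u * u * u) = ip ℓ (u * u) (u * u) := by
      simp only [ip, Pi.mul_apply]
      congr 2
      funext x
      ring
    rw [hq, ip_add_right ℓ hu.continuousOn (s2.smul' 2).continuousOn hu.cube.continuousOn,
      ip_smul_right, c2, ip_self hℓ.le]
    have := ip_iterate_two hℓ hu hodd 0
    simp only [Function.iterate_zero, id_eq, zero_add, Function.iterate_one] at this
    rw [this]
    ring
  have hsup : ∀ x ∈ I, |u x| ≤ √(2 * (nrm ℓ u * nrm ℓ (dS ℓ u))) := fun x hx =>
    Real.abs_le_sqrt (sq_le_of_zero hℓ hu.one zero_mem_I u0 hx)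
  have e5 := nrm_mul_le hℓ.le (Real.sqrt_nonneg _) hu.continuousOn hu.continuousOn hsup
  have hn0 := nrm_nonneg ℓ u
  have hn1 := nrm_nonneg ℓ (dS ℓ u)
  have e6 : nrm ℓ (u * u) ^ 2 ≤ 2 * (nrm ℓ u * nrm ℓ (dS ℓ u)) * nrm ℓ u ^ 2 := by
    have := pow_le_pow_left₀ (nrm_nonneg _ _) e5 2
    rwa [mul_pow, Real.sq_sqrt (by positivity)] at this
  rw [e1, e3, e4]
  have e7 : 0 ≤ ε * nrm ℓ q ^ 2 := by positivity
  nlinarith [sq_nonneg (nrm ℓ (dS ℓ u) - nrm ℓ u ^ 3), sq_nonneg (nrm ℓ (dS ℓ u))]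

/-! ### Comparison with the initial curvature, at a fixed time -/

/-- The data at a positive time of a solution with a lower bound `L₁` for the length: the curvature
and the tangential velocity `lam`, whose derivative is `u V + μ` with a constant `μ`, because the
parametrization has constant speed. -/
structure DriftCurv (M L₁ : ℝ) extends OddCurv M where
  ε : ℝ
  lam : ℝ → ℝ
  μ : ℝ
  ε_pos : 0 < ε
  ε_le : ε ≤ 1
  le_ℓ : L₁ ≤ ℓ
  lam_smooth : Smooth lam
  dS_lam : EqOn (dS ℓ lam) (u * vel ε ℓ u + fun _ => μ) I
  lam_zero : lam 0 = 0
  lam_one : lam 1 = 0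

lemma dS_const (ℓ c : ℝ) : dS ℓ (fun _ => c) = fun _ => 0 := by
  funext x
  simp [dS]

lemma dS_iterate_succ_const (ℓ c : ℝ) (n : ℕ) : (dS ℓ)^[n + 1] (fun _ => c) = fun _ => 0 := by
  rw [Function.iterate_succ_apply, dS_const]
  induction n with
  | zero => rfl
  | succ n ih => rw [Function.iterate_succ_apply, dS_const, ih]

lemma smooth_const (c : ℝ) : Smooth (fun _ => c) := contDiffOn_const

section
variable {M L₁ : ℝ}

/-- Since `lam` vanishes at both ends, `u V + μ` has mean zero. -/
lemma DriftCurv.ip_vel (a : DriftCurv M L₁) : ip a.ℓ a.u (vel a.ε a.ℓ a.u) = -(a.ℓ * a.μ) := by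
  have sV := a.smooth.vel (ε := a.ε) (ℓ := a.ℓ)
  have h := ip_dS (ℓ := a.ℓ) a.pos.ne' (f := fun _ => 1) (g := a.lam) (smooth_const 1).one
    a.lam_smooth.one (by rw [a.lam_zero, mul_zero]) (by rw [a.lam_one, mul_zero])
  rw [dS_const, ip_congr a.ℓ (eqOn_refl _ _) a.dS_lam,
    ip_add_right a.ℓ continuousOn_const (a.smooth.mul' sV).continuousOn continuousOn_const] at h
  simp only [ip, Pi.mul_apply, one_mul, zero_mul, intervalIntegral.integral_const, smul_eq_mul] at *
  linarith

lemma DriftCurv.abs_mul_μ_le (a : DriftCurv M L₁) :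
    a.ℓ * |a.μ| ≤ nrm a.ℓ a.u * nrm a.ℓ (vel a.ε a.ℓ a.u) := by
  have h := abs_ip_le a.pos.le a.smooth.continuousOn
    (a.smooth.vel (ε := a.ε) (ℓ := a.ℓ)).continuousOn
  rwa [a.ip_vel, abs_neg, abs_mul, abs_of_pos a.pos] at h

lemma DriftCurv.abs_lam_le (a : DriftCurv M L₁) {x : ℝ} (hx : x ∈ I) :
    |a.lam x| ≤ 2 * (nrm a.ℓ a.u * nrm a.ℓ (vel a.ε a.ℓ a.u)) := by
  have cu := a.smooth.continuousOn
  have cV := (a.smooth.vel (ε := a.ε) (ℓ := a.ℓ)).continuousOn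
  have h := abs_sub_le_integral a.pos a.lam_smooth.one hx zero_mem_I
  rw [a.lam_zero, sub_zero] at h
  have i1 : IntervalIntegrable (fun s => |a.u s| * |vel a.ε a.ℓ a.u s|)
      MeasureTheory.volume 0 1 := intervalIntegrable_of_continuousOn (cu.abs.mul cV.abs)
  have h2 : ∫ s in (0 : ℝ)..1, |dS a.ℓ a.lam s| ≤
      (∫ s in (0 : ℝ)..1, |a.u s| * |vel a.ε a.ℓ a.u s|) + |a.μ| := by
    calc ∫ s in (0 : ℝ)..1, |dS a.ℓ a.lam s|
        ≤ ∫ s in (0 : ℝ)..1, (|a.u s| * |vel a.ε a.ℓ a.u s| + |a.μ|) := by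
          refine intervalIntegral.integral_mono_on zero_le_one
            (intervalIntegrable_of_continuousOn (a.lam_smooth.dS a.ℓ).continuousOn.abs)
            (i1.add intervalIntegrable_const) fun s hs => ?_
          rw [a.dS_lam hs, ← abs_mul]
          exact abs_add_le _ _
      _ = _ := by
          rw [intervalIntegral.integral_add i1 intervalIntegrable_const]
          simp
  have h3 := integral_abs_mul_le a.pos.le cu cV
  have h4 := a.abs_mul_μ_le
  have h5 := mul_le_mul_of_nonneg_left h2 a.pos.le
  rw [mul_add] at h5
  linarith

variable (hM : 1 ≤ M)
include hM

lemma DriftCurv.supW (m : ℕ) : SupW (fun a : DriftCurv M L₁ => a.ℓ)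
    (fun a => scale (m + 1) a.ℓ a.u) m 1 (fun a => a.u) := by
  obtain ⟨C, hC, h⟩ := OddCurv.supW hM m
  exact ⟨C, hC, fun a => h a.toOddCurv⟩

lemma DriftCurv.l2W (m : ℕ) : L2W (fun a : DriftCurv M L₁ => a.ℓ)
    (fun a => scale (m + 1) a.ℓ a.u) (m + 1) 0 (fun a => a.u) := by
  obtain ⟨C, hC, h⟩ := OddCurv.l2W hM m
  exact ⟨C, hC, fun a => h a.toOddCurv⟩

/-- The tangential velocity has weight four, one less than the normal velocity. -/
lemma DriftCurv.supW_lam (hL : 0 < L₁) (n : ℕ) : SupW (fun a : DriftCurv M L₁ => a.ℓ)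
    (fun a => scale (n + 2) a.ℓ a.u) n 4 (fun a => a.lam) := by
  have hℓ : ∀ a : DriftCurv M L₁, 0 < a.ℓ := fun a => a.pos
  have hU : ∀ a : DriftCurv M L₁, Smooth a.u := fun a => a.smooth
  have hz : ∀ a : DriftCurv M L₁, 1 ≤ scale (n + 2) a.ℓ a.u := fun a => one_le_scale _
  have hS := DriftCurv.supW (L₁ := L₁) hM (n + 1)
  have hLL := DriftCurv.l2W (L₁ := L₁) hM (n + 1)
  have hε : ∀ a : DriftCurv M L₁, |a.ε| ≤ 1 := fun a => by rw [abs_of_pos a.ε_pos]; exact a.ε_le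
  have hM0 : 0 ≤ M := by linarith
  obtain ⟨C, hC, hV⟩ : L2W (fun a : DriftCurv M L₁ => a.ℓ) (fun a => scale (n + 2) a.ℓ a.u) 0 4
      (fun a => vel a.ε a.ℓ a.u) :=
    ((hLL.mono (Nat.zero_le _)).weight hz (by norm_num)).add hℓ
      ((l2W_velCorr (n := 0) hℓ hz hU hS hLL (by omega)).smul hε) hU
      (fun a => (hU a).velCorr.smul' _)
  have hV0 : ∀ a : DriftCurv M L₁, nrm a.ℓ a.u * nrm a.ℓ (vel a.ε a.ℓ a.u) ≤
      M * C * scale (n + 2) a.ℓ a.u ^ 4 := fun a => by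
    have h := hV a 0 le_rfl
    simp only [Function.iterate_zero, id_eq, mul_zero, add_zero] at h
    exact (mul_le_mul a.bound h (nrm_nonneg _ _) hM0).trans_eq (by ring)
  have h0 : SupW (fun a : DriftCurv M L₁ => a.ℓ) (fun a => scale (n + 2) a.ℓ a.u) 0 4
      (fun a => a.lam) := by
    refine ⟨2 * (M * C), by positivity, fun a i hi x hx => ?_⟩
    obtain rfl : i = 0 := by omega
    have := hV0 a
    have := a.abs_lam_le hx
    simp only [Function.iterate_zero, id_eq, mul_zero, add_zero]
    linarith
  rcases n with _ | n
  · exact h0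
  refine SupW.of_succ hz h0 ?_
  have hVel : SupW (fun a : DriftCurv M L₁ => a.ℓ) (fun a => scale (n + 3) a.ℓ a.u) n 5
      (fun a => vel a.ε a.ℓ a.u) :=
    ((hS.mono (by omega)).weight hz (by norm_num)).add
      ((supW_velCorr (n := n) hz hU hS (by omega)).smul hε) hU
      (fun a => (hU a).velCorr.smul' _)
  have hμ : SupW (fun a : DriftCurv M L₁ => a.ℓ) (fun a => scale (n + 3) a.ℓ a.u) n 6
      (fun a => fun _ => a.μ) := by
    refine ⟨L₁⁻¹ * (M * C), by positivity, fun a i hi x hx => ?_⟩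
    have hz1 := hz a
    rcases i with _ | i
    · have h1 := (mul_le_mul_of_nonneg_right a.le_ℓ (abs_nonneg a.μ)).trans
        (a.abs_mul_μ_le.trans (hV0 a))
      have h2 : |a.μ| ≤ L₁⁻¹ * (M * C * scale (n + 1 + 2) a.ℓ a.u ^ 4) := by
        rw [inv_mul_eq_div, le_div_iff₀ hL]
        linarith
      have h3 : scale (n + 1 + 2) a.ℓ a.u ^ 4 ≤ scale (n + 1 + 2) a.ℓ a.u ^ 6 :=
        pow_le_pow_right₀ hz1 (by norm_num)
      simp only [Function.iterate_zero, id_eq, mul_zero, add_zero]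
      refine h2.trans ?_
      rw [mul_assoc L₁⁻¹]
      gcongr
    · rw [dS_iterate_succ_const, abs_zero]
      positivity
  exact (((hS.mono (by omega)).mul hz hVel hU (fun a => (hU a).vel)).add hμ
    (fun a => (hU a).mul' (hU a).vel) (fun a => smooth_const _)).congr fun a => a.dS_lam

end

/-- The rate of change of `‖∂ₛʲ (u - φ)‖²` controls `ε ‖∂ₛʲ⁺² u‖²` by `ε ‖∂ₛʲ⁺² φ‖²`, with an error that
tends to zero with `‖∂ₛʲ (u - φ)‖`. Here `φ` stands for the curvature of the initial curve, and only
its even derivatives of order at most `j + 1` are assumed to vanish at the end points. -/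
lemma exists_comparison_rate_le {M L₁ : ℝ} (hM : 1 ≤ M) (hL : 0 < L₁) (j : ℕ) :
    ∃ C : ℝ, 0 ≤ C ∧ ∀ (a : DriftCurv M L₁) (φ : ℝ → ℝ), ContDiffOn ℝ (j + 2 : ℕ) φ I →
    (∀ i ≤ j + 1, Even i → (dS a.ℓ)^[i] φ 0 = 0 ∧ (dS a.ℓ)^[i] φ 1 = 0) →
    2 * ip a.ℓ ((dS a.ℓ)^[j] (a.u + (-1 : ℝ) • φ))
        ((dS a.ℓ)^[j] (evol a.ε a.ℓ a.u 0 + a.lam * dS a.ℓ a.u)) ≤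
      -(2 * a.ε) * (nrm a.ℓ ((dS a.ℓ)^[j + 2] a.u) ^ 2 - nrm a.ℓ ((dS a.ℓ)^[j + 2] φ) ^ 2) +
      C * nrm a.ℓ ((dS a.ℓ)^[j] (a.u + (-1 : ℝ) • φ)) *
        (1 + nrm a.ℓ ((dS a.ℓ)^[j + 2] a.u) ^ 2) := by
  have hℓ : ∀ a : DriftCurv M L₁, 0 < a.ℓ := fun a => a.pos
  have hU : ∀ a : DriftCurv M L₁, Smooth a.u := fun a => a.smooth
  have hz : ∀ a : DriftCurv M L₁, 1 ≤ scale (j + 2) a.ℓ a.u := fun a => one_le_scale _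
  have hS := DriftCurv.supW (L₁ := L₁) hM (j + 1)
  have hLL := DriftCurv.l2W (L₁ := L₁) hM (j + 1)
  have hε : ∀ a : DriftCurv M L₁, |a.ε| ≤ 1 := fun a => by rw [abs_of_pos a.ε_pos]; exact a.ε_le
  -- the terms of the evolution other than the fourth order one
  set R : DriftCurv M L₁ → ℝ → ℝ := fun a => (dS a.ℓ)^[2] a.u + lowA a.ℓ a.u 0 +
    a.ε • lowB a.ℓ a.u 0 + a.lam * dS a.ℓ a.u with hR
  have s2 : ∀ a : DriftCurv M L₁, Smooth ((dS a.ℓ)^[2] a.u) := fun a => (hU a).iter _ 2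
  have sA : ∀ a : DriftCurv M L₁, Smooth (lowA a.ℓ a.u 0) := fun a => (hU a).lowA 0
  have sB : ∀ a : DriftCurv M L₁, Smooth (a.ε • lowB a.ℓ a.u 0) := fun a =>
    ((hU a).lowB 0).smul' _
  have sl : ∀ a : DriftCurv M L₁, Smooth (a.lam * dS a.ℓ a.u) := fun a =>
    a.lam_smooth.mul' ((hU a).dS _)
  have sR : ∀ a, Smooth (R a) := fun a => (((s2 a).add' (sA a)).add' (sB a)).add' (sl a)
  obtain ⟨C, hC, hRb⟩ : L2W (fun a : DriftCurv M L₁ => a.ℓ) (fun a => scale (j + 2) a.ℓ a.u) j 6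
      R := by
    have h1 := (L2W.iter (n := j) (m := 2) hLL).weight hz (show 0 + 2 * 2 ≤ 6 by norm_num)
    have h2 := (l2W_lowA (n := j) (j := 0) hℓ hz hU hS hLL (by omega)).weight hz
      (show 2 + 2 * 0 ≤ 6 by norm_num)
    have h3 := (l2W_lowB (n := j) (j := 0) hℓ hz hU hS hLL (by omega)).smul hε
    have h4 := L2W.mul hℓ hz (DriftCurv.supW_lam hM hL j)
      (L2W.dS (n := j) (hLL.mono (by omega))) (fun a => a.lam_smooth) (fun a => (hU a).dS _)
    exact ((h1.add hℓ h2 s2 sA).add hℓ h3 (fun a => (s2 a).add' (sA a)) sB).add hℓ h4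
      (fun a => ((s2 a).add' (sA a)).add' (sB a)) sl
  refine ⟨2 * C, by positivity, fun a φ hφ hφ0 => ?_⟩
  have hu := a.smooth
  have hpos := a.pos
  have hw : ContDiffOn ℝ (j + 2 : ℕ) (a.u + (-1 : ℝ) • φ) I :=
    (hu.contDiffOn _).add (contDiffOn_const.smul hφ)
  set w := a.u + (-1 : ℝ) • φ with hwdef
  have hiter : ∀ i ≤ j + 2,
      EqOn ((dS a.ℓ)^[i] w) ((dS a.ℓ)^[i] a.u + (-1 : ℝ) • (dS a.ℓ)^[i] φ) I := fun i hi => by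
    rw [← dS_iterate_smul]
    have hi' : (i : WithTop ℕ∞) ≤ ((j + 2 : ℕ) : WithTop ℕ∞) := by exact_mod_cast hi
    exact dS_iterate_add_of_contDiffOn _ i (hu.contDiffOn i) (contDiffOn_const.smul (hφ.of_le hi'))
  have hw0 : ∀ i ≤ j + 1, Even i → (dS a.ℓ)^[i] w 0 = 0 ∧ (dS a.ℓ)^[i] w 1 = 0 := by
    intro i hi he
    have := hφ0 i hi he
    rw [hiter i (by omega) zero_mem_I, hiter i (by omega) one_mem_I]
    simp only [Pi.add_apply, Pi.smul_apply, this]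
    obtain ⟨m, rfl⟩ := even_iff_exists_two_mul.1 he
    simp [(a.odd m).1, (a.odd m).2]
  have cw2 : ContDiffOn ℝ 2 ((dS a.ℓ)^[j] w) I := contDiffOn_iterate_dS a.ℓ j 2 hw
  have cw1 : ContDiffOn ℝ 1 ((dS a.ℓ)^[j + 1] w) I := by
    simpa using contDiffOn_iterate_dS a.ℓ (j + 1) 1 hw
  have cφl : ContinuousOn ((dS a.ℓ)^[j + 2] φ) I :=
    (contDiffOn_iterate_dS a.ℓ (j + 2) 0 (by simpa using hφ)).continuousOn
  have cw := cw2.continuousOn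
  -- integration by parts in the fourth order term
  have ibp : ip a.ℓ ((dS a.ℓ)^[j] w) ((dS a.ℓ)^[j + 4] a.u) =
      ip a.ℓ ((dS a.ℓ)^[j + 2] w) ((dS a.ℓ)^[j + 2] a.u) := by
    have b1 : ∀ i ≤ j + 1, ∀ k, Odd (i + k) →
        (dS a.ℓ)^[i] w 0 * (dS a.ℓ)^[k] a.u 0 = 0 ∧ (dS a.ℓ)^[i] w 1 * (dS a.ℓ)^[k] a.u 1 = 0 := by
      intro i hi k hik
      rcases Nat.even_or_odd i with he | ho
      · rw [(hw0 i hi he).1, (hw0 i hi he).2, zero_mul, zero_mul]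
        exact ⟨rfl, rfl⟩
      · have hk : Even k := by
          by_contra h
          exact (Nat.not_even_iff_odd.2 hik) (ho.add_odd (Nat.not_even_iff_odd.1 h))
        obtain ⟨m, rfl⟩ := even_iff_exists_two_mul.1 hk
        rw [(a.odd m).1, (a.odd m).2, mul_zero, mul_zero]
        exact ⟨rfl, rfl⟩
    have e1 := b1 j (by omega) (j + 3) ⟨j + 1, by ring⟩
    have e2 := b1 (j + 1) le_rfl (j + 2) ⟨j + 1, by ring⟩
    rw [Function.iterate_succ_apply' (dS a.ℓ) (j + 3),
      ip_dS hpos.ne' (cw2.of_le (by norm_num)) (hu.iter a.ℓ (j + 3)).one e1.1 e1.2,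
      ← Function.iterate_succ_apply' (dS a.ℓ) j, Function.iterate_succ_apply' (dS a.ℓ) (j + 2),
      ip_dS hpos.ne' cw1 (hu.iter a.ℓ (j + 2)).one e2.1 e2.2, neg_neg,
      ← Function.iterate_succ_apply' (dS a.ℓ) (j + 1)]
  have split : ip a.ℓ ((dS a.ℓ)^[j] w) ((dS a.ℓ)^[j] (evol a.ε a.ℓ a.u 0 + a.lam * dS a.ℓ a.u)) =
      ip a.ℓ ((dS a.ℓ)^[j] w) ((dS a.ℓ)^[j] (R a)) -
        2 * a.ε * ip a.ℓ ((dS a.ℓ)^[j + 2] w) ((dS a.ℓ)^[j + 2] a.u) := by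
    have s4 := ((hu.iter a.ℓ 4).smul' (-(2 * a.ε)))
    have e : EqOn (evol a.ε a.ℓ a.u 0 + a.lam * dS a.ℓ a.u)
        (R a + (-(2 * a.ε)) • (dS a.ℓ)^[4] a.u) I := by
      intro x hx
      have := evol_eq (ε := a.ε) (ℓ := a.ℓ) hu 0 hx
      simp only [Pi.add_apply, Pi.smul_apply, zero_add, hR] at this ⊢
      rw [this]
      ring
    rw [ip_congr a.ℓ (eqOn_refl _ _) ((dS_iterate_congr a.ℓ j e).trans
      (dS_iterate_add a.ℓ j (sR a) s4)), ip_add_right a.ℓ cw ((sR a).iter a.ℓ j).continuousOn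
      (s4.iter a.ℓ j).continuousOn, dS_iterate_smul, ip_smul_right, ← Function.iterate_add_apply,
      ibp]
    ring
  -- the leading term
  have lead : nrm a.ℓ ((dS a.ℓ)^[j + 2] a.u) ^ 2 - nrm a.ℓ ((dS a.ℓ)^[j + 2] φ) ^ 2 ≤
      2 * ip a.ℓ ((dS a.ℓ)^[j + 2] w) ((dS a.ℓ)^[j + 2] a.u) := by
    have ck := (hu.iter a.ℓ (j + 2)).continuousOn
    rw [ip_comm, ip_congr a.ℓ (eqOn_refl _ _) (hiter (j + 2) le_rfl),
      ip_add_right a.ℓ ck ck (cφl.const_smul (-1 : ℝ)), ip_smul_right, ip_self hpos.le]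
    have h := (abs_le.1 (abs_ip_le hpos.le ck cφl)).2
    nlinarith [sq_nonneg (nrm a.ℓ ((dS a.ℓ)^[j + 2] a.u) - nrm a.ℓ ((dS a.ℓ)^[j + 2] φ))]
  have rest : ip a.ℓ ((dS a.ℓ)^[j] w) ((dS a.ℓ)^[j] (R a)) ≤
      nrm a.ℓ ((dS a.ℓ)^[j] w) * (C * (1 + nrm a.ℓ ((dS a.ℓ)^[j + 2] a.u) ^ 2)) := by
    refine (abs_le.1 (abs_ip_le hpos.le cw ((sR a).iter a.ℓ j).continuousOn)).2.trans
      (mul_le_mul_of_nonneg_left ((hRb a j le_rfl).trans (mul_le_mul_of_nonneg_left ?_ hC))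
        (nrm_nonneg _ _))
    refine (pow_le_pow_right₀ (hz a) (show 6 + 2 * j ≤ 4 * (j + 2) by omega)).trans ?_
    rw [scale_pow (by omega)]
    exact max_le (by nlinarith [sq_nonneg (nrm a.ℓ ((dS a.ℓ)^[j + 2] a.u))]) (by linarith)
  rw [split]
  have := mul_le_mul_of_nonneg_left lead (show 0 ≤ 2 * a.ε by linarith [a.ε_pos])
  nlinarith

/-! ### Calculus on the space-time domain `(0, ∞) × [0, 1]` -/

/-- The space-time domain. -/
def dom : Set (ℝ × ℝ) := Ioi 0 ×ˢ I

/-- Smoothness on `(0, ∞) × [0, 1]`, up to the lateral boundary. -/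
abbrev Smooth2 (F : ℝ × ℝ → ℝ) : Prop := ContDiffOn ℝ ∞ F dom

/-- The derivative in the direction `v` on the space-time domain, where a point is `(t, x)`; it is
one-sided on the lateral boundary. -/
def dd (v : ℝ × ℝ) (F : ℝ × ℝ → ℝ) (p : ℝ × ℝ) : ℝ := fderivWithin ℝ F dom p v

local notation "∂ₜ" => dd (1, 0)
local notation "∂ₓ" => dd (0, 1)

lemma uniqueDiffOn_dom : UniqueDiffOn ℝ dom := isOpen_Ioi.uniqueDiffOn.prod uniqueDiffOn_I

lemma mem_dom {t x : ℝ} (ht : 0 < t) (hx : x ∈ I) : (t, x) ∈ dom := ⟨ht, hx⟩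

lemma dom_subset_closure_interior : dom ⊆ closure (interior dom) := by
  rw [dom, interior_prod_eq, closure_prod_eq, isOpen_Ioi.interior_eq, interior_Icc,
    closure_Ioo zero_ne_one]
  exact prod_mono subset_closure le_rfl

section
variable {F G : ℝ × ℝ → ℝ} {v w : ℝ × ℝ}

lemma Smooth2.differentiableOn (hF : Smooth2 F) : DifferentiableOn ℝ F dom :=
  ContDiffOn.differentiableOn hF (by simp)

lemma Smooth2.dd (hF : Smooth2 F) (v : ℝ × ℝ) : Smooth2 (dd v F) :=
  (hF.fderivWithin uniqueDiffOn_dom le_rfl).clm_apply contDiffOn_const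

lemma dd_congr (v : ℝ × ℝ) (h : EqOn F G dom) : EqOn (dd v F) (dd v G) dom := by
  intro p hp
  rw [dd, dd, fderivWithin_congr h (h hp)]

lemma dd_add (hF : Smooth2 F) (hG : Smooth2 G) {p : ℝ × ℝ} (hp : p ∈ dom) :
    dd v (fun q => F q + G q) p = dd v F p + dd v G p := by
  rw [dd, fderivWithin_fun_add (uniqueDiffOn_dom p hp) (hF.differentiableOn p hp)
    (hG.differentiableOn p hp)]
  rfl

lemma dd_mul (hF : Smooth2 F) (hG : Smooth2 G) {p : ℝ × ℝ} (hp : p ∈ dom) :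
    dd v (fun q => F q * G q) p = dd v F p * G p + F p * dd v G p := by
  rw [dd, fderivWithin_fun_mul (uniqueDiffOn_dom p hp) (hF.differentiableOn p hp)
    (hG.differentiableOn p hp)]
  simp only [add_apply, FunLike.coe_smul, Pi.smul_apply, smul_eq_mul, dd]
  ring

lemma dd_const (c : ℝ) (p : ℝ × ℝ) : dd v (fun _ => c) p = 0 := by
  simp [dd]

lemma dd_comm (hF : Smooth2 F) {p : ℝ × ℝ} (hp : p ∈ dom) :
    dd v (dd w F) p = dd w (dd v F) p := by
  have hd : DifferentiableWithinAt ℝ (fderivWithin ℝ F dom) dom p :=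
    ((hF.fderivWithin uniqueDiffOn_dom (m := ∞) le_rfl).differentiableOn (by simp)) p hp
  have key : ∀ v w : ℝ × ℝ, dd v (dd w F) p =
      fderivWithin ℝ (fderivWithin ℝ F dom) dom p v w := by
    intro v w
    unfold dd
    rw [fderivWithin_clm_apply (uniqueDiffOn_dom p hp) hd (differentiableWithinAt_const w)]
    simp
  rw [key, key]
  exact (hF p hp).isSymmSndFDerivWithinAt (by
    rw [minSmoothness_of_isRCLikeNormedField]
    exact WithTop.coe_le_coe.2 le_top) uniqueDiffOn_dom
    (dom_subset_closure_interior hp) hp v w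

lemma hasDerivWithinAt_dx (hF : DifferentiableOn ℝ F dom) {t x : ℝ} (ht : 0 < t) (hx : x ∈ I) :
    HasDerivWithinAt (fun y => F (t, y)) (∂ₓ F (t, x)) I x := by
  have h1 := (hF (t, x) (mem_dom ht hx)).hasFDerivWithinAt
  have h2 : HasDerivWithinAt (fun y : ℝ => (t, y)) (0, 1) I x :=
    (hasDerivWithinAt_const x I t).prodMk (hasDerivWithinAt_id x I)
  exact h1.comp_hasDerivWithinAt x h2 (fun y hy => mem_dom ht hy)

lemma hasDerivAt_dt (hF : DifferentiableOn ℝ F dom) {t x : ℝ} (ht : 0 < t) (hx : x ∈ I) :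
    HasDerivAt (fun s => F (s, x)) (∂ₜ F (t, x)) t := by
  have h1 := (hF (t, x) (mem_dom ht hx)).hasFDerivWithinAt
  have h2 : HasDerivWithinAt (fun s : ℝ => (s, x)) (1, 0) (Ioi 0) t :=
    (hasDerivWithinAt_id t _).prodMk (hasDerivWithinAt_const t _ x)
  exact (h1.comp_hasDerivWithinAt t h2 (fun s hs => mem_dom hs hx)).hasDerivAt (Ioi_mem_nhds ht)

/-- The restriction of a function on space-time to a time slice. -/
def sl (F : ℝ × ℝ → ℝ) (t : ℝ) : ℝ → ℝ := fun y => F (t, y)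

lemma Smooth2.sl (hF : Smooth2 F) {t : ℝ} (ht : 0 < t) : Smooth (sl F t) :=
  hF.comp (contDiff_const.prodMk contDiff_id).contDiffOn fun _ hy => mem_dom ht hy

lemma dx_eq (hF : Smooth2 F) {t x : ℝ} (ht : 0 < t) (hx : x ∈ I) :
    ∂ₓ F (t, x) = derivWithin (ElasticFlow.sl F t) I x :=
  ((hasDerivWithinAt_dx hF.differentiableOn ht hx).derivWithin (uniqueDiffOn_I x hx)).symm

/-- The arclength derivative on the slices of a function on space-time, with speed `ℓ t` at time `t`. -/
def dSl (ℓ : ℝ → ℝ) (F : ℝ × ℝ → ℝ) (p : ℝ × ℝ) : ℝ := dS (ℓ p.1) (sl F p.1) p.2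

lemma dSl_eq (ℓ : ℝ → ℝ) (hF : Smooth2 F) {p : ℝ × ℝ} (hp : p ∈ dom) :
    dSl ℓ F p = (ℓ p.1)⁻¹ * ∂ₓ F p := by
  rw [dSl, dS, ← dx_eq hF hp.1 hp.2]

lemma Smooth2.dSl {ℓ : ℝ → ℝ} (hℓ : Smooth2 fun p => (ℓ p.1)⁻¹) (hF : Smooth2 F) :
    Smooth2 (dSl ℓ F) :=
  (ContDiffOn.mul hℓ (hF.dd (0, 1))).congr fun _ hp => dSl_eq ℓ hF hp

lemma Smooth2.iter_dSl {ℓ : ℝ → ℝ} (hℓ : Smooth2 fun p => (ℓ p.1)⁻¹) (hF : Smooth2 F) (n : ℕ) :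
    Smooth2 (fun p => (dS (ℓ p.1))^[n] (ElasticFlow.sl F p.1) p.2) := by
  induction n with
  | zero => exact hF
  | succ n ih =>
    refine (Smooth2.dSl hℓ ih).congr fun p _ => ?_
    rw [Function.iterate_succ_apply']
    rfl

lemma dt_iterate_deriv (hF : Smooth2 F) (n : ℕ) {p : ℝ × ℝ} (hp : p ∈ dom) :
    ∂ₜ (fun q => (dS 1)^[n] (sl F q.1) q.2) p = (dS 1)^[n] (sl (∂ₜ F) p.1) p.2 := by
  have h1 : Smooth2 fun _ : ℝ × ℝ => (1 : ℝ)⁻¹ := contDiffOn_const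
  induction n generalizing p with
  | zero => rfl
  | succ n ih =>
    have hn := Smooth2.iter_dSl (ℓ := fun _ => 1) h1 hF n
    have e : EqOn (fun q : ℝ × ℝ => (dS 1)^[n + 1] (sl F q.1) q.2)
        (∂ₓ fun q => (dS 1)^[n] (sl F q.1) q.2) dom := by
      intro q hq
      have := dSl_eq (fun _ => 1) hn hq
      simp only [inv_one, one_mul] at this
      rw [← this]
      simp only [Function.iterate_succ_apply']
      rfl
    rw [dd_congr _ e hp, dd_comm hn hp, Function.iterate_succ_apply' (dS 1) n,
      dx_eq (hn.dd (1, 0)) hp.1 hp.2, dS, inv_one, one_mul]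
    exact derivWithin_congr (fun y hy => ih (mem_dom hp.1 hy)) (ih hp)

/-- Differentiation under the integral sign. -/
lemma hasDerivAt_integral {F' : ℝ × ℝ → ℝ} (hF : ContinuousOn F dom) (hF' : ContinuousOn F' dom)
    (hd : ∀ t, 0 < t → ∀ x ∈ I, HasDerivAt (fun s => F (s, x)) (F' (t, x)) t) {t : ℝ}
    (ht : 0 < t) :
    HasDerivAt (fun s => ∫ x in (0 : ℝ)..1, F (s, x)) (∫ x in (0 : ℝ)..1, F' (t, x)) t := by
  have slice : ∀ {H : ℝ × ℝ → ℝ}, ContinuousOn H dom → ∀ s, 0 < s →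
      ContinuousOn (fun x => H (s, x)) I := fun hH s hs =>
    hH.comp (by fun_prop) fun x hx => mem_dom hs hx
  have hK : IsCompact (Icc (t / 2) (2 * t) ×ˢ I) := isCompact_Icc.prod isCompact_Icc
  have hsub : Icc (t / 2) (2 * t) ×ˢ I ⊆ dom := by
    refine prod_mono (fun s hs => ?_) le_rfl
    have := hs.1
    exact lt_of_lt_of_le (by linarith : 0 < t / 2) this
  obtain ⟨C, hC⟩ := hK.exists_bound_of_continuousOn (hF'.mono hsub)
  have hu : uIoc (0 : ℝ) 1 ⊆ I := by
    rw [uIoc_of_le zero_le_one]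
    exact Ioc_subset_Icc_self
  have hmeas : ∀ {f : ℝ → ℝ}, ContinuousOn f I →
      MeasureTheory.AEStronglyMeasurable f (MeasureTheory.volume.restrict (uIoc (0 : ℝ) 1)) :=
    fun hf => (hf.mono hu).aestronglyMeasurable measurableSet_uIoc
  refine (intervalIntegral.hasDerivAt_integral_of_dominated_loc_of_deriv_le
    (F := fun s x => F (s, x)) (F' := fun s x => F' (s, x)) (bound := fun _ => C)
    (Icc_mem_nhds (by linarith : t / 2 < t) (by linarith : t < 2 * t)) ?_ ?_ ?_ ?_ ?_ ?_).2
  · filter_upwards [Ioi_mem_nhds ht] with s hs using hmeas (slice hF s hs)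
  · exact intervalIntegrable_of_continuousOn (slice hF t ht)
  · exact hmeas (slice hF' t ht)
  · exact Filter.Eventually.of_forall fun x hx s hs => hC (s, x) (mk_mem_prod hs (hu hx))
  · exact intervalIntegrable_const
  · exact Filter.Eventually.of_forall fun x hx s hs =>
      hd s (hsub (mk_mem_prod hs (hu hx))).1 x (hu hx)

end

/-! ### The curvature flow in the constant speed parametrization -/

/-- The evolution of the length `ℓ`, of the curvature `K` and of the tangential velocity `Lam` of a
solution in the constant speed parametrization. Time derivatives are taken at a fixed parameter
`x`; `eq_Lam` says that the parametrization keeps its speed constant in `x`. -/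
structure CurvFlow (ε : ℝ) (ℓ : ℝ → ℝ) (K Lam : ℝ × ℝ → ℝ) : Prop where
  pos : ∀ t, 0 ≤ t → 0 < ℓ t
  ℓ_smooth : Smooth2 fun p => ℓ p.1
  K_smooth : Smooth2 K
  Lam_smooth : Smooth2 Lam
  eq_K : ∀ p ∈ dom, ∂ₜ K p =
    evol ε (ℓ p.1) (sl K p.1) 0 p.2 + Lam p * dS (ℓ p.1) (sl K p.1) p.2
  eq_Lam : ∀ p ∈ dom, dS (ℓ p.1) (sl Lam p.1) p.2 =
    K p * vel ε (ℓ p.1) (sl K p.1) p.2 + (ℓ p.1)⁻¹ * ∂ₜ (fun q => ℓ q.1) p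
  K_zero : ∀ t, 0 ≤ t → K (t, 0) = 0
  K_one : ∀ t, 0 ≤ t → K (t, 1) = 0
  vel_zero : ∀ t, 0 < t → vel ε (ℓ t) (sl K t) 0 = 0
  vel_one : ∀ t, 0 < t → vel ε (ℓ t) (sl K t) 1 = 0
  Lam_zero : ∀ t, 0 < t → Lam (t, 0) = 0
  Lam_one : ∀ t, 0 < t → Lam (t, 1) = 0
  ℓ_cont : ContinuousOn ℓ (Ici 0)
  K_cont : ContinuousOn K (Ici 0 ×ˢ I)

namespace CurvFlow
variable {ε : ℝ} {ℓ : ℝ → ℝ} {K Lam : ℝ × ℝ → ℝ} (h : CurvFlow ε ℓ K Lam)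
include h

lemma inv_smooth : Smooth2 fun p => (ℓ p.1)⁻¹ :=
  ContDiffOn.inv h.ℓ_smooth fun p hp => (h.pos p.1 (le_of_lt hp.1)).ne'

lemma iter_smooth (j : ℕ) : Smooth2 fun p => (dS (ℓ p.1))^[j] (sl K p.1) p.2 :=
  Smooth2.iter_dSl h.inv_smooth h.K_smooth j

lemma vel_smooth : Smooth2 fun p => vel ε (ℓ p.1) (sl K p.1) p.2 := by
  have h2 := h.iter_smooth 2
  have h0 := h.K_smooth
  exact ContDiffOn.add h0 (contDiffOn_const.mul ((contDiffOn_const.mul h2).add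
    (contDiffOn_const.mul ((ContDiffOn.mul h0 h0).mul h0))))

lemma evol_smooth (j : ℕ) : Smooth2 fun p => evol ε (ℓ p.1) (sl K p.1) j p.2 := by
  induction j with
  | zero =>
    exact ContDiffOn.add (Smooth2.iter_dSl h.inv_smooth h.vel_smooth 2)
      ((ContDiffOn.mul h.K_smooth h.K_smooth).mul h.vel_smooth)
  | succ j ih =>
    exact ContDiffOn.add (Smooth2.dSl h.inv_smooth ih)
      ((ContDiffOn.mul h.K_smooth (h.iter_smooth (j + 1))).mul h.vel_smooth)

lemma dt_ℓ {t x : ℝ} (ht : 0 < t) (hx : x ∈ I) :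
    ∂ₜ (fun q => ℓ q.1) (t, x) = ∂ₜ (fun q => ℓ q.1) (t, 0) :=
  (hasDerivAt_dt h.ℓ_smooth.differentiableOn ht hx).unique
    (hasDerivAt_dt h.ℓ_smooth.differentiableOn ht zero_mem_I)

/-- The evolution equation of the derivatives of the curvature, at a fixed value of the parameter
`x`; hence the transport term. -/
lemma dt_iterate (j : ℕ) {p : ℝ × ℝ} (hp : p ∈ dom) :
    ∂ₜ (fun q => (dS (ℓ q.1))^[j] (sl K q.1) q.2) p =
      evol ε (ℓ p.1) (sl K p.1) j p.2 + Lam p * (dS (ℓ p.1))^[j + 1] (sl K p.1) p.2 := by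
  induction j generalizing p with
  | zero => exact h.eq_K p hp
  | succ j ih =>
    have hinv := h.inv_smooth
    have hk := h.iter_smooth j
    have hk1 := h.iter_smooth (j + 1)
    set k : ℝ × ℝ → ℝ := fun q => (dS (ℓ q.1))^[j] (sl K q.1) q.2 with hkdef
    set k1 : ℝ × ℝ → ℝ := fun q => (dS (ℓ q.1))^[j + 1] (sl K q.1) q.2 with hk1def
    set E : ℝ × ℝ → ℝ := fun q => evol ε (ℓ q.1) (sl K q.1) j q.2 with hE
    have hEs : Smooth2 E := h.evol_smooth j
    have hℓ0 : ℓ p.1 ≠ 0 := (h.pos p.1 (le_of_lt hp.1)).ne'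
    have e1 : EqOn k1 (fun q => (ℓ q.1)⁻¹ * ∂ₓ k q) dom := fun q hq => by
      change (dS (ℓ q.1))^[j + 1] (sl K q.1) q.2 = (ℓ q.1)⁻¹ * ∂ₓ k q
      rw [← dSl_eq ℓ hk hq, Function.iterate_succ_apply']
      rfl
    have e2 : EqOn (∂ₜ k) (fun q => E q + Lam q * k1 q) dom := fun q hq => ih hq
    have e3 : ∂ₓ (∂ₜ k) p = ∂ₓ E p + (∂ₓ Lam p * k1 p + Lam p * ∂ₓ k1 p) := by
      rw [dd_congr _ e2 hp, dd_add hEs (ContDiffOn.mul h.Lam_smooth hk1) hp,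
        dd_mul h.Lam_smooth hk1 hp]
    -- the time derivative of `1 / ℓ`
    have e4 : ∂ₜ (fun q => (ℓ q.1)⁻¹) p * ℓ p.1 + (ℓ p.1)⁻¹ * ∂ₜ (fun q => ℓ q.1) p = 0 := by
      rw [← dd_mul hinv h.ℓ_smooth hp, dd_congr _ (G := fun _ => 1) (fun q hq => ?_) hp, dd_const]
      exact inv_mul_cancel₀ (h.pos q.1 (le_of_lt hq.1)).ne'
    have e5 : (ℓ p.1)⁻¹ * ∂ₓ Lam p =
        K p * vel ε (ℓ p.1) (sl K p.1) p.2 + (ℓ p.1)⁻¹ * ∂ₜ (fun q => ℓ q.1) p := by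
      rw [← h.eq_Lam p hp, ← dSl_eq ℓ h.Lam_smooth hp]
      rfl
    have e6 : (ℓ p.1)⁻¹ * ∂ₓ k1 p = (dS (ℓ p.1))^[j + 1 + 1] (sl K p.1) p.2 := by
      rw [← dSl_eq ℓ hk1 hp, Function.iterate_succ_apply' (dS (ℓ p.1)) (j + 1)]
      rfl
    have e7 : (ℓ p.1)⁻¹ * ∂ₓ E p = dS (ℓ p.1) (evol ε (ℓ p.1) (sl K p.1) j) p.2 := by
      rw [← dSl_eq ℓ hEs hp]
      rfl
    have e8 : ∂ₓ k p = ℓ p.1 * k1 p := by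
      rw [e1 hp]
      exact (mul_inv_cancel_left₀ hℓ0 _).symm
    rw [dd_congr _ e1 hp, dd_mul hinv (hk.dd _) hp, dd_comm hk hp, e3]
    simp only [evol, Pi.add_apply, Pi.mul_apply]
    rw [← e6, ← e7, e8, show sl K p.1 p.2 = K p from rfl,
      show (dS (ℓ p.1))^[j + 1] (sl K p.1) p.2 = k1 p from rfl]
    linear_combination k1 p * e4 + k1 p * e5

/-- At positive times the curvature is odd at both end points: the time derivative of `∂ₛ²ⁱ κ = 0` there
gives the vanishing of `∂ₛ²ⁱ⁺⁴ κ`, where `ε ≠ 0` is essential. -/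
lemma oddEnds (hε : ε ≠ 0) {t : ℝ} (ht : 0 < t) : OddEnds (ℓ t) (sl K t) := by
  have main : ∀ e ∈ I, (∀ t, 0 < t → K (t, e) = 0) → (∀ t, 0 < t → Lam (t, e) = 0) →
      (∀ t, 0 < t → vel ε (ℓ t) (sl K t) e = 0) → ∀ i, ∀ t, 0 < t →
      Par (ℓ t) e (2 * i + 3) 0 (sl K t) := by
    intro e he hK hLam hV i
    induction i with
    | zero =>
      intro t ht i hi hev
      have h0 : sl K t e = 0 := hK t ht
      have hi' : i = 0 ∨ i = 2 := by
        obtain ⟨m, hm⟩ := hev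
        omega
      rcases hi' with rfl | rfl
      · exact h0
      · have := hV t ht
        simp only [vel, velCorr, Pi.add_apply, Pi.smul_apply, smul_eq_mul, Pi.mul_apply, h0] at this
        simpa [hε] using this
    | succ i ih =>
      intro t ht m hm hev
      by_cases hm' : m ≤ 2 * i + 3
      · exact ih t ht m hm' hev
      have : m = 2 * i + 4 := by
        obtain ⟨r, hr⟩ := hev
        omega
      subst this
      refine iterate_eq_zero_of_evol_eq_zero hε he (h.K_smooth.sl ht) i (ih t ht) ?_
      have h1 := h.dt_iterate (2 * i) (mem_dom ht he)
      have h2 := hasDerivAt_dt (h.iter_smooth (2 * i)).differentiableOn ht he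
      have h3 : HasDerivAt (fun s => (dS (ℓ s))^[2 * i] (sl K s) e) 0 t := by
        refine (hasDerivAt_const t (0 : ℝ)).congr_of_eventuallyEq ?_
        filter_upwards [Ioi_mem_nhds ht] with s hs
        exact ih s hs (2 * i) (by omega) ⟨i, by ring⟩
      have h4 := h2.unique h3
      rw [h1, hLam t ht] at h4
      linarith
  intro i
  exact ⟨main 0 zero_mem_I (fun t ht => h.K_zero t ht.le) h.Lam_zero h.vel_zero i t ht (2 * i)
      (by omega) ⟨i, by ring⟩,
    main 1 one_mem_I (fun t ht => h.K_one t ht.le) h.Lam_one h.vel_one i t ht (2 * i)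
      (by omega) ⟨i, by ring⟩⟩

/-- The rate of change of `∫ (∂ₛʲ κ)² ds`. The tangential velocity drops out, as it vanishes at the
end points. -/
lemma hasDerivAt_energy (j : ℕ) {t : ℝ} (ht : 0 < t) :
    HasDerivAt (fun s => nrm (ℓ s) ((dS (ℓ s))^[j] (sl K s)) ^ 2)
      (energyRate ε (ℓ t) (sl K t) j) t := by
  have hk := h.iter_smooth j
  have hℓ := h.pos t ht.le
  have hu := h.K_smooth.sl ht
  have hkt := hu.iter (ℓ t) j
  have hV := hu.vel (ε := ε) (ℓ := ℓ t)
  have hL := h.Lam_smooth.sl ht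
  have hE := hu.evol (ε := ε) (ℓ := ℓ t) j
  set ℓ' := ∂ₜ (fun q => ℓ q.1) (t, 0) with hℓ'
  have h1 : HasDerivAt ℓ ℓ' t := hasDerivAt_dt h.ℓ_smooth.differentiableOn ht zero_mem_I
  have h2 := hasDerivAt_integral (F := fun q => (dS (ℓ q.1))^[j] (sl K q.1) q.2 ^ 2)
    (F' := fun q => 2 * (dS (ℓ q.1))^[j] (sl K q.1) q.2 *
      ∂ₜ (fun q => (dS (ℓ q.1))^[j] (sl K q.1) q.2) q)
    (hk.continuousOn.pow 2) ((continuousOn_const.mul hk.continuousOn).mul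
      (hk.dd (1, 0)).continuousOn)
    (fun t ht x hx => ((hasDerivAt_dt hk.differentiableOn ht hx).pow 2).congr_deriv (by
      push_cast
      ring)) ht
  have h3 := h1.mul h2
  refine (h3.congr_of_eventuallyEq ?_).congr_deriv ?_
  · filter_upwards [Ioi_mem_nhds ht] with s hs
    exact nrm_sq (h.pos s (le_of_lt hs)).le _
  set k := (dS (ℓ t))^[j] (sl K t) with hkdef
  have e1 : ∫ x in (0 : ℝ)..1, 2 * (dS (ℓ t))^[j] (sl K t) x *
      ∂ₜ (fun q => (dS (ℓ q.1))^[j] (sl K q.1) q.2) (t, x) =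
      ∫ x in (0 : ℝ)..1, (2 * (k x * evol ε (ℓ t) (sl K t) j x) +
        sl Lam t x * dS (ℓ t) (k * k) x) := by
    refine integral_congr_I fun x hx => ?_
    rw [h.dt_iterate j (mem_dom ht hx),
      dS_mul (ℓ t) hkt.differentiableOn hkt.differentiableOn hx]
    simp only [Pi.add_apply, Pi.mul_apply, Function.iterate_succ_apply', ← hkdef, sl]
    ring
  have i1 : IntervalIntegrable (fun x => 2 * (k x * evol ε (ℓ t) (sl K t) j x))
      MeasureTheory.volume 0 1 :=
    intervalIntegrable_of_continuousOn
      (continuousOn_const.mul (hkt.continuousOn.mul hE.continuousOn))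
  have i2 : IntervalIntegrable (fun x => sl Lam t x * dS (ℓ t) (k * k) x)
      MeasureTheory.volume 0 1 :=
    intervalIntegrable_of_continuousOn
      (hL.continuousOn.mul ((hkt.mul' hkt).dS (ℓ t)).continuousOn)
  have e2 : ∫ x in (0 : ℝ)..1, sl Lam t x * dS (ℓ t) (k * k) x =
      -∫ x in (0 : ℝ)..1, (k x * (sl K t * k * vel ε (ℓ t) (sl K t)) x +
        (ℓ t)⁻¹ * ℓ' * k x ^ 2) := by
    rw [integral_mul_dS hℓ.ne' hL.one (hkt.mul' hkt).one
      (by rw [show sl Lam t 0 = 0 from h.Lam_zero t ht, zero_mul])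
      (by rw [show sl Lam t 1 = 0 from h.Lam_one t ht, zero_mul])]
    refine congrArg _ (integral_congr_I fun x hx => ?_)
    have := h.eq_Lam (t, x) (mem_dom ht hx)
    simp only at this
    simp only [Pi.mul_apply]
    rw [this, h.dt_ℓ ht hx]
    simp only [sl]
    ring
  have i3 : IntervalIntegrable (fun x => k x * (sl K t * k * vel ε (ℓ t) (sl K t)) x)
      MeasureTheory.volume 0 1 :=
    intervalIntegrable_of_continuousOn
      (hkt.continuousOn.mul ((hu.mul' hkt).mul' hV).continuousOn)
  have i4 : IntervalIntegrable (fun x => (ℓ t)⁻¹ * ℓ' * k x ^ 2) MeasureTheory.volume 0 1 :=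
    intervalIntegrable_of_continuousOn (continuousOn_const.mul (hkt.continuousOn.pow 2))
  rw [e1, intervalIntegral.integral_add i1 i2, e2, intervalIntegral.integral_add i3 i4,
    intervalIntegral.integral_const_mul, intervalIntegral.integral_const_mul, energyRate, ip, ip,
    ← hkdef]
  have : ℓ t * (ℓ t)⁻¹ = 1 := mul_inv_cancel₀ hℓ.ne'
  linear_combination (-(ℓ' * ∫ x in (0 : ℝ)..1, k x ^ 2)) * this

end CurvFlow

open Filter Topology

/-! ### Bounds along a flow -/

lemma continuousOn_integral {F : ℝ × ℝ → ℝ} (hF : ContinuousOn F (Ici 0 ×ˢ I)) :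
    ContinuousOn (fun t => ∫ x in (0 : ℝ)..1, F (t, x)) (Ici 0) := by
  -- extend by a retraction onto the domain
  set r : ℝ × ℝ → ℝ × ℝ := fun p => (max p.1 0, (projIcc 0 1 zero_le_one p.2 : ℝ)) with hr
  have hrc : Continuous r :=
    (continuous_fst.max continuous_const).prodMk
      (continuous_subtype_val.comp (continuous_projIcc.comp continuous_snd))
  have hc : Continuous (fun p => F (r p)) :=
    hF.comp_continuous hrc fun p => ⟨le_max_right p.1 0, (projIcc 0 1 zero_le_one p.2).2⟩
  have h2 := intervalIntegral.continuous_parametric_intervalIntegral_of_continuous'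
    (μ := MeasureTheory.volume) (f := fun t x => F (r (t, x))) hc 0 1
  refine h2.continuousOn.congr fun t ht => integral_congr_I fun x hx => ?_
  simp only [hr, max_eq_left (mem_Ici.1 ht), projIcc_of_mem zero_le_one hx]

namespace CurvFlow
variable {ε : ℝ} {ℓ : ℝ → ℝ} {K Lam : ℝ × ℝ → ℝ} (h : CurvFlow ε ℓ K Lam)
include h

/-- A bound for `∫ κ² ds` on a time interval that depends only on its initial value. -/
lemma nrm_sq_le (hε : 0 < ε) {a t : ℝ} (ha : nrm (ℓ 0) (sl K 0) ^ 2 + 1 ≤ a) (ht : 0 ≤ t)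
    (ht' : t ≤ (9 * a ^ 2)⁻¹) : nrm (ℓ t) (sl K t) ^ 2 ≤ 2 * a := by
  have ha0 : 0 < a := by linarith [sq_nonneg (nrm (ℓ 0) (sl K 0))]
  set T := (9 * a ^ 2)⁻¹ with hT
  have hTpos : 0 < T := by positivity
  have hTa : 9 * a ^ 3 * T = a := by
    rw [hT]
    field_simp
  have hcont : ContinuousOn (fun t => nrm (ℓ t) (sl K t) ^ 2) (Icc 0 T) := by
    have h1 := (h.ℓ_cont.mul (continuousOn_integral (h.K_cont.pow 2))).mono
      (Icc_subset_Ici_self : Icc 0 T ⊆ Ici (0 : ℝ))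
    exact h1.congr fun s hs => nrm_sq (h.pos s hs.1).le _
  have hA0 : nrm (ℓ 0) (sl K 0) ^ 2 < a := by linarith
  -- the comparison starts at a positive time, where the flow is smooth
  have hev : ∀ᶠ s in 𝓝[>] (0 : ℝ), nrm (ℓ s) (sl K s) ^ 2 < a := by
    have h0 := (hcont 0 ⟨le_rfl, hTpos.le⟩).mono_left
      (nhdsWithin_mono 0 (Ioc_subset_Icc_self (a := (0 : ℝ)) (b := T)))
    rw [nhdsWithin_Ioc_eq_nhdsGT hTpos] at h0
    exact h0.eventually (Iio_mem_nhds hA0)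
  rcases ht.eq_or_lt with rfl | htpos
  · linarith
  obtain ⟨s, ⟨hsA, hs0⟩, hst⟩ :=
    ((hev.and self_mem_nhdsWithin).and (Ioo_mem_nhdsGT htpos)).exists
  have hs0' : 0 < s := hs0
  -- the barrier `a + 9 a³ (r - s)` stays below `2 a`, and its slope exceeds `(2 a)³`
  have key := image_le_of_deriv_right_lt_deriv_boundary' (a := s) (b := t)
    (f := fun r => nrm (ℓ r) (sl K r) ^ 2) (f' := fun r => energyRate ε (ℓ r) (sl K r) 0)
    (B := fun r => a + 9 * a ^ 3 * (r - s)) (B' := fun _ => 9 * a ^ 3)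
    (hcont.mono (Icc_subset_Icc hs0'.le ht'))
    (fun r hr => (h.hasDerivAt_energy 0 (hs0'.trans_le hr.1)).hasDerivWithinAt)
    (by simpa using hsA.le) (by fun_prop)
    (fun r _ => by
      have := (((hasDerivAt_id r).sub_const s).const_mul (9 * a ^ 3)).const_add a
      simpa using this.hasDerivWithinAt)
    (fun r hr hBr => by
      have hr0 := hs0'.trans_le hr.1
      refine (energyRate_zero_le hε.le (h.pos r hr0.le) (h.K_smooth.sl hr0)
        (h.oddEnds hε.ne' hr0)).trans_lt ?_
      rw [hBr]
      have h1 : a + 9 * a ^ 3 * (r - s) ≤ 2 * a := by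
        have : 9 * a ^ 3 * (r - s) ≤ 9 * a ^ 3 * T := by
          refine mul_le_mul_of_nonneg_left ?_ (by positivity)
          linarith [hr.2]
        linarith
      have h0 : 0 ≤ a + 9 * a ^ 3 * (r - s) := by
        have : 0 ≤ 9 * a ^ 3 * (r - s) := mul_nonneg (by positivity) (by linarith [hr.1])
        linarith
      have h2 := pow_le_pow_left₀ h0 h1 3
      have h3 : 0 < a ^ 3 := by positivity
      nlinarith)
    (right_mem_Icc.2 hst.2.le)
  refine key.trans ?_
  have : 9 * a ^ 3 * (t - s) ≤ 9 * a ^ 3 * T :=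
    mul_le_mul_of_nonneg_left (by linarith) (by positivity)
  linarith

variable {C M T : ℝ} {j : ℕ}

/-- The growth of an energy whose rate of change is bounded above. -/
lemma energy_sub_le {s t c : ℝ} (hs : 0 < s) (hst : s ≤ t)
    (hc : ∀ r ∈ Icc s t, energyRate ε (ℓ r) (sl K r) j ≤ c) :
    nrm (ℓ t) ((dS (ℓ t))^[j] (sl K t)) ^ 2 ≤
      nrm (ℓ s) ((dS (ℓ s))^[j] (sl K s)) ^ 2 + c * (t - s) := by
  have hd : ∀ r ∈ Icc s t, HasDerivAt (fun s => nrm (ℓ s) ((dS (ℓ s))^[j] (sl K s)) ^ 2)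
      (energyRate ε (ℓ r) (sl K r) j) r := fun r hr => h.hasDerivAt_energy j (hs.trans_le hr.1)
  have := (convex_Icc s t).image_sub_le_mul_sub_of_deriv_le
    (f := fun s => nrm (ℓ s) ((dS (ℓ s))^[j] (sl K s)) ^ 2) (C := c)
    (fun r hr => (hd r hr).continuousAt.continuousWithinAt)
    (fun r hr => (hd r (interior_subset hr)).differentiableAt.differentiableWithinAt)
    (fun r hr => by
      rw [(hd r (interior_subset hr)).deriv]
      exact hc r (interior_subset hr))
    s (left_mem_Icc.2 hst) t (right_mem_Icc.2 hst) hst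
  linarith

end CurvFlow

/-- A flow with parameter `ε ∈ (0, 1]` and the bound `M` for `‖κ‖` on the time interval `(0, T]`. -/
structure BddFlow (M T ε : ℝ) (ℓ : ℝ → ℝ) (K Lam : ℝ × ℝ → ℝ) : Prop
    extends CurvFlow ε ℓ K Lam where
  ε_pos : 0 < ε
  ε_le : ε ≤ 1
  bound : ∀ t, 0 < t → t ≤ T → nrm (ℓ t) (sl K t) ≤ M

section
variable {M T : ℝ}

/-- The differential inequality for the energies, uniformly over all flows. -/
lemma exists_rate_le (hM : 1 ≤ M) (T : ℝ) (j : ℕ) : ∃ C : ℝ, 0 ≤ C ∧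
    ∀ (ε : ℝ) (ℓ : ℝ → ℝ) (K Lam : ℝ × ℝ → ℝ), BddFlow M T ε ℓ K Lam → ∀ t, 0 < t → t ≤ T →
    energyRate ε (ℓ t) (sl K t) j ≤ -nrm (ℓ t) ((dS (ℓ t))^[j + 1] (sl K t)) ^ 2 + C := by
  obtain ⟨C, hC, h⟩ := exists_energyRate_le hM j
  exact ⟨C, hC, fun ε ℓ K Lam hf t ht hT => h ε (ℓ t) (sl K t) hf.ε_pos hf.ε_le (hf.pos t ht.le)
    (hf.K_smooth.sl ht) (hf.oddEnds hf.ε_pos.ne' ht) (hf.bound t ht hT)⟩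

/-- Interior estimates: on `[δ, T]` all energies are bounded, uniformly over all flows. -/
lemma exists_bound_of_pos (hM : 1 ≤ M) (T : ℝ) (j : ℕ) : ∀ δ : ℝ, 0 < δ → ∃ B : ℝ,
    ∀ (ε : ℝ) (ℓ : ℝ → ℝ) (K Lam : ℝ × ℝ → ℝ), BddFlow M T ε ℓ K Lam → ∀ t ∈ Icc δ T,
    nrm (ℓ t) ((dS (ℓ t))^[j] (sl K t)) ^ 2 ≤ B := by
  induction j with
  | zero =>
    intro δ hδ
    exact ⟨M ^ 2, fun ε ℓ K Lam hf t ht =>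
      pow_le_pow_left₀ (nrm_nonneg _ _) (hf.bound t (hδ.trans_le ht.1) ht.2) 2⟩
  | succ j ih =>
    intro δ hδ
    obtain ⟨B, hB⟩ := ih (δ / 2) (by linarith)
    obtain ⟨C, hC, hCj⟩ := exists_rate_le hM T j
    obtain ⟨D, hD, hDj⟩ := exists_rate_le hM T (j + 1)
    refine ⟨2 * B / δ + C + 1 + D * T, fun ε ℓ K Lam hf t ht => ?_⟩
    have hδT : δ ≤ T := ht.1.trans ht.2
    -- a large energy of order `j + 1` throughout `[δ / 2, δ]` would make the one of order `j` negative
    obtain ⟨r, hr, hrB⟩ : ∃ r ∈ Icc (δ / 2) δ,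
        nrm (ℓ r) ((dS (ℓ r))^[j + 1] (sl K r)) ^ 2 ≤ 2 * B / δ + C + 1 := by
      by_contra! hcon
      have h1 := hf.energy_sub_le (j := j) (s := δ / 2) (t := δ) (c := -(2 * B / δ) - 1)
        (by linarith) (by linarith) (fun r hr => by
          have h1 := hCj ε ℓ K Lam hf r (by linarith [hr.1]) (hr.2.trans hδT)
          have h2 := hcon r hr
          linarith)
      have h2 := hB ε ℓ K Lam hf (δ / 2) ⟨le_rfl, by linarith⟩
      have h3 : 2 * B / δ * δ = 2 * B := div_mul_cancel₀ _ hδ.ne'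
      nlinarith [sq_nonneg (nrm (ℓ δ) ((dS (ℓ δ))^[j] (sl K δ)))]
    have hr0 : 0 < r := by linarith [hr.1]
    have h1 := hf.energy_sub_le (j := j + 1) (s := r) (t := t) (c := D) hr0 (hr.2.trans ht.1)
      (fun q hq => by
        have h1 := hDj ε ℓ K Lam hf q (hr0.trans_le hq.1) (hq.2.trans ht.2)
        nlinarith [sq_nonneg (nrm (ℓ q) ((dS (ℓ q))^[j + 1 + 1] (sl K q)))])
    have h2 : D * (t - r) ≤ D * T := mul_le_mul_of_nonneg_left (by linarith [ht.2]) hD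
    linarith

end

/-! ### The initial time -/

lemma dS_eq_smul (ℓ : ℝ) (f : ℝ → ℝ) : dS ℓ f = ℓ⁻¹ • dS 1 f := by
  funext x
  simp [dS]

lemma dS_iterate_eq_smul (ℓ : ℝ) (n : ℕ) (f : ℝ → ℝ) :
    (dS ℓ)^[n] f = (ℓ⁻¹ ^ n) • (dS 1)^[n] f := by
  induction n with
  | zero => simp
  | succ n ih =>
    rw [Function.iterate_succ_apply', ih, dS_smul, dS_eq_smul, Function.iterate_succ_apply',
      smul_smul, pow_succ]

lemma ip_iterate_eq (ℓ : ℝ) (n : ℕ) (f g : ℝ → ℝ) : ip ℓ ((dS ℓ)^[n] f) ((dS ℓ)^[n] g) =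
    ℓ * (ℓ⁻¹ ^ n) ^ 2 * ip 1 ((dS 1)^[n] f) ((dS 1)^[n] g) := by
  have e : ∀ a b : ℝ → ℝ, ip ℓ a b = ℓ * ip 1 a b := fun a b => by simp [ip]
  rw [dS_iterate_eq_smul ℓ n f, dS_iterate_eq_smul ℓ n g, e, ip_smul_right, ip_comm,
    ip_smul_right, ip_comm]
  ring

lemma nrm_iterate_sq_eq {ℓ : ℝ} (hℓ : 0 ≤ ℓ) (n : ℕ) (f : ℝ → ℝ) :
    nrm ℓ ((dS ℓ)^[n] f) ^ 2 = ℓ * (ℓ⁻¹ ^ n) ^ 2 * nrm 1 ((dS 1)^[n] f) ^ 2 := by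
  rw [← ip_self hℓ, ip_iterate_eq, ip_self zero_le_one]

namespace CurvFlow
variable {ε : ℝ} {ℓ : ℝ → ℝ} {K Lam : ℝ × ℝ → ℝ} (h : CurvFlow ε ℓ K Lam)
include h

lemma tendsto_ℓ : Tendsto ℓ (𝓝[>] 0) (𝓝 (ℓ 0)) :=
  (h.ℓ_cont 0 self_mem_Ici).mono_left (nhdsWithin_mono 0 Ioi_subset_Ici_self)

lemma tendsto_factor (n : ℕ) :
    Tendsto (fun t => ℓ t * ((ℓ t)⁻¹ ^ n) ^ 2) (𝓝[>] 0) (𝓝 (ℓ 0 * ((ℓ 0)⁻¹ ^ n) ^ 2)) :=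
  h.tendsto_ℓ.mul (((h.tendsto_ℓ.inv₀ (h.pos 0 le_rfl).ne').pow n).pow 2)

lemma factor_pos {t : ℝ} (ht : 0 ≤ t) (n : ℕ) : 0 < ℓ t * ((ℓ t)⁻¹ ^ n) ^ 2 := by
  have := h.pos t ht
  positivity

lemma tendsto_nrm_initial (n : ℕ) (φ : ℝ → ℝ) :
    Tendsto (fun t => nrm (ℓ t) ((dS (ℓ t))^[n] φ) ^ 2) (𝓝[>] 0)
      (𝓝 (nrm (ℓ 0) ((dS (ℓ 0))^[n] φ) ^ 2)) := by
  rw [nrm_iterate_sq_eq (h.pos 0 le_rfl).le]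
  refine ((h.tendsto_factor n).mul_const _).congr' ?_
  filter_upwards [self_mem_nhdsWithin] with t ht
  rw [nrm_iterate_sq_eq (h.pos t (le_of_lt ht)).le]

/-- The deviation from the initial curvature. -/
lemma hasDerivAt_deviation {j : ℕ} (hφ : ContDiffOn ℝ j (sl K 0) I) {t : ℝ} (ht : 0 < t) :
    HasDerivAt (fun s => nrm 1 ((dS 1)^[j] (sl K s + (-1 : ℝ) • sl K 0)) ^ 2)
      (2 * ip 1 ((dS 1)^[j] (sl K t + (-1 : ℝ) • sl K 0))
        ((dS 1)^[j] (evol ε (ℓ t) (sl K t) 0 + sl Lam t * dS (ℓ t) (sl K t)))) t := by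
  have hU := Smooth2.iter_dSl (ℓ := fun _ => 1) contDiffOn_const h.K_smooth j
  set U : ℝ × ℝ → ℝ := fun p => (dS 1)^[j] (sl K p.1) p.2 with hUdef
  set φ := (dS 1)^[j] (sl K 0) with hφdef
  have cφ : ContinuousOn φ I := (contDiffOn_iterate_dS 1 j 0 (by simpa using hφ)).continuousOn
  have cφ2 : ContinuousOn (fun p : ℝ × ℝ => φ p.2) dom :=
    cφ.comp continuousOn_snd fun p hp => hp.2
  have hφ' : ContDiffOn ℝ j ((-1 : ℝ) • sl K 0) I := contDiffOn_const.smul hφ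
  have hdev : ∀ s, 0 < s →
      EqOn ((dS 1)^[j] (sl K s + (-1 : ℝ) • sl K 0)) (fun x => U (s, x) - φ x) I := by
    intro s hs x hx
    rw [dS_iterate_add_of_contDiffOn 1 j ((h.K_smooth.sl hs).contDiffOn j)
      hφ' hx, Pi.add_apply, dS_iterate_smul]
    simp only [Pi.smul_apply, smul_eq_mul, hUdef, hφdef]
    ring
  have h2 := hasDerivAt_integral (F := fun p => (U p - φ p.2) ^ 2)
    (F' := fun p => 2 * (U p - φ p.2) * ∂ₜ U p)
    ((hU.continuousOn.sub cφ2).pow 2)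
    ((continuousOn_const.mul (hU.continuousOn.sub cφ2)).mul (hU.dd (1, 0)).continuousOn)
    (fun t ht x hx => (((hasDerivAt_dt hU.differentiableOn ht hx).sub_const (φ x)).pow
      2).congr_deriv (by
      push_cast
      ring)) ht
  refine (h2.congr_of_eventuallyEq ?_).congr_deriv ?_
  · filter_upwards [Ioi_mem_nhds ht] with s hs
    rw [nrm_sq zero_le_one, one_mul]
    exact integral_congr_I fun x hx => by simp only [hdev s hs hx]
  · rw [ip, one_mul, ← intervalIntegral.integral_const_mul]
    refine integral_congr_I fun x hx => ?_
    have e1 := dt_iterate_deriv h.K_smooth j (mem_dom ht hx)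
    have e2 : EqOn (sl (∂ₜ K) t) (evol ε (ℓ t) (sl K t) 0 + sl Lam t * dS (ℓ t) (sl K t)) I :=
      fun y hy => h.eq_K (t, y) (mem_dom ht hy)
    simp only [hdev t ht hx]
    rw [e1, dS_iterate_congr 1 j e2 hx]
    ring

/-- The data of the flow at a positive time. -/
def drift {M T L₁ : ℝ} (hf : BddFlow M T ε ℓ K Lam) {t : ℝ} (ht : 0 < t) (hT : t ≤ T)
    (hL : L₁ ≤ ℓ t) : DriftCurv M L₁ where
  ℓ := ℓ t
  u := sl K t
  pos := h.pos t ht.le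
  smooth := h.K_smooth.sl ht
  odd := h.oddEnds hf.ε_pos.ne' ht
  bound := hf.bound t ht hT
  ε := ε
  lam := sl Lam t
  μ := (ℓ t)⁻¹ * ∂ₜ (fun q => ℓ q.1) (t, 0)
  ε_pos := hf.ε_pos
  ε_le := hf.ε_le
  le_ℓ := hL
  lam_smooth := h.Lam_smooth.sl ht
  dS_lam := fun x hx => by
    have := h.eq_Lam (t, x) (mem_dom ht hx)
    simp only [h.dt_ℓ ht hx] at this
    exact this
  lam_zero := h.Lam_zero t ht
  lam_one := h.Lam_one t ht

end CurvFlow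

namespace BddFlow
variable {M T ε : ℝ} {ℓ : ℝ → ℝ} {K Lam : ℝ × ℝ → ℝ} (hf : BddFlow M T ε ℓ K Lam)
include hf

/-- If `∂ₛʲ κ` converges in `L²` to its initial value, then the energy of order `j + 2` is bounded,
along a sequence of times that tends to zero, in terms of its initial value. Otherwise the distance
of `∂ₛʲ κ` from the initial value would decrease strictly from zero. -/
lemma exists_energy_le (hM : 1 ≤ M) (hT : 0 < T) {j : ℕ}
    (hφ : ContDiffOn ℝ (j + 2 : ℕ) (sl K 0) I)
    (hφ0 : ∀ i ≤ j + 1, Even i → (dS 1)^[i] (sl K 0) 0 = 0 ∧ (dS 1)^[i] (sl K 0) 1 = 0)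
    (hlim : Tendsto (fun t => nrm 1 ((dS 1)^[j] (sl K t + (-1 : ℝ) • sl K 0)) ^ 2)
      (𝓝[>] 0) (𝓝 0)) {t₀ : ℝ} (ht₀ : 0 < t₀) :
    ∃ t, 0 < t ∧ t < t₀ ∧ nrm (ℓ t) ((dS (ℓ t))^[j + 2] (sl K t)) ^ 2 ≤
      2 * nrm (ℓ 0) ((dS (ℓ 0))^[j + 2] (sl K 0)) ^ 2 + 2 := by
  have h := hf.toCurvFlow
  have hL0 := h.pos 0 le_rfl
  set F₀ := nrm (ℓ 0) ((dS (ℓ 0))^[j + 2] (sl K 0)) ^ 2 with hF₀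
  obtain ⟨C, hC, hrate⟩ := exists_comparison_rate_le hM (half_pos hL0) j
  by_contra! hcon
  set Ψ : ℝ → ℝ := fun t => nrm 1 ((dS 1)^[j] (sl K t + (-1 : ℝ) • sl K 0)) ^ 2 with hΨ
  have hlim2 : Tendsto (fun t => C * nrm (ℓ t) ((dS (ℓ t))^[j] (sl K t + (-1 : ℝ) • sl K 0)))
      (𝓝[>] 0) (𝓝 0) := by
    have h1 := ((h.tendsto_factor j).mul hlim).sqrt.const_mul C
    rw [mul_zero, Real.sqrt_zero, mul_zero] at h1
    refine h1.congr' ?_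
    filter_upwards [self_mem_nhdsWithin] with t ht
    rw [← nrm_iterate_sq_eq (h.pos t (le_of_lt ht)).le, Real.sqrt_sq (nrm_nonneg _ _)]
  have ev : ∀ᶠ t in 𝓝[>] (0 : ℝ), (ℓ 0 / 2 ≤ ℓ t ∧
      nrm (ℓ t) ((dS (ℓ t))^[j + 2] (sl K 0)) ^ 2 < F₀ + 1 / 2) ∧
      (C * nrm (ℓ t) ((dS (ℓ t))^[j] (sl K t + (-1 : ℝ) • sl K 0)) < ε ∧ t < min t₀ T) := by
    refine (Eventually.and ?_ ?_).and (Eventually.and ?_ ?_)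
    · exact (h.tendsto_ℓ.eventually (Ioi_mem_nhds (half_lt_self hL0))).mono fun t ht => le_of_lt ht
    · exact (h.tendsto_nrm_initial (j + 2) (sl K 0)).eventually (Iio_mem_nhds (by linarith))
    · exact hlim2.eventually (Iio_mem_nhds hf.ε_pos)
    · exact mem_of_superset (Ioo_mem_nhdsGT (lt_min ht₀ hT)) fun t ht => ht.2
  obtain ⟨t₁, ht₁, hsub⟩ := mem_nhdsGT_iff_exists_Ioo_subset.1 ev
  have ht₁ : 0 < t₁ := ht₁
  have hd : ∀ t ∈ Ioo 0 t₁, ∃ d, d < 0 ∧ HasDerivAt Ψ d t := by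
    intro t ht
    obtain ⟨⟨hL, hF⟩, hη, htm⟩ := hsub ht
    refine ⟨_, ?_, h.hasDerivAt_deviation (hφ.of_le (by exact_mod_cast (by omega))) ht.1⟩
    have hfac := h.factor_pos ht.1.le j
    have hr := hrate (h.drift hf ht.1 (htm.le.trans (min_le_right _ _)) hL) (sl K 0) hφ (by
      intro i hi he
      rw [dS_iterate_eq_smul]
      simp only [Pi.smul_apply, hφ0 i hi he, smul_zero, and_self])
    simp only [CurvFlow.drift] at hr
    rw [ip_iterate_eq, mul_left_comm] at hr
    have hB := hcon t ht.1 (htm.trans_le (min_le_left _ _))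
    set B := nrm (ℓ t) ((dS (ℓ t))^[j + 2] (sl K t)) ^ 2
    set F := nrm (ℓ t) ((dS (ℓ t))^[j + 2] (sl K 0)) ^ 2
    set η := C * nrm (ℓ t) ((dS (ℓ t))^[j] (sl K t + (-1 : ℝ) • sl K 0))
    have hB0 : 0 ≤ B := sq_nonneg _
    have hneg : -(2 * ε) * (B - F) + η * (1 + B) < 0 := by
      have h1 : (1 + B) / 2 ≤ B - F := by linarith
      have h2 := mul_le_mul_of_nonneg_left h1 (show 0 ≤ 2 * ε by linarith [hf.ε_pos])
      have h3 : η * (1 + B) < ε * (1 + B) := mul_lt_mul_of_pos_right hη (by linarith)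
      linarith
    exact neg_of_mul_neg_right (hr.trans_lt hneg) hfac.le
  have hanti : StrictAntiOn Ψ (Ioo 0 t₁) := by
    refine strictAntiOn_of_deriv_neg (convex_Ioo 0 t₁) (fun t ht => ?_) (fun t ht => ?_)
    · obtain ⟨d, -, hd⟩ := hd t ht
      exact hd.continuousAt.continuousWithinAt
    · rw [interior_Ioo] at ht
      obtain ⟨d, hneg, hd⟩ := hd t ht
      rwa [hd.deriv]
  have h1 : Ψ (t₁ / 2) < Ψ (t₁ / 4) :=
    hanti ⟨by linarith, by linarith⟩ ⟨by linarith, by linarith⟩ (by linarith)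
  have h2 : Ψ (t₁ / 4) ≤ 0 := by
    refine ge_of_tendsto hlim ?_
    filter_upwards [Ioo_mem_nhdsGT (show 0 < t₁ / 4 by linarith)] with t ht
    exact (hanti ⟨ht.1, by linarith [ht.2]⟩ ⟨by linarith, by linarith⟩ ht.2).le
  have h3 : 0 ≤ Ψ (t₁ / 2) := sq_nonneg _
  linarith

/-- A bound for the energy of order `j + 2` passes the `L²` convergence from order `j` to `j + 1`. -/
lemma tendsto_deviation_succ (hT : 0 < T) {j : ℕ} {B : ℝ}
    (hφ : ContDiffOn ℝ (j + 2 : ℕ) (sl K 0) I)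
    (hφ0 : ∀ i ≤ j + 1, Even i → (dS 1)^[i] (sl K 0) 0 = 0 ∧ (dS 1)^[i] (sl K 0) 1 = 0)
    (hlim : Tendsto (fun t => nrm 1 ((dS 1)^[j] (sl K t + (-1 : ℝ) • sl K 0)) ^ 2)
      (𝓝[>] 0) (𝓝 0))
    (hB : ∀ t, 0 < t → t ≤ T → nrm (ℓ t) ((dS (ℓ t))^[j + 2] (sl K t)) ^ 2 ≤ B) :
    Tendsto (fun t => nrm 1 ((dS 1)^[j + 1] (sl K t + (-1 : ℝ) • sl K 0)) ^ 2)
      (𝓝[>] 0) (𝓝 0) := by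
  have h := hf.toCurvFlow
  -- interpolation: `‖w⁽ʲ⁺¹⁾‖² ≤ ‖w⁽ʲ⁾‖ ‖w⁽ʲ⁺²⁾‖` for the deviation `w`
  have key : ∀ t, 0 < t → t ≤ T →
      nrm 1 ((dS 1)^[j + 1] (sl K t + (-1 : ℝ) • sl K 0)) ^ 2 ≤
      √(nrm 1 ((dS 1)^[j] (sl K t + (-1 : ℝ) • sl K 0)) ^ 2) *
        (√((ℓ t * ((ℓ t)⁻¹ ^ (j + 2)) ^ 2)⁻¹ * B) + nrm 1 ((dS 1)^[j + 2] (sl K 0))) := by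
    intro t ht htT
    have hu := h.K_smooth.sl ht
    have hodd := h.oddEnds hf.ε_pos.ne' ht
    have hw : ContDiffOn ℝ (j + 2 : ℕ) (sl K t + (-1 : ℝ) • sl K 0) I :=
      (hu.contDiffOn _).add (contDiffOn_const.smul hφ)
    have hiter : ∀ i ≤ j + 2, EqOn ((dS 1)^[i] (sl K t + (-1 : ℝ) • sl K 0))
        ((dS 1)^[i] (sl K t) + (-1 : ℝ) • (dS 1)^[i] (sl K 0)) I := fun i hi => by
      rw [← dS_iterate_smul]
      have hi' : (i : WithTop ℕ∞) ≤ ((j + 2 : ℕ) : WithTop ℕ∞) := by exact_mod_cast hi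
      exact dS_iterate_add_of_contDiffOn _ i (hu.contDiffOn i)
        (contDiffOn_const.smul (hφ.of_le hi'))
    have hodd1 : ∀ m, (dS 1)^[2 * m] (sl K t) 0 = 0 ∧ (dS 1)^[2 * m] (sl K t) 1 = 0 := by
      intro m
      have h1 := hodd m
      rw [dS_iterate_eq_smul] at h1
      have h2 : (ℓ t)⁻¹ ^ (2 * m) ≠ 0 := pow_ne_zero _ (inv_ne_zero (h.pos t ht.le).ne')
      simpa only [Pi.smul_apply, smul_eq_mul, mul_eq_zero, h2, false_or] using h1
    have hw0 : ∀ i ≤ j + 1, Even i → (dS 1)^[i] (sl K t + (-1 : ℝ) • sl K 0) 0 = 0 ∧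
        (dS 1)^[i] (sl K t + (-1 : ℝ) • sl K 0) 1 = 0 := by
      intro i hi he
      have := hφ0 i hi he
      rw [hiter i (by omega) zero_mem_I, hiter i (by omega) one_mem_I]
      simp only [Pi.add_apply, Pi.smul_apply, this]
      obtain ⟨m, rfl⟩ := even_iff_exists_two_mul.1 he
      simp [(hodd1 m).1, (hodd1 m).2]
    set w := sl K t + (-1 : ℝ) • sl K 0 with hwdef
    have cw2 : ContDiffOn ℝ 2 ((dS 1)^[j] w) I := contDiffOn_iterate_dS 1 j 2 hw
    have cw1 : ContDiffOn ℝ 1 ((dS 1)^[j + 1] w) I := by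
      simpa using contDiffOn_iterate_dS 1 (j + 1) 1 hw
    have cwl : ContinuousOn ((dS 1)^[j + 2] w) I :=
      (contDiffOn_iterate_dS 1 (j + 2) 0 (by simpa using hw)).continuousOn
    have cφl : ContinuousOn ((dS 1)^[j + 2] (sl K 0)) I :=
      (contDiffOn_iterate_dS 1 (j + 2) 0 (by simpa using hφ)).continuousOn
    have hbd : (dS 1)^[j] w 0 * (dS 1)^[j + 1] w 0 = 0 ∧ (dS 1)^[j] w 1 * (dS 1)^[j + 1] w 1 = 0 := by
      rcases Nat.even_or_odd j with he | ho
      · rw [(hw0 j (by omega) he).1, (hw0 j (by omega) he).2, zero_mul, zero_mul]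
        exact ⟨rfl, rfl⟩
      · rw [(hw0 (j + 1) le_rfl ho.add_one).1, (hw0 (j + 1) le_rfl ho.add_one).2, mul_zero, mul_zero]
        exact ⟨rfl, rfl⟩
    have ibp := ip_dS one_ne_zero (cw2.of_le (by norm_num)) cw1 hbd.1 hbd.2
    rw [← Function.iterate_succ_apply' (dS 1), ← Function.iterate_succ_apply' (dS 1),
      ip_self zero_le_one] at ibp
    have h1 := abs_ip_le zero_le_one cw2.continuousOn cwl
    rw [ibp, abs_neg, abs_of_nonneg (sq_nonneg _)] at h1
    rw [Real.sqrt_sq (nrm_nonneg _ _)]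
    refine h1.trans (mul_le_mul_of_nonneg_left ?_ (nrm_nonneg _ _))
    rw [nrm_congr 1 (hiter (j + 2) le_rfl)]
    refine (nrm_add_le zero_le_one (hu.iter 1 (j + 2)).continuousOn
      (cφl.const_smul (-1 : ℝ))).trans ?_
    rw [nrm_smul, abs_neg, abs_one, one_mul]
    refine add_le_add (Real.le_sqrt_of_sq_le ?_) le_rfl
    have h2 := hB t ht htT
    rw [nrm_iterate_sq_eq (h.pos t ht.le).le] at h2
    have hfac := h.factor_pos ht.le (j + 2)
    rw [inv_mul_eq_div, le_div_iff₀ hfac]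
    linarith
  have hl := hlim.sqrt.mul ((((h.tendsto_factor (j + 2)).inv₀
    (h.factor_pos le_rfl (j + 2)).ne').mul_const B).sqrt.add_const
      (nrm 1 ((dS 1)^[j + 2] (sl K 0))))
  rw [Real.sqrt_zero, zero_mul] at hl
  refine squeeze_zero' (Eventually.of_forall fun t => sq_nonneg _) ?_ hl
  filter_upwards [Ioc_mem_nhdsGT hT] with t ht using key t ht.1 ht.2

lemma tendsto_deviation_zero :
    Tendsto (fun t => nrm 1 ((dS 1)^[0] (sl K t + (-1 : ℝ) • sl K 0)) ^ 2) (𝓝[>] 0) (𝓝 0) := by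
  have h := hf.toCurvFlow
  have c0 : ContinuousOn (fun p : ℝ × ℝ => K (0, p.2)) (Ici 0 ×ˢ I) :=
    h.K_cont.comp (by fun_prop) fun p hp => ⟨self_mem_Ici, hp.2⟩
  have h1 := continuousOn_integral (F := fun p => (K p - K (0, p.2)) ^ 2) ((h.K_cont.sub c0).pow 2)
  have h2 := (h1 0 self_mem_Ici).mono_left (nhdsWithin_mono 0 Ioi_subset_Ici_self)
  simp only [sub_self, ne_eq, OfNat.ofNat_ne_zero, not_false_eq_true, zero_pow,
    intervalIntegral.integral_zero] at h2
  refine h2.congr fun t => ?_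
  rw [nrm_sq zero_le_one, one_mul]
  simp only [Function.iterate_zero, id_eq, Pi.add_apply, Pi.smul_apply, smul_eq_mul, sl]
  congr 1
  funext x
  ring

end BddFlow

/-- Estimates up to the initial time: the energy of order `j + 2` is bounded in terms of its initial
value, uniformly over all flows whose initial curvature satisfies the compatibility conditions of
order at most `j + 1`. -/
lemma exists_bound_of_compatible {M : ℝ} (hM : 1 ≤ M) {T : ℝ} (hT : 0 < T) (j : ℕ) : ∃ D : ℝ,
    ∀ (ε : ℝ) (ℓ : ℝ → ℝ) (K Lam : ℝ × ℝ → ℝ), BddFlow M T ε ℓ K Lam →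
    ContDiffOn ℝ (j + 2 : ℕ) (sl K 0) I →
    (∀ i ≤ j + 1, Even i → (dS 1)^[i] (sl K 0) 0 = 0 ∧ (dS 1)^[i] (sl K 0) 1 = 0) →
    ∀ t, 0 < t → t ≤ T → nrm (ℓ t) ((dS (ℓ t))^[j + 2] (sl K t)) ^ 2 ≤
      2 * nrm (ℓ 0) ((dS (ℓ 0))^[j + 2] (sl K 0)) ^ 2 + D := by
  have step : ∀ j : ℕ, ∃ D : ℝ,
      ∀ (ε : ℝ) (ℓ : ℝ → ℝ) (K Lam : ℝ × ℝ → ℝ), BddFlow M T ε ℓ K Lam →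
      ContDiffOn ℝ (j + 2 : ℕ) (sl K 0) I →
      (∀ i ≤ j + 1, Even i → (dS 1)^[i] (sl K 0) 0 = 0 ∧ (dS 1)^[i] (sl K 0) 1 = 0) →
      Tendsto (fun t => nrm 1 ((dS 1)^[j] (sl K t + (-1 : ℝ) • sl K 0)) ^ 2) (𝓝[>] 0) (𝓝 0) →
      ∀ t, 0 < t → t ≤ T → nrm (ℓ t) ((dS (ℓ t))^[j + 2] (sl K t)) ^ 2 ≤
        2 * nrm (ℓ 0) ((dS (ℓ 0))^[j + 2] (sl K 0)) ^ 2 + D := by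
    intro j
    obtain ⟨C, hC, hrate⟩ := exists_rate_le hM T (j + 2)
    refine ⟨2 + C * T, fun ε ℓ K Lam hf hφ hφ0 hlim t ht htT => ?_⟩
    obtain ⟨s, hs, hst, hsB⟩ := hf.exists_energy_le hM hT hφ hφ0 hlim ht
    have h1 := hf.energy_sub_le (j := j + 2) (c := C) hs hst.le (fun r hr => by
      have h1 := hrate ε ℓ K Lam hf r (hs.trans_le hr.1) (hr.2.trans htT)
      nlinarith [sq_nonneg (nrm (ℓ r) ((dS (ℓ r))^[j + 2 + 1] (sl K r)))])
    have h2 : C * (t - s) ≤ C * T := mul_le_mul_of_nonneg_left (by linarith) hC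
    linarith
  obtain ⟨D, hD⟩ := step j
  refine ⟨D, fun ε ℓ K Lam hf hφ hφ0 => hD ε ℓ K Lam hf hφ hφ0 ?_⟩
  have lower : ∀ i ≤ j,
      Tendsto (fun t => nrm 1 ((dS 1)^[i] (sl K t + (-1 : ℝ) • sl K 0)) ^ 2) (𝓝[>] 0) (𝓝 0) := by
    intro i
    induction i with
    | zero => exact fun _ => hf.tendsto_deviation_zero
    | succ i ih =>
      intro hi
      have hφ' : ContDiffOn ℝ (i + 2 : ℕ) (sl K 0) I :=
        hφ.of_le (by exact_mod_cast (by omega : i + 2 ≤ j + 2))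
      have hφ0' : ∀ m ≤ i + 1, Even m →
          (dS 1)^[m] (sl K 0) 0 = 0 ∧ (dS 1)^[m] (sl K 0) 1 = 0 := fun m hm =>
        hφ0 m (by omega)
      obtain ⟨E, hE⟩ := step i
      exact hf.tendsto_deviation_succ hT hφ' hφ0' (ih (by omega))
        (hE ε ℓ K Lam hf hφ' hφ0' (ih (by omega)))
  exact lower j le_rfl

/-! ### From curves to curvature -/

section ConstantSpeed
variable {γ : ℝ → Plane} {L : ℝ} (hL : ∀ x ∈ I, speed γ x = L)
include hL

lemma arcDeriv_eqOn {E : Type*} [NormedAddCommGroup E] [NormedSpace ℝ E] (f : ℝ → E) :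
    EqOn (arcDeriv γ f) (L⁻¹ • derivWithin f I) I := by
  intro x hx
  rw [arcDeriv, hL x hx]
  rfl

lemma tangent_eq {x : ℝ} (hx : x ∈ I) : tangent γ x = L⁻¹ • derivWithin γ I x :=
  arcDeriv_eqOn hL γ hx

lemma curvature_eq {x : ℝ} (hx : x ∈ I) : curvature γ x = L⁻¹ ^ 3 *
    (derivWithin γ I x 0 * derivWithin (derivWithin γ I) I x 1 -
      derivWithin γ I x 1 * derivWithin (derivWithin γ I) I x 0) := by
  have h1 : arcDeriv γ (arcDeriv γ γ) x = L⁻¹ • L⁻¹ • derivWithin (derivWithin γ I) I x := by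
    rw [arcDeriv_eqOn hL _ hx, Pi.smul_apply,
      derivWithin_congr (arcDeriv_eqOn hL γ) (arcDeriv_eqOn hL γ hx), derivWithin_const_smul_field]
  rw [curvature, normal, h1, tangent_eq hL hx, rot]
  simp only [PiLp.inner_apply, Fin.sum_univ_two, PiLp.smul_apply, smul_eq_mul,
    RCLike.inner_apply, conj_trivial, Matrix.cons_val_zero, Matrix.cons_val_one]
  ring

lemma curvatureDeriv_eqOn (j : ℕ) : EqOn (curvatureDeriv γ j) ((dS L)^[j] (curvature γ)) I := by
  unfold curvatureDeriv
  induction j with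
  | zero => exact fun x _ => rfl
  | succ j ih =>
    rw [Function.iterate_succ_apply', Function.iterate_succ_apply']
    exact (arcDeriv_eqOn hL _).trans (dS_congr L ih)

lemma arcIntegral_eq (hL0 : 0 ≤ L) (j : ℕ) :
    arcIntegral γ (fun x => curvatureDeriv γ j x ^ 2) =
      nrm L ((dS L)^[j] (curvature γ)) ^ 2 := by
  rw [arcIntegral, nrm_sq hL0, ← intervalIntegral.integral_const_mul]
  refine integral_congr_I fun x hx => ?_
  simp only [curvatureDeriv_eqOn hL j hx, hL x hx]
  ring

end ConstantSpeed

lemma speed_congr {γ γ' : ℝ → Plane} (h : EqOn γ γ' I) : EqOn (speed γ) (speed γ') I := by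
  intro x hx
  rw [speed, speed, derivWithin_congr h (h hx)]

lemma arcDeriv_congr {E : Type*} [NormedAddCommGroup E] [NormedSpace ℝ E] {γ γ' : ℝ → Plane}
    (h : EqOn γ γ' I) {f g : ℝ → E} (hfg : EqOn f g I) :
    EqOn (arcDeriv γ f) (arcDeriv γ' g) I := by
  intro x hx
  rw [arcDeriv, arcDeriv, speed_congr h hx, derivWithin_congr hfg (hfg hx)]

lemma curvature_congr {γ γ' : ℝ → Plane} (h : EqOn γ γ' I) :
    EqOn (curvature γ) (curvature γ') I := by
  intro x hx
  rw [curvature, curvature, normal, normal, tangent, tangent, arcDeriv_congr h h hx,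
    arcDeriv_congr h (arcDeriv_congr h h) hx]

/-- A coordinate of the plane, as a continuous linear map. -/
def coord (i : Fin 2) : Plane →L[ℝ] ℝ := EuclideanSpace.proj i

lemma derivWithin_apply {γ : ℝ → Plane} {s : Set ℝ} {x : ℝ} (hs : UniqueDiffWithinAt ℝ s x)
    (hγ : DifferentiableWithinAt ℝ γ s x) (i : Fin 2) :
    derivWithin γ s x i = derivWithin (fun y => γ y i) s x :=
  (((coord i).hasFDerivAt.comp_hasDerivWithinAt x hγ.hasDerivWithinAt).derivWithin hs).symm

lemma norm_sq_eq (v : Plane) : ‖v‖ ^ 2 = v 0 ^ 2 + v 1 ^ 2 := by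
  rw [EuclideanSpace.norm_sq_eq, Fin.sum_univ_two, Real.norm_eq_abs, Real.norm_eq_abs, sq_abs,
    sq_abs]

/-- The kinematics of a moving plane curve `(X, Y)` of constant speed `ℓ`, with unit tangent `(a, b)`,
curvature `K`, normal velocity `V` and tangential velocity `Lam`. -/
structure MovingFrame (ℓ : ℝ → ℝ) (X Y a b K V Lam : ℝ × ℝ → ℝ) : Prop where
  ℓ_smooth : Smooth2 fun p => ℓ p.1
  X_smooth : Smooth2 X
  Y_smooth : Smooth2 Y
  a_smooth : Smooth2 a
  b_smooth : Smooth2 b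
  K_smooth : Smooth2 K
  V_smooth : Smooth2 V
  Lam_smooth : Smooth2 Lam
  X_x : EqOn (∂ₓ X) (fun p => ℓ p.1 * a p) dom
  Y_x : EqOn (∂ₓ Y) (fun p => ℓ p.1 * b p) dom
  unit : ∀ p ∈ dom, a p * a p + b p * b p = 1
  K_eq : ∀ p ∈ dom, ℓ p.1 * K p = a p * ∂ₓ b p - b p * ∂ₓ a p
  V_eq : ∀ p ∈ dom, V p = -b p * ∂ₜ X p + a p * ∂ₜ Y p
  Lam_eq : ∀ p ∈ dom, Lam p = a p * ∂ₜ X p + b p * ∂ₜ Y p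

lemma dx_fst {ℓ : ℝ → ℝ} (hℓ : Smooth2 fun p => ℓ p.1) {p : ℝ × ℝ} (hp : p ∈ dom) :
    ∂ₓ (fun q => ℓ q.1) p = 0 := by
  obtain ⟨t, x⟩ := p
  rw [dx_eq hℓ hp.1 hp.2]
  exact congrFun (derivWithin_const I (ℓ t)) x

namespace MovingFrame
variable {ℓ : ℝ → ℝ} {X Y a b K V Lam : ℝ × ℝ → ℝ} (h : MovingFrame ℓ X Y a b K V Lam)
include h

lemma dd_unit (v : ℝ × ℝ) {p : ℝ × ℝ} (hp : p ∈ dom) : a p * dd v a p + b p * dd v b p = 0 := by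
  have h1 : dd v (fun q => a q * a q + b q * b q) p = 0 := by
    rw [dd_congr v (G := fun _ => 1) (fun q hq => h.unit q hq) hp, dd_const]
  rw [dd_add (ContDiffOn.mul h.a_smooth h.a_smooth) (ContDiffOn.mul h.b_smooth h.b_smooth) hp,
    dd_mul h.a_smooth h.a_smooth hp, dd_mul h.b_smooth h.b_smooth hp] at h1
  linarith

/-- The Frenet equations. -/
lemma frenet {p : ℝ × ℝ} (hp : p ∈ dom) :
    ∂ₓ a p = -(ℓ p.1 * K p * b p) ∧ ∂ₓ b p = ℓ p.1 * K p * a p := by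
  have h1 := h.dd_unit (0, 1) hp
  have h2 := h.K_eq p hp
  have h3 := h.unit p hp
  constructor
  · linear_combination (-∂ₓ a p) * h3 + a p * h1 + b p * h2
  · linear_combination (-∂ₓ b p) * h3 + b p * h1 - a p * h2

lemma velocity {p : ℝ × ℝ} (hp : p ∈ dom) :
    ∂ₜ X p = -b p * V p + a p * Lam p ∧ ∂ₜ Y p = a p * V p + b p * Lam p := by
  have h1 := h.V_eq p hp
  have h2 := h.Lam_eq p hp
  have h3 := h.unit p hp
  constructor
  · linear_combination (-∂ₜ X p) * h3 + b p * h1 - a p * h2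
  · linear_combination (-∂ₜ Y p) * h3 - a p * h1 - b p * h2

/-- The evolution of `ℓ (a, b) = ∂ₓ (X, Y)`. -/
lemma dt_tangent {p : ℝ × ℝ} (hp : p ∈ dom) :
    ∂ₜ (fun q => ℓ q.1) p * a p + ℓ p.1 * ∂ₜ a p =
      -(ℓ p.1 * K p * a p * V p) - b p * ∂ₓ V p - ℓ p.1 * K p * b p * Lam p + a p * ∂ₓ Lam p ∧
    ∂ₜ (fun q => ℓ q.1) p * b p + ℓ p.1 * ∂ₜ b p =
      -(ℓ p.1 * K p * b p * V p) + a p * ∂ₓ V p + ℓ p.1 * K p * a p * Lam p + b p * ∂ₓ Lam p := by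
  obtain ⟨ha, hb⟩ := h.frenet hp
  have nb : Smooth2 fun q => -1 * b q := contDiffOn_const.mul h.b_smooth
  have hnb : ∂ₓ (fun q => -1 * b q) p = -∂ₓ b p := by
    rw [dd_mul contDiffOn_const h.b_smooth hp, dd_const]
    ring
  constructor
  · rw [← dd_mul h.ℓ_smooth h.a_smooth hp, ← dd_congr _ h.X_x hp, dd_comm h.X_smooth hp,
      dd_congr _ (G := fun q => -1 * b q * V q + a q * Lam q)
        (fun q hq => (h.velocity hq).1.trans (by ring)) hp,
      dd_add (ContDiffOn.mul nb h.V_smooth) (ContDiffOn.mul h.a_smooth h.Lam_smooth) hp,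
      dd_mul nb h.V_smooth hp, dd_mul h.a_smooth h.Lam_smooth hp, hnb, ha, hb]
    ring
  · rw [← dd_mul h.ℓ_smooth h.b_smooth hp, ← dd_congr _ h.Y_x hp, dd_comm h.Y_smooth hp,
      dd_congr _ (G := fun q => a q * V q + b q * Lam q) (fun q hq => (h.velocity hq).2) hp,
      dd_add (ContDiffOn.mul h.a_smooth h.V_smooth) (ContDiffOn.mul h.b_smooth h.Lam_smooth) hp,
      dd_mul h.a_smooth h.V_smooth hp, dd_mul h.b_smooth h.Lam_smooth hp, ha, hb]
    ring

/-- The evolution of the length. -/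
lemma dx_Lam {p : ℝ × ℝ} (hp : p ∈ dom) :
    ∂ₓ Lam p = ∂ₜ (fun q => ℓ q.1) p + ℓ p.1 * K p * V p := by
  obtain ⟨h1, h2⟩ := h.dt_tangent hp
  linear_combination (-a p) * h1 - b p * h2 + ℓ p.1 * h.dd_unit (1, 0) hp +
    (∂ₜ (fun q => ℓ q.1) p + ℓ p.1 * K p * V p - ∂ₓ Lam p) * h.unit p hp

/-- The evolution of the curvature. -/
lemma dt_K {p : ℝ × ℝ} (hp : p ∈ dom) : ℓ p.1 * (ℓ p.1 * ∂ₜ K p) =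
    ∂ₓ (∂ₓ V) p + ℓ p.1 * ℓ p.1 * (K p * K p * V p) + ℓ p.1 * (Lam p * ∂ₓ K p) := by
  have sa := h.a_smooth
  have sb := h.b_smooth
  have sK := h.K_smooth
  have sℓ := h.ℓ_smooth
  have sax := sa.dd (0, 1)
  have sbx := sb.dd (0, 1)
  have sat := sa.dd (1, 0)
  have sbt := sb.dd (1, 0)
  -- the angular velocity of the tangent
  set W : ℝ × ℝ → ℝ := fun q => a q * ∂ₜ b q + -1 * b q * ∂ₜ a q with hW
  have nb : Smooth2 fun q => -1 * b q := contDiffOn_const.mul sb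
  have hnb : ∀ v, dd v (fun q => -1 * b q) p = -dd v b p := fun v => by
    rw [dd_mul contDiffOn_const sb hp, dd_const]
    ring
  have sW : Smooth2 W := (ContDiffOn.mul sa sbt).add (ContDiffOn.mul nb sat)
  have hWV : EqOn (fun q => ℓ q.1 * W q) (fun q => ∂ₓ V q + ℓ q.1 * K q * Lam q) dom := by
    intro q hq
    obtain ⟨h1, h2⟩ := h.dt_tangent hq
    simp only [hW]
    linear_combination (-b q) * h1 + a q * h2 + (∂ₓ V q + ℓ q.1 * K q * Lam q) * h.unit q hq
  have hat : EqOn (∂ₜ a) (fun q => -1 * b q * W q) dom := fun q hq => by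
    simp only [hW]
    linear_combination (-∂ₜ a q) * h.unit q hq + a q * h.dd_unit (1, 0) hq
  have hbt : EqOn (∂ₜ b) (fun q => a q * W q) dom := fun q hq => by
    simp only [hW]
    linear_combination (-∂ₜ b q) * h.unit q hq + b q * h.dd_unit (1, 0) hq
  obtain ⟨ha, hb⟩ := h.frenet hp
  have e1 : ∂ₜ (fun q => ℓ q.1) p * K p + ℓ p.1 * ∂ₜ K p = ∂ₓ W p := by
    rw [← dd_mul sℓ sK hp, dd_congr _ (G := fun q => a q * ∂ₓ b q + -1 * b q * ∂ₓ a q)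
      (fun q hq => (h.K_eq q hq).trans (by ring)) hp,
      dd_add (ContDiffOn.mul sa sbx) (ContDiffOn.mul nb sax) hp, dd_mul sa sbx hp,
      dd_mul nb sax hp, hnb, dd_comm (v := (1, 0)) sb hp, dd_comm (v := (1, 0)) sa hp,
      dd_congr _ hat hp, dd_congr _ hbt hp, dd_mul nb sW hp, dd_mul sa sW hp, hnb, ha, hb,
      hat hp, hbt hp]
    linear_combination ∂ₓ W p * h.unit p hp
  have e2 : ℓ p.1 * ∂ₓ W p = ∂ₓ (∂ₓ V) p + ℓ p.1 * ∂ₓ K p * Lam p + ℓ p.1 * K p * ∂ₓ Lam p := by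
    have := dd_congr (0, 1) hWV hp
    rw [dd_mul sℓ sW hp, dd_add (h.V_smooth.dd _)
      (ContDiffOn.mul (ContDiffOn.mul sℓ sK) h.Lam_smooth) hp,
      dd_mul (ContDiffOn.mul sℓ sK) h.Lam_smooth hp, dd_mul sℓ sK hp, dx_fst sℓ hp] at this
    linarith
  linear_combination ℓ p.1 * e1 + e2 + ℓ p.1 * K p * h.dx_Lam hp

end MovingFrame

section Solution
variable {ε : ℝ} {P Q : Plane} {c : ℝ → Plane} {Υ : ℝ → ℝ → Plane} (hs : IsSolution ε P Q c Υ)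
include hs

lemma IsSolution.speed_eq {t : ℝ} (ht : 0 ≤ t) : ∀ x ∈ I, speed (Υ t) x = speed (Υ t) 0 := by
  obtain ⟨L, -, h⟩ := hs.constSpeed t ht
  intro x hx
  rw [h x hx, h 0 zero_mem_I]

lemma IsSolution.speed_pos {t : ℝ} (ht : 0 ≤ t) : 0 < speed (Υ t) 0 := by
  obtain ⟨L, hL, h⟩ := hs.constSpeed t ht
  rwa [h 0 zero_mem_I]

lemma IsSolution.continuousOn_speed : ContinuousOn (fun t => speed (Υ t) 0) (Ici 0) := by
  have h1 := (hs.continuous_up_to_zero 1 one_le_two).norm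
  have h2 : ContinuousOn (fun t : ℝ => ‖iteratedDerivWithin 1 (Υ t) I 0‖) (Ici 0) :=
    h1.comp (f := fun t : ℝ => (t, (0 : ℝ))) (by fun_prop) fun t ht => ⟨ht, zero_mem_I⟩
  refine h2.congr fun t _ => ?_
  simp only [speed, iteratedDerivWithin_one]

lemma IsSolution.continuousOn_curvature :
    ContinuousOn (fun p : ℝ × ℝ => curvature (Υ p.1) p.2) (Ici 0 ×ˢ I) := by
  have h1 := hs.continuous_up_to_zero 1 one_le_two
  have h2 := hs.continuous_up_to_zero 2 le_rfl
  have hc : ∀ {f : ℝ × ℝ → Plane}, ContinuousOn f (Ici 0 ×ˢ I) → ∀ i : Fin 2,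
      ContinuousOn (fun p => f p i) (Ici 0 ×ˢ I) := fun hf i =>
    (coord i).continuous.comp_continuousOn hf
  have hℓ : ContinuousOn (fun p : ℝ × ℝ => (speed (Υ p.1) 0)⁻¹ ^ 3) (Ici 0 ×ˢ I) :=
    ((hs.continuousOn_speed.comp continuousOn_fst fun p hp => hp.1).inv₀
      fun p hp => (hs.speed_pos hp.1).ne').pow 3
  refine (hℓ.mul (((hc h1 0).mul (hc h2 1)).sub ((hc h1 1).mul (hc h2 0)))).congr fun p hp => ?_
  simp only [curvature_eq (hs.speed_eq hp.1) hp.2]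
  have e : iteratedDerivWithin 2 (Υ p.1) I = derivWithin (derivWithin (Υ p.1) I) I := by
    funext x
    rw [iteratedDerivWithin_succ]
    rw [iteratedDerivWithin_one]
  have e1 : iteratedDerivWithin 1 (Υ p.1) I = derivWithin (Υ p.1) I :=
    iteratedDerivWithin_one
  simp only [Pi.mul_apply, Pi.sub_apply, e, e1]

/-- The curvature of a solution evolves by `CurvFlow`. -/
lemma IsSolution.exists_curvFlow : ∃ Lam : ℝ × ℝ → ℝ,
    CurvFlow ε (fun t => speed (Υ t) 0) (fun p => curvature (Υ p.1) p.2) Lam := by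
  set ℓ : ℝ → ℝ := fun t => speed (Υ t) 0 with hℓdef
  set K : ℝ × ℝ → ℝ := fun p => curvature (Υ p.1) p.2 with hKdef
  set X : ℝ × ℝ → ℝ := fun p => Υ p.1 p.2 0 with hX
  set Y : ℝ × ℝ → ℝ := fun p => Υ p.1 p.2 1 with hY
  have hcoord : ∀ i : Fin 2, Smooth2 fun p => Υ p.1 p.2 i := fun i =>
    (coord i).contDiff.comp_contDiffOn hs.smooth
  have sX : Smooth2 X := hcoord 0
  have sY : Smooth2 Y := hcoord 1
  have hslice : ∀ t, 0 < t → ContDiffOn ℝ ∞ (Υ t) I := fun t ht =>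
    ContDiffOn.comp hs.smooth (f := fun y : ℝ => (t, y))
      (contDiff_const.prodMk contDiff_id).contDiffOn fun y hy => mem_dom ht hy
  have hpos : ∀ p ∈ dom, 0 < ℓ p.1 := fun p hp => hs.speed_pos (le_of_lt hp.1)
  -- the space derivatives in coordinates
  have d1 : ∀ p ∈ dom, ∀ i : Fin 2,
      derivWithin (Υ p.1) I p.2 i = ∂ₓ (fun q => Υ q.1 q.2 i) p := fun p hp i => by
    rw [derivWithin_apply (uniqueDiffOn_I p.2 hp.2)
      ((hslice p.1 hp.1).differentiableOn (by simp) p.2 hp.2)]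
    exact (dx_eq (hcoord i) hp.1 hp.2).symm
  have d2 : ∀ p ∈ dom, ∀ i : Fin 2, derivWithin (derivWithin (Υ p.1) I) I p.2 i =
      ∂ₓ (∂ₓ fun q => Υ q.1 q.2 i) p := fun p hp i => by
    have hd : ContDiffOn ℝ ∞ (derivWithin (Υ p.1) I) I :=
      (hslice p.1 hp.1).derivWithin uniqueDiffOn_I le_rfl
    rw [derivWithin_apply (uniqueDiffOn_I p.2 hp.2) (hd.differentiableOn (by simp) p.2 hp.2),
      derivWithin_congr (fun y hy => d1 (p.1, y) (mem_dom hp.1 hy) i) (d1 p hp i)]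
    exact (dx_eq ((hcoord i).dd (0, 1)) hp.1 hp.2).symm
  have hsq : ∀ p ∈ dom, ℓ p.1 ^ 2 = ∂ₓ X p ^ 2 + ∂ₓ Y p ^ 2 := fun p hp => by
    rw [hℓdef]
    simp only
    rw [← hs.speed_eq (le_of_lt hp.1) p.2 hp.2, speed, norm_sq_eq, d1 p hp, d1 p hp]
  have sℓ : Smooth2 fun p => ℓ p.1 := by
    have h1 : ContDiffOn ℝ ∞ (fun p => √(∂ₓ X p ^ 2 + ∂ₓ Y p ^ 2)) dom := by
      refine ContDiffOn.sqrt (((sX.dd (0, 1)).pow 2).add ((sY.dd (0, 1)).pow 2)) fun p hp => ?_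
      have := hpos p hp
      rw [← hsq p hp]
      positivity
    refine h1.congr fun p hp => ?_
    rw [← hsq p hp, Real.sqrt_sq (hpos p hp).le]
  have sinv : Smooth2 fun p => (ℓ p.1)⁻¹ := ContDiffOn.inv sℓ fun p hp => (hpos p hp).ne'
  set a : ℝ × ℝ → ℝ := fun p => (ℓ p.1)⁻¹ * ∂ₓ X p with ha
  set b : ℝ × ℝ → ℝ := fun p => (ℓ p.1)⁻¹ * ∂ₓ Y p with hb
  have sa : Smooth2 a := ContDiffOn.mul sinv (sX.dd _)
  have sb : Smooth2 b := ContDiffOn.mul sinv (sY.dd _)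
  have dinv : ∀ p ∈ dom, ∂ₓ (fun q => (ℓ q.1)⁻¹) p = 0 := fun p hp =>
    dx_fst (ℓ := fun t => (ℓ t)⁻¹) sinv hp
  have hax : ∀ p ∈ dom, ∂ₓ a p = (ℓ p.1)⁻¹ * ∂ₓ (∂ₓ X) p := fun p hp => by
    rw [ha, dd_mul sinv (sX.dd _) hp, dinv p hp]
    ring
  have hbx : ∀ p ∈ dom, ∂ₓ b p = (ℓ p.1)⁻¹ * ∂ₓ (∂ₓ Y) p := fun p hp => by
    rw [hb, dd_mul sinv (sY.dd _) hp, dinv p hp]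
    ring
  have hK : ∀ p ∈ dom, K p =
      (ℓ p.1)⁻¹ ^ 3 * (∂ₓ X p * ∂ₓ (∂ₓ Y) p - ∂ₓ Y p * ∂ₓ (∂ₓ X) p) := fun p hp => by
    rw [hKdef]
    simp only
    rw [curvature_eq (hs.speed_eq (le_of_lt hp.1)) hp.2, d1 p hp, d1 p hp, d2 p hp, d2 p hp]
  have sK : Smooth2 K := (ContDiffOn.mul (sinv.pow 3)
    ((ContDiffOn.mul (sX.dd _) ((sY.dd _).dd _)).sub
      (ContDiffOn.mul (sY.dd _) ((sX.dd _).dd _)))).congr hK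
  set V : ℝ × ℝ → ℝ := fun p => vel ε (ℓ p.1) (sl K p.1) p.2 with hV
  have sV : Smooth2 V := by
    have h2 := Smooth2.iter_dSl sinv sK 2
    exact ContDiffOn.add sK (contDiffOn_const.mul ((contDiffOn_const.mul h2).add
      (contDiffOn_const.mul ((ContDiffOn.mul sK sK).mul sK))))
  set Lam : ℝ × ℝ → ℝ := fun p => a p * ∂ₜ X p + b p * ∂ₜ Y p with hLam
  have sLam : Smooth2 Lam := (ContDiffOn.mul sa (sX.dd _)).add (ContDiffOn.mul sb (sY.dd _))
  have hVeq : ∀ p ∈ dom, V p = -b p * ∂ₜ X p + a p * ∂ₜ Y p := by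
    intro p hp
    obtain ⟨t, x⟩ := p
    have ht : 0 < t := hp.1
    have hx : x ∈ I := hp.2
    have hm := hs.motion t ht x hx
    have hdiff : DifferentiableAt ℝ (fun τ => Υ τ x) t := by
      have h1 : ContDiffOn ℝ ∞ (fun τ => Υ τ x) (Ioi 0) :=
        ContDiffOn.comp hs.smooth (f := fun τ : ℝ => (τ, x))
          (contDiff_id.prodMk contDiff_const).contDiffOn fun s hs' => mem_dom hs' hx
      exact (h1.differentiableOn (by simp) t ht).differentiableAt (Ioi_mem_nhds ht)
    have hdt : ∀ i : Fin 2, deriv (fun τ => Υ τ x) t i = ∂ₜ (fun q => Υ q.1 q.2 i) (t, x) :=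
      fun i => ((coord i).hasFDerivAt.comp_hasDerivAt t hdiff.hasDerivAt).unique
        (hasDerivAt_dt (hcoord i).differentiableOn ht hx)
    have hspeed := hs.speed_eq ht.le
    rw [normal, tangent_eq hspeed hx, rot, curvatureDeriv_eqOn hspeed 2 hx] at hm
    simp only [PiLp.inner_apply, Fin.sum_univ_two, PiLp.smul_apply, smul_eq_mul,
      RCLike.inner_apply, conj_trivial, Matrix.cons_val_zero, Matrix.cons_val_one,
      hdt, d1 (t, x) hp] at hm
    have e : V (t, x) = curvature (Υ t) x - ε * (2 * (dS (ℓ t))^[2] (curvature (Υ t)) x +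
        curvature (Υ t) x ^ 3) := by
      rw [hV]
      simp only [vel, velCorr, Pi.add_apply, Pi.smul_apply, Pi.mul_apply, smul_eq_mul]
      change curvature (Υ t) x + ε * (-2 * (dS (ℓ t))^[2] (curvature (Υ t)) x + -1 *
        (curvature (Υ t) x * curvature (Υ t) x * curvature (Υ t) x)) = _
      ring
    rw [e, ← hm]
  have frame : MovingFrame ℓ X Y a b K V Lam :=
    { ℓ_smooth := sℓ
      X_smooth := sX
      Y_smooth := sY
      a_smooth := sa
      b_smooth := sb
      K_smooth := sK
      V_smooth := sV
      Lam_smooth := sLam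
      X_x := fun p hp => (mul_inv_cancel_left₀ (hpos p hp).ne' _).symm
      Y_x := fun p hp => (mul_inv_cancel_left₀ (hpos p hp).ne' _).symm
      unit := fun p hp => by
        have h1 := hsq p hp
        have h2 := (hpos p hp).ne'
        simp only [ha, hb]
        field_simp
        linarith
      K_eq := fun p hp => by
        have h2 := (hpos p hp).ne'
        rw [hK p hp, hax p hp, hbx p hp]
        simp only [ha, hb]
        field_simp
      V_eq := hVeq
      Lam_eq := fun p _ => rfl }
  -- the end points do not move
  have hend : ∀ e ∈ I, (∃ R : Plane, ∀ t, 0 ≤ t → Υ t e = R) → ∀ t, 0 < t →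
      V (t, e) = 0 ∧ Lam (t, e) = 0 := by
    rintro e he ⟨R, hR⟩ t ht
    have h0 : ∀ i : Fin 2, ∂ₜ (fun q => Υ q.1 q.2 i) (t, e) = 0 := fun i => by
      refine (hasDerivAt_dt (hcoord i).differentiableOn ht he).unique
        ((hasDerivAt_const t (R i)).congr_of_eventuallyEq ?_)
      filter_upwards [Ioi_mem_nhds ht] with s hs'
      simp only [hR s (le_of_lt hs')]
    have hX0 : ∂ₜ X (t, e) = 0 := h0 0
    have hY0 : ∂ₜ Y (t, e) = 0 := h0 1
    rw [hVeq (t, e) (mem_dom ht he), hLam]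
    simp only [hX0, hY0, mul_zero, add_zero, and_self]
  refine ⟨Lam, ?_⟩
  exact
    { pos := fun t ht => hs.speed_pos ht
      ℓ_smooth := sℓ
      K_smooth := sK
      Lam_smooth := sLam
      eq_K := fun p hp => by
        have h1 := frame.dt_K hp
        have h2 := (hpos p hp).ne'
        have e1 : (dS (ℓ p.1))^[2] (vel ε (ℓ p.1) (sl K p.1)) p.2 =
            (ℓ p.1)⁻¹ * ((ℓ p.1)⁻¹ * ∂ₓ (∂ₓ V) p) := by
          have e2 : EqOn (dSl ℓ V) (fun q => (ℓ q.1)⁻¹ * ∂ₓ V q) dom := fun q hq => dSl_eq ℓ sV hq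
          have e3 := dSl_eq ℓ (Smooth2.dSl sinv sV) hp
          rw [dd_congr _ e2 hp, dd_mul sinv (sV.dd _) hp, dinv p hp, zero_mul, zero_add] at e3
          exact e3
        have e2 : dS (ℓ p.1) (sl K p.1) p.2 = (ℓ p.1)⁻¹ * ∂ₓ K p := dSl_eq ℓ sK hp
        simp only [evol, Pi.add_apply, Pi.mul_apply]
        rw [e1, e2, show sl K p.1 p.2 = K p from rfl,
          show vel ε (ℓ p.1) (sl K p.1) p.2 = V p from rfl]
        field_simp
        linarith
      eq_Lam := fun p hp => by
        have h1 := frame.dx_Lam hp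
        have h2 := (hpos p hp).ne'
        have e1 : dS (ℓ p.1) (sl Lam p.1) p.2 = (ℓ p.1)⁻¹ * ∂ₓ Lam p := dSl_eq ℓ sLam hp
        rw [e1, h1, show vel ε (ℓ p.1) (sl K p.1) p.2 = V p from rfl]
        field_simp
        ring
      K_zero := hs.curvature_left
      K_one := hs.curvature_right
      vel_zero := fun t ht => (hend 0 zero_mem_I ⟨P, hs.left⟩ t ht).1
      vel_one := fun t ht => (hend 1 one_mem_I ⟨Q, hs.right⟩ t ht).1
      Lam_zero := fun t ht => (hend 0 zero_mem_I ⟨P, hs.left⟩ t ht).2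
      Lam_one := fun t ht => (hend 1 one_mem_I ⟨Q, hs.right⟩ t ht).2
      ℓ_cont := hs.continuousOn_speed
      K_cont := hs.continuousOn_curvature }

end Solution

/-! ### The initial curve -/

section InitialCurve
variable {P Q : Plane} {c : ℝ → Plane}

lemma contDiffOn_coord {n : WithTop ℕ∞} {γ : ℝ → Plane} (hγ : ContDiffOn ℝ n γ I) (i : Fin 2) :
    ContDiffOn ℝ n (fun y => γ y i) I :=
  (coord i).contDiff.comp_contDiffOn hγ

lemma contDiffOn_curvature {L : ℝ} (hL : ∀ x ∈ I, speed c x = L) {n : WithTop ℕ∞}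
    (hc : ContDiffOn ℝ (n + 2) c I) : ContDiffOn ℝ n (curvature c) I := by
  have h1 : ContDiffOn ℝ (n + 1) (derivWithin c I) I :=
    hc.derivWithin uniqueDiffOn_I (by rw [add_assoc, one_add_one_eq_two])
  have h2 : ContDiffOn ℝ n (derivWithin (derivWithin c I) I) I :=
    h1.derivWithin uniqueDiffOn_I le_rfl
  have h3 : ContDiffOn ℝ n (derivWithin c I) I := h1.of_le le_self_add
  exact (contDiffOn_const.mul (((contDiffOn_coord h3 0).mul (contDiffOn_coord h2 1)).sub
    ((contDiffOn_coord h3 1).mul (contDiffOn_coord h2 0)))).congr fun x hx => curvature_eq hL hx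

lemma iteratedDerivWithin_coord (hc : ContDiffOn ℝ ∞ c I) (n : ℕ) (i : Fin 2) :
    EqOn ((dS 1)^[n] fun y => c y i) (fun y => iteratedDerivWithin n c I y i) I := by
  induction n with
  | zero =>
    intro x _
    simp only [Function.iterate_zero, id_eq, iteratedDerivWithin_zero]
  | succ n ih =>
    intro x hx
    have hd : DifferentiableOn ℝ (iteratedDerivWithin n c I) I :=
      hc.differentiableOn_iteratedDerivWithin (by exact_mod_cast WithTop.coe_lt_top n)
        uniqueDiffOn_I
    simp only [Function.iterate_succ_apply', iteratedDerivWithin_succ]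
    rw [derivWithin_apply (uniqueDiffOn_I x hx) (hd x hx), dS_congr 1 ih hx, dS, inv_one, one_mul]

/-- If the even derivatives of order at least two of the curve vanish at an end point, then so do the
even derivatives of its curvature. -/
lemma iterate_curvature_eq_zero {L : ℝ} (hL : ∀ x ∈ I, speed c x = L) (hc : ContDiffOn ℝ ∞ c I)
    {p : ℝ} (hp : p ∈ I) (h0 : ∀ k : ℕ, 1 ≤ k → iteratedDerivWithin (2 * k) c I p = 0) {i : ℕ}
    (hi : Even i) : (dS 1)^[i] (curvature c) p = 0 := by
  have sX : ∀ m : Fin 2, Smooth fun y => c y m := fun m => contDiffOn_coord hc m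
  have par1 : ∀ m : Fin 2, Par 1 p (i + 1) 1 (dS 1 fun y => c y m) := by
    intro m k _ hk
    obtain ⟨r, hr⟩ := even_iff_exists_two_mul.1 hk
    rw [← Function.iterate_succ_apply, Nat.succ_eq_add_one, hr, iteratedDerivWithin_coord hc _ m hp]
    simp only [h0 r (by omega), PiLp.zero_apply]
  have par2 : ∀ m : Fin 2, Par 1 p i 0 (dS 1 (dS 1 fun y => c y m)) := fun m =>
    (par1 m).dS.parity (by decide)
  have s1 : ∀ m : Fin 2, Smooth (dS 1 fun y => c y m) := fun m => (sX m).dS 1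
  have s2 : ∀ m : Fin 2, Smooth (dS 1 (dS 1 fun y => c y m)) := fun m => (s1 m).dS 1
  have hprod : ∀ m k : Fin 2,
      Par 1 p i 0 ((dS 1 fun y => c y m) * dS 1 (dS 1 fun y => c y k)) := fun m k =>
    (Par.mul hp ((par1 m).mono i.le_succ) (par2 k) (s1 m) (s2 k)).parity (by decide)
  have hsum := Par.smul (L⁻¹ ^ 3) (Par.add hp (hprod 0 1) ((hprod 1 0).smul (-1))
    ((s1 0).mul' (s2 1)) (((s1 1).mul' (s2 0)).smul' (-1)))
  have d1 : ∀ m : Fin 2, ∀ x ∈ I, derivWithin c I x m = dS 1 (fun y => c y m) x := fun m x hx => by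
    have := iteratedDerivWithin_coord hc 1 m hx
    simp only [Function.iterate_one, iteratedDerivWithin_one] at this
    exact this.symm
  have d2 : ∀ m : Fin 2, ∀ x ∈ I, derivWithin (derivWithin c I) I x m =
      dS 1 (dS 1 fun y => c y m) x := fun m x hx => by
    have := iteratedDerivWithin_coord hc 2 m hx
    simp only [iteratedDerivWithin_succ, iteratedDerivWithin_zero] at this
    exact this.symm
  refine (hsum.congr hp fun x hx => ?_) i le_rfl (by simpa using hi)
  rw [curvature_eq hL hx, d1 0 x hx, d1 1 x hx, d2 0 x hx, d2 1 x hx]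
  simp only [Pi.smul_apply, Pi.add_apply, Pi.mul_apply, smul_eq_mul]
  ring

/-- The time up to which the curvature is controlled by the initial curve alone. -/
lemma exists_bddFlow (P Q : Plane) (c : ℝ → Plane) : ∃ Tmax : ℝ, 0 < Tmax ∧ ∃ M : ℝ, 1 ≤ M ∧
    ∀ T, T < Tmax → ∀ ε ∈ Ioc (0 : ℝ) 1, ∀ Υ : ℝ → ℝ → Plane, IsSolution ε P Q c Υ →
    ∃ Lam, BddFlow M T ε (fun t => speed (Υ t) 0) (fun p => curvature (Υ p.1) p.2) Lam := by
  set a : ℝ := nrm (speed c 0) (curvature c) ^ 2 + 1 with ha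
  have ha1 : 1 ≤ a := by linarith [sq_nonneg (nrm (speed c 0) (curvature c))]
  refine ⟨(9 * a ^ 2)⁻¹, by positivity, √(2 * a), Real.one_le_sqrt.2 (by linarith), ?_⟩
  intro T hT ε hε Υ hs
  obtain ⟨Lam, h⟩ := hs.exists_curvFlow
  refine ⟨Lam, h, hε.1, hε.2, fun t ht htT => ?_⟩
  have h0 : EqOn (Υ 0) c I := hs.initial
  refine Real.le_sqrt_of_sq_le (h.nrm_sq_le hε.1 ?_ ht.le (htT.trans hT.le))
  change nrm (speed (Υ 0) 0) (curvature (Υ 0)) ^ 2 + 1 ≤ a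
  rw [speed_congr h0 zero_mem_I, nrm_congr _ (curvature_congr h0)]

/-- Bounds at positive times extend to the initial time, where the energy is that of the initial
curve. -/
lemma uniformlyBounded_of_pos {T B : ℝ} {j : ℕ}
    (h : ∀ ε ∈ Ioc (0 : ℝ) 1, ∀ Υ : ℝ → ℝ → Plane, IsSolution ε P Q c Υ → ∀ t, 0 < t → t ≤ T →
      nrm (speed (Υ t) 0) ((dS (speed (Υ t) 0))^[j] (curvature (Υ t))) ^ 2 ≤ B) :
    UniformlyBounded P Q c j (Icc 0 T) := by
  refine ⟨max B (nrm (speed c 0) ((dS (speed c 0))^[j] (curvature c)) ^ 2), ?_⟩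
  intro ε hε Υ hs t ht
  rw [arcIntegral_eq (hs.speed_eq ht.1) (hs.speed_pos ht.1).le]
  rcases ht.1.eq_or_lt with rfl | h0
  · have h0 : EqOn (Υ 0) c I := hs.initial
    rw [speed_congr h0 zero_mem_I, nrm_congr _ (dS_iterate_congr _ j (curvature_congr h0))]
    exact le_max_right _ _
  · exact (h ε hε Υ hs t h0 ht.2).trans (le_max_left _ _)

/-- Energy estimates up to the initial time, in terms of the initial energy, under the compatibility
conditions. -/
lemma exists_bound_of_initial {T M : ℝ} (hT : 0 < T) (hM : 1 ≤ M)
    (hflow : ∀ ε ∈ Ioc (0 : ℝ) 1, ∀ Υ : ℝ → ℝ → Plane, IsSolution ε P Q c Υ →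
      ∃ Lam, BddFlow M T ε (fun t => speed (Υ t) 0) (fun p => curvature (Υ p.1) p.2) Lam)
    (j : ℕ) (hφ : ContDiffOn ℝ (j + 2 : ℕ) (curvature c) I)
    (hφ0 : ∀ i ≤ j + 1, Even i →
      (dS 1)^[i] (curvature c) 0 = 0 ∧ (dS 1)^[i] (curvature c) 1 = 0) :
    ∃ B : ℝ, ∀ ε ∈ Ioc (0 : ℝ) 1, ∀ Υ : ℝ → ℝ → Plane, IsSolution ε P Q c Υ → ∀ t, 0 < t → t ≤ T →
      nrm (speed (Υ t) 0) ((dS (speed (Υ t) 0))^[j + 2] (curvature (Υ t))) ^ 2 ≤ B := by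
  obtain ⟨D, hD⟩ := exists_bound_of_compatible hM hT j
  refine ⟨2 * nrm (speed c 0) ((dS (speed c 0))^[j + 2] (curvature c)) ^ 2 + D, ?_⟩
  intro ε hε Υ hs t ht htT
  obtain ⟨Lam, hf⟩ := hflow ε hε Υ hs
  have h0 : EqOn (Υ 0) c I := hs.initial
  have hκ : EqOn (curvature (Υ 0)) (curvature c) I := curvature_congr h0
  have h1 := hD ε _ _ Lam hf (hφ.congr hκ) (fun i hi he => by
    have h2 := dS_iterate_congr 1 i hκ
    exact ⟨(h2 zero_mem_I).trans (hφ0 i hi he).1, (h2 one_mem_I).trans (hφ0 i hi he).2⟩) t ht htT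
  have h3 : nrm (speed (Υ 0) 0) ((dS (speed (Υ 0) 0))^[j + 2] (curvature (Υ 0))) ^ 2 =
      nrm (speed c 0) ((dS (speed c 0))^[j + 2] (curvature c)) ^ 2 := by
    rw [speed_congr h0 zero_mem_I, nrm_congr _ (dS_iterate_congr _ (j + 2) hκ)]
  rw [← h3]
  exact h1

end InitialCurve

end ElasticFlow

end

open ElasticFlow in
theorem proposition3p8 (P Q : ElasticFlow.Plane) (c : ℝ → ElasticFlow.Plane)
    (hc : ElasticFlow.IsInitialCurve P Q c) :
    ∃ Tmax : ℝ, 0 < Tmax ∧ ∀ T : ℝ, 0 < T → T < Tmax →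
      (∀ j : ℕ, ∀ δ : ℝ, 0 < δ → ElasticFlow.UniformlyBounded P Q c j (Icc δ T)) ∧
      (∀ j : ℕ, j ≤ 2 → ElasticFlow.UniformlyBounded P Q c j (Icc 0 T)) ∧
      (ContDiffOn ℝ ∞ c ElasticFlow.I →
        (∀ k : ℕ, 1 ≤ k → iteratedDerivWithin (2 * k) c ElasticFlow.I 0 = 0 ∧
          iteratedDerivWithin (2 * k) c ElasticFlow.I 1 = 0) →
        ∀ j : ℕ, ElasticFlow.UniformlyBounded P Q c j (Icc 0 T)) := by
  obtain ⟨Tmax, hTmax, M, hM, hflow⟩ := exists_bddFlow P Q c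
  obtain ⟨L, -, hL⟩ := hc.constSpeed
  refine ⟨Tmax, hTmax, fun T hT hTT => ?_⟩
  have hflow := hflow T hTT
  have low : ∀ j : ℕ, j ≤ 2 → UniformlyBounded P Q c j (Icc 0 T) := by
    have h0 : ∀ ε ∈ Ioc (0 : ℝ) 1, ∀ Υ : ℝ → ℝ → Plane, IsSolution ε P Q c Υ → ∀ t, 0 < t → t ≤ T →
        nrm (speed (Υ t) 0) (curvature (Υ t)) ≤ M := by
      intro ε hε Υ hs t ht htT
      obtain ⟨Lam, hf⟩ := hflow ε hε Υ hs
      exact hf.bound t ht htT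
    have hκ : ContDiffOn ℝ (0 + 2 : ℕ) (curvature c) I :=
      contDiffOn_curvature hL (hc.contDiffOn.of_le (by norm_num))
    obtain ⟨B, hB⟩ := exists_bound_of_initial hT hM hflow 0 hκ (by
      intro i hi he
      obtain rfl : i = 0 := by
        obtain ⟨m, hm⟩ := he
        omega
      exact ⟨hc.curvature_left, hc.curvature_right⟩)
    intro j hj
    interval_cases j
    · exact uniformlyBounded_of_pos (B := M ^ 2) fun ε hε Υ hs t ht htT =>
        pow_le_pow_left₀ (nrm_nonneg _ _) (h0 ε hε Υ hs t ht htT) 2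
    · refine uniformlyBounded_of_pos (B := M * √B) fun ε hε Υ hs t ht htT => ?_
      obtain ⟨Lam, hf⟩ := hflow ε hε Υ hs
      exact (nrm_sq_le_mul (hf.pos t ht.le) (hf.K_smooth.sl ht) (hf.oddEnds hf.ε_pos.ne' ht) 0).trans
        (mul_le_mul (h0 ε hε Υ hs t ht htT) (Real.le_sqrt_of_sq_le (hB ε hε Υ hs t ht htT))
          (nrm_nonneg _ _) (by linarith))
    · exact uniformlyBounded_of_pos hB
  refine ⟨fun j δ hδ => ?_, low, fun hsm heven j => ?_⟩
  · obtain ⟨B, hB⟩ := exists_bound_of_pos hM T j δ hδ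
    refine ⟨B, fun ε hε Υ hs t ht => ?_⟩
    have ht0 : 0 ≤ t := hδ.le.trans ht.1
    obtain ⟨Lam, hf⟩ := hflow ε hε Υ hs
    rw [arcIntegral_eq (hs.speed_eq ht0) (hs.speed_pos ht0).le]
    exact hB ε _ _ Lam hf t ht
  · by_cases hj : j ≤ 2
    · exact low j hj
    obtain ⟨m, rfl⟩ : ∃ m, j = m + 2 := ⟨j - 2, by omega⟩
    have hκ : ContDiffOn ℝ ∞ (curvature c) I := contDiffOn_curvature hL hsm
    obtain ⟨B, hB⟩ := exists_bound_of_initial hT hM hflow m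
      (Smooth.contDiffOn hκ _) fun i _ he =>
        ⟨iterate_curvature_eq_zero hL hsm zero_mem_I (fun k hk => (heven k hk).1) he,
          iterate_curvature_eq_zero hL hsm one_mem_I (fun k hk => (heven k hk).2) he⟩
    exact uniformlyBounded_of_pos hB
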